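/- **Setting.** Let $f\in C^2(\mathbb R)$. Let $u$ be a continuous, compactly supported real function on $[0,\infty)\times\mathbb R$ which satisfies $\partial_t u+\partial_x f(u)=g_E$ in the sense of distributions on $(0,\infty)\times\mathbb R$, for some measurable $g_E$ with $|g_E|\le G$ almost everywhere. Put $\lambda=f'\circ u$. *Inflection values.* Let $D^+$ (resp. $D^-$) be the interior of the set of those $z$ for which there is $\bar h>0$ with $f(z+h)-f(z)\ge f'(z)h$ (resp. $\le$) for all $|h|\le\bar h$, and let $N=\mathbb R\setminus(D^+\cup D^-)$. (When $f$ is affine on no nontrivial interval, $N$ is the closure of the set of the points $z$ at which $f''(z)=0$ and $w\mapsto f(w)-f'(z)(w-z)$ has neither a local maximum nor a local minimum.) *Characteristics.* A characteristic curve of $u$ is a function $\gamma:I\to\mathbb R$ on a relatively open interval $I\subseteq[0,\infty)$ which is absolutely continuous on the compact subintervals of $I$ and satisfies $\dot\gamma(t)=\lambda(t,\gamma(t))$ for almost every $t\in I$; write $i_\gamma(t)=(t,\gamma(t))$. *The set to select from.* For $\delta>0$ let $\mathcal C_\delta$ be the set of all $(t,x,\Gamma)\in[\delta,\infty)\times\mathbb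 R\times C^1([-\delta,\delta])$ with $\Gamma(0)=x$ and $\dot\Gamma(s)=\lambda(t+s,\Gamma(s))$ on $[-\delta,\delta]$. Let $\mathcal G_\delta$ be the set of all $(t,x,\Gamma,\zeta)$ with $(t,x,\Gamma)\in\mathcal C_\delta$, $\zeta\in[-G,G]$ and $\zeta=\lim_{h\to0}\frac{u(t+h,\Gamma(h))-u(t,x)}{h}$. Let $E_\delta$ be its projection on the $(t,x)$-plane. *Souslin sources.* A Souslin selection is a map $E_\delta\ni(t,x)\mapsto(\Gamma_{t,x},\zeta_{t,x})$, measurable for the $\sigma$-algebra generated by the analytic sets, with $(t,x,\Gamma_{t,x},\zeta_{t,x})\in\mathcal G_\delta$. Its source is $\mathfrak g(t,x)=\zeta_{t,x}$ if $(t,x)\in E_\delta$ and $u(t,x)\notin N$, and $\mathfrak g(t,x)=0$ otherwise. *Borel sources.* For a sequence $\varepsilon_k>0$ with $\varepsilon_k\to0$, a Borel selection consists of a Borel set $S\supseteq E_\delta$ and Borel maps $S\ni(t,x)\mapsto(\Gamma^k_{t,x},\zeta^k_{t,x})$, $k\in\mathbb N$, such that $(t,x,\Gamma^k_{t,x})\in\mathcal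 C_\delta$, $|\zeta^k_{t,x}|\le G+\varepsilon_k$, and $\bigl|\zeta^k_{t,x}-\frac{u(t+h,\Gamma^k_{t,x}(h))-u(t,x)}{h}\bigr|<\varepsilon_k$ for all sufficiently small $h\ne0$. Its source is $\mathfrak g(t,x)=\liminf_k\zeta^k_{t,x}$ if $(t,x)\in S$ and $u(t,x)\notin N$, and $\mathfrak g(t,x)=0$ otherwise. **Theorem.** Assume (H): $\mathcal L^1(N)=0$. Let $\delta>0$ and let $\varepsilon_k>0$ with $\varepsilon_k\to0$. Then Souslin selections and Borel selections exist. The source of every Souslin selection is measurable for the $\sigma$-algebra generated by the analytic sets, and the source of every Borel selection is Borel. Let $\mathfrak g$ be the source of any Souslin or any Borel selection. Then $|\mathfrak g|\le G$, and for every characteristic curve $\gamma:I\to\mathbb R$ of $u$: 1. For almost every $t\in I$ with $t\ge\delta$, one has $i_\gamma(t)\in E_\delta$; if moreover $u(i_\gamma(t))\notin N$, then $\zeta=\mathfrak g(i_\gamma(t))$ for all $(\Gamma,\zeta)$ with $(i_\gamma(t),\Gamma,\zeta)\in\mathcal G_\delta$ (so $\mathfrak g\circ i_\gamma$ is well defined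 almost everywhere, independently of the selection). 2. For all $r\le s$ in $I$ with $r\ge\delta$, $\mathfrak g\circ i_\gamma$ is integrable on $[r,s]$ and $$u(i_\gamma(s))-u(i_\gamma(r))=\int_r^s\mathfrak g(i_\gamma(t))\,dt .$$ If $u=0$ on $[0,\delta]\times\mathbb R$, this holds for all $r\le s$ in $I$. 3. $\frac{d}{dt}u(i_\gamma(t))=\mathfrak g(i_\gamma(t))$ in the sense of distributions on $I\cap(\delta,\infty)$, and on $I\cap(0,\infty)$ if $u=0$ on $[0,\delta]\times\mathbb R$. In particular $u$ is a broad solution on $(\delta,\infty)\times\mathbb R$ with the source of any Borel selection. Moreover there is one Borel function $\mathfrak g$ with $|\mathfrak g|\le G$ on the whole plane for which the identity in 2 holds, for every characteristic curve $\gamma: I\to\mathbb R$, for all $r\le s$ in $I$ (including $r=0$), and for which $u$ is a broad solution on $(0,\infty)\times\mathbb R$: the equation in 3 holds on $I\cap(0,\infty)$ for every characteristic curve. -/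

import Mathlib

open Set Filter Topology MeasureTheory
open scoped ContDiff

noncomputable section

namespace BalanceLaw

/-- The closed half plane of points `(t, x)` with `0 ≤ t`. -/
def halfPlane : Set (ℝ × ℝ) := {p | 0 ≤ p.1}

/-- The open half plane of points `(t, x)` with `a < t`. -/
def openHalfPlane (a : ℝ) : Set (ℝ × ℝ) := {p | a < p.1}

/-- The interior of the set of points at which the tangent line supports the graph of `f`
locally from below. -/
def convexRegion (f : ℝ → ℝ) : Set ℝ :=
  interior {z | ∃ h₀ > 0, ∀ h ∈ Icc (-h₀) h₀, deriv f z * h ≤ f (z + h) - f z}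

/-- The interior of the set of points at which the tangent line supports the graph of `f`
locally from above. -/
def concaveRegion (f : ℝ → ℝ) : Set ℝ :=
  interior {z | ∃ h₀ > 0, ∀ h ∈ Icc (-h₀) h₀, f (z + h) - f z ≤ deriv f z * h}

/-- The closed set `N` of inflection values of the flux: the complement of the two open regions in
which `f` is locally convex, respectively locally concave. -/
def inflectionSet (f : ℝ → ℝ) : Set ℝ := (convexRegion f ∪ concaveRegion f)ᶜ

/-- `u` solves `∂ₜ u + ∂ₓ f(u) = g` in the sense of distributions on the open set `Ω`. -/
def IsDistributionalSolution (f : ℝ → ℝ) (u g : ℝ × ℝ → ℝ) (Ω : Set (ℝ × ℝ)) : Prop :=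
  ∀ φ : ℝ × ℝ → ℝ, ContDiff ℝ ∞ φ → HasCompactSupport φ → tsupport φ ⊆ Ω →
    ∫ p in Ω, (fderiv ℝ φ p (1, 0) * u p + fderiv ℝ φ p (0, 1) * f (u p)) =
      - ∫ p in Ω, φ p * g p

/-- The function `γ`, considered on the (relatively open) interval `I` of `[0, ∞)`, is a
characteristic curve of `u`: it is absolutely continuous on the compact subintervals of `I` and
`γ'(t) = f'(u(t, γ(t)))` for almost every `t ∈ I`. Values of `γ` outside `I` play no role. -/
structure IsCharacteristic (f : ℝ → ℝ) (u : ℝ × ℝ → ℝ) (I : Set ℝ) (γ : ℝ → ℝ) : Prop where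
  ordConnected : I.OrdConnected
  relOpen : ∃ O : Set ℝ, IsOpen O ∧ I = O ∩ Ici 0
  absCont : ∀ a ∈ I, ∀ b ∈ I, a ≤ b → AbsolutelyContinuousOnInterval γ a b
  ode : ∀ᵐ t : ℝ, t ∈ I → HasDerivAt γ (deriv f (u (t, γ t))) t

/-- The equation `d/dt u(t, γ(t)) = g(t, γ(t))` holds in the sense of distributions on
`{t ∈ I | (t, γ(t)) ∈ Ω}` for every characteristic curve `γ : I → ℝ` of `u`. -/
def SolvesAlongCharacteristics (f : ℝ → ℝ) (u g : ℝ × ℝ → ℝ) (Ω : Set (ℝ × ℝ)) : Prop :=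
  ∀ (I : Set ℝ) (γ : ℝ → ℝ), IsCharacteristic f u I γ →
    ∀ φ : ℝ → ℝ, ContDiff ℝ ∞ φ → HasCompactSupport φ → tsupport φ ⊆ {t ∈ I | (t, γ t) ∈ Ω} →
      ∫ t, deriv φ t * u (t, γ t) = - ∫ t, φ t * g (t, γ t)

/-- `u` is a continuous broad solution on `Ω` whose source is the class of the bounded Borel
function `g`. -/
structure IsBroadSolution (f : ℝ → ℝ) (u g : ℝ × ℝ → ℝ) (Ω : Set (ℝ × ℝ)) : Prop where
  continuousOn : ContinuousOn u Ω
  borel : Measurable g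
  bounded : ∃ C : ℝ, ∀ p ∈ Ω, |g p| ≤ C
  solves : SolvesAlongCharacteristics f u g Ω

/-- The value at `s` of a function on `[-δ, δ]` (with junk value `0` outside the interval). -/
def curveVal {δ : ℝ} (c : C(Icc (-δ) δ, ℝ)) (s : ℝ) : ℝ :=
  open scoped Classical in if h : s ∈ Icc (-δ) δ then c ⟨s, h⟩ else 0

/-- The space `C¹([-δ, δ]; ℝ)`, as the space of pairs (function, derivative) with the topology of
uniform convergence of both. -/
abbrev C1Curve (δ : ℝ) : Type :=
  {c : C(Icc (-δ) δ, ℝ) × C(Icc (-δ) δ, ℝ) //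
    ∀ s : Icc (-δ) δ, HasDerivWithinAt (curveVal c.1) (c.2 s) (Icc (-δ) δ) s}

/-- The value of a `C¹` curve at time `s ∈ [-δ, δ]`. -/
def C1Curve.val {δ : ℝ} (Γ : C1Curve δ) (s : ℝ) : ℝ := curveVal Γ.1.1 s

/-- The derivative of a `C¹` curve at time `s ∈ [-δ, δ]`. -/
def C1Curve.der {δ : ℝ} (Γ : C1Curve δ) (s : ℝ) : ℝ := curveVal Γ.1.2 s

/-- Pairs of a point `(t, x)` with `t ≥ δ` and a time-translated characteristic through it,
defined on `[-δ, δ]`. -/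
def translatedChar (f : ℝ → ℝ) (u : ℝ × ℝ → ℝ) (δ : ℝ) : Set ((ℝ × ℝ) × C1Curve δ) :=
  {q | δ ≤ q.1.1 ∧ q.2.val 0 = q.1.2 ∧
    ∀ s ∈ Icc (-δ) δ, q.2.der s = deriv f (u (q.1.1 + s, q.2.val s))}

/-- The difference quotient at `p = (t, x)` of `u` along the time-translated curve `Γ`. -/
def quotAlong (u : ℝ × ℝ → ℝ) {δ : ℝ} (p : ℝ × ℝ) (Γ : C1Curve δ) (h : ℝ) : ℝ :=
  (u (p.1 + h, Γ.val h) - u p) / h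

/-- The set `𝒢` of all `((t, x), Γ, ζ)` with `t ≥ δ`, where `Γ` is a time-translated characteristic
through `(t, x)` and `ζ ∈ [-G, G]` is the derivative of `u` along `Γ` at `(t, x)`. -/
def derivGraph (f : ℝ → ℝ) (u : ℝ × ℝ → ℝ) (G δ : ℝ) : Set ((ℝ × ℝ) × C1Curve δ × ℝ) :=
  {q | (q.1, q.2.1) ∈ translatedChar f u δ ∧ q.2.2 ∈ Icc (-G) G ∧
    Tendsto (quotAlong u q.1 q.2.1) (𝓝[≠] 0) (𝓝 q.2.2)}

/-- The projection `E` of `𝒢` on the `(t, x)` plane. -/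
def derivSet (f : ℝ → ℝ) (u : ℝ × ℝ → ℝ) (G δ : ℝ) : Set (ℝ × ℝ) :=
  Prod.fst '' derivGraph f u G δ

/-- The `σ`-algebra on the plane generated by the analytic (Souslin) sets. -/
abbrev souslinSpace : MeasurableSpace (ℝ × ℝ) :=
  MeasurableSpace.generateFrom {s | AnalyticSet s}

/-- A selection of `𝒢` over `E`, measurable for the `σ`-algebra generated by the analytic sets. -/
structure IsSouslinSelection (f : ℝ → ℝ) (u : ℝ × ℝ → ℝ) (G δ : ℝ)
    (σ : derivSet f u G δ → C1Curve δ × ℝ) : Prop where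
  measurable :
    @Measurable _ _ (souslinSpace.comap Subtype.val) (borel (C1Curve δ × ℝ)) σ
  mem : ∀ p : derivSet f u G δ, ((p : ℝ × ℝ), σ p) ∈ derivGraph f u G δ

/-- The source defined by a selection of `𝒢`: the selected derivative of `u` on
`E \ u⁻¹(N)`, and `0` elsewhere. -/
def selectedSource (f : ℝ → ℝ) (u : ℝ × ℝ → ℝ) {G δ : ℝ}
    (σ : derivSet f u G δ → C1Curve δ × ℝ) (p : ℝ × ℝ) : ℝ :=
  open scoped Classical in
  if h : p ∈ derivSet f u G δ ∧ u p ∉ inflectionSet f then (σ ⟨p, h.1⟩).2 else 0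

/-- A sequence of Borel selections of approximate derivatives of `u`, over a Borel set `S`
containing `E`: the `k`-th one selects a time-translated characteristic and a number that is
`ε k`-close to all sufficiently short difference quotients of `u` along this characteristic. -/
structure IsBorelSelection (f : ℝ → ℝ) (u : ℝ × ℝ → ℝ) (G δ : ℝ) (ε : ℕ → ℝ)
    (S : Set (ℝ × ℝ)) (σ : ℕ → S → C1Curve δ × ℝ) : Prop where
  measurableSet : MeasurableSet S
  subset : derivSet f u G δ ⊆ S
  measurable : ∀ k, @Measurable _ _ _ (borel (C1Curve δ × ℝ)) (σ k)
  mem : ∀ k (p : S), ((p : ℝ × ℝ), (σ k p).1) ∈ translatedChar f u δ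
  bound : ∀ k (p : S), (σ k p).2 ∈ Icc (-G - ε k) (G + ε k)
  approx : ∀ k (p : S), ∀ᶠ h in 𝓝[≠] (0 : ℝ),
    |(σ k p).2 - quotAlong u (p : ℝ × ℝ) (σ k p).1 h| < ε k

/-- The source defined by a sequence of approximate selections: the lower limit of the selected
numbers on `S \ u⁻¹(N)`, and `0` elsewhere. -/
def limitSource (f : ℝ → ℝ) (u : ℝ × ℝ → ℝ) {δ : ℝ} {S : Set (ℝ × ℝ)}
    (σ : ℕ → S → C1Curve δ × ℝ) (p : ℝ × ℝ) : ℝ :=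
  open scoped Classical in
  if h : p ∈ S ∧ u p ∉ inflectionSet f then
    liminf (fun k => (σ k ⟨p, h.1⟩).2) atTop
  else 0

/-- Along every characteristic curve `γ : I → ℝ`, the function `g ∘ i_γ` is integrable on
`[r, s]` and its integral is the increment of `u`, for all `r ≤ s` in `I` with `a ≤ r`. -/
def IntegratesAlongCharacteristics (f : ℝ → ℝ) (u g : ℝ × ℝ → ℝ) (a : ℝ) : Prop :=
  ∀ (I : Set ℝ) (γ : ℝ → ℝ), IsCharacteristic f u I γ →
    ∀ r ∈ I, ∀ s ∈ I, a ≤ r → r ≤ s →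
      IntervalIntegrable (fun t => g (t, γ t)) volume r s ∧
      u (s, γ s) - u (r, γ r) = ∫ t in r..s, g (t, γ t)

/-- Along every characteristic curve `γ : I → ℝ`, for almost every time `t ≥ δ` of `I`, the point
`(t, γ(t))` belongs to `E` and, if `u(t, γ(t)) ∉ N`, then `g(t, γ(t))` is the derivative
of `u` at this point along every characteristic through it along which the derivative exists. -/
def WellDefinedAlongCharacteristics (f : ℝ → ℝ) (u g : ℝ × ℝ → ℝ) (G δ : ℝ) : Prop :=
  ∀ (I : Set ℝ) (γ : ℝ → ℝ), IsCharacteristic f u I γ →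
    ∀ᵐ t : ℝ, t ∈ I → δ ≤ t →
      (t, γ t) ∈ derivSet f u G δ ∧
      (u (t, γ t) ∉ inflectionSet f →
        ∀ (Γ : C1Curve δ) (ζ : ℝ), ((t, γ t), Γ, ζ) ∈ derivGraph f u G δ → ζ = g (t, γ t))

/-- `g` is a universal source for `u`: it is bounded by `G`, well defined almost everywhere along
every characteristic curve, and it is the derivative of `u` along every characteristic curve,
from time `δ` on, and from time `0` on if `u` vanishes up to time `δ`. -/
structure IsUniversalSource (f : ℝ → ℝ) (u : ℝ × ℝ → ℝ) (G δ : ℝ) (g : ℝ × ℝ → ℝ) : Prop where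
  bounded : ∀ p, |g p| ≤ G
  wellDefined : WellDefinedAlongCharacteristics f u g G δ
  integrates : IntegratesAlongCharacteristics f u g δ
  solves : SolvesAlongCharacteristics f u g (openHalfPlane δ)
  integrates_zero : (∀ p : ℝ × ℝ, 0 ≤ p.1 → p.1 ≤ δ → u p = 0) →
    IntegratesAlongCharacteristics f u g 0
  solves_zero : (∀ p : ℝ × ℝ, 0 ≤ p.1 → p.1 ≤ δ → u p = 0) →
    SolvesAlongCharacteristics f u g (openHalfPlane 0)

end BalanceLaw

end

noncomputable section

namespace BalanceLaw

/-! The proof has three independent ingredients.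

Lipschitz bound. Mollification turns the equation into classical inequalities `|∂ₜ U + ∂ₓ W| ≤ G`.
Integrating over the strip between a characteristic `γ` and its translate `γ + ε` and passing to the
limit bounds the increment of the mass of `u` in the strip plus a flux term by `G |ε| (s - r)`.
Since `γ' = f'(u)`, the integrand of the flux term is the deviation of `f` from its tangent line,
which has a sign as long as `u` stays near a value outside `N`. Dropping it and letting `ε` tend to
`0` from both sides shows that `u` is locally `G`-Lipschitz along `γ` off `u⁻¹(N)`. As `N` is null,
almost all values between `u` at two times of `γ` are taken at such good times, so the bound is
global (`IsCharacteristic.abs_sub_le`). Hence `u` is differentiable at almost every time of `γ`, and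
the derivative vanishes almost everywhere on `u⁻¹(N)` (`ae_eq_zero_of_hasDerivAt_of_mem_null`).

Independence of the characteristic. Suppose that at a value outside `N` another characteristic `Γ`
touches `γ` and the difference quotients of `u` along `Γ` stay beyond a number `q` on the other side
of the derivative along `γ`. Monotonicity of `f'` forces `Γ` to stay on one side of `γ`. Two such
curves issued at nearby times from the same side would cross, and at the crossing `u` would lie both
strictly above and strictly below a line of slope `q`. So such times are isolated from the right for
fixed parameters, and countable altogether (`touchingTimes_separated`, `countable_setOf_separated`).
Any selected derivative is therefore the derivative along `γ` at almost every time of `γ` with value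
outside `N`.

Selection. Characteristics on `[-δ, δ]` through a compact set form a compact set of `C¹` curves, so
`derivGraph` is a countable intersection of σ-compact sets. It is analytic, and the
lexicographically least branch gives a Souslin selection. For a fixed precision the graph is
σ-compact and admits a Borel selection; the lower limit over the precisions is Borel. Peano's
theorem extends a short characteristic to `[-δ, δ]`, so almost every point of a characteristic after
time `δ` lies in `E`. -/

/-! ### Extension in time and mollification -/

/-- The extension of a function on the half plane which is constant in time for negative times. -/
def pastExtension (u : ℝ × ℝ → ℝ) (p : ℝ × ℝ) : ℝ := u (max p.1 0, p.2)

theorem continuous_pastExtension {u : ℝ × ℝ → ℝ} (hu : ContinuousOn u halfPlane) :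
    Continuous (pastExtension u) :=
  hu.comp_continuous (by fun_prop) fun p => by simp [halfPlane]

theorem pastExtension_of_nonneg (u : ℝ × ℝ → ℝ) {p : ℝ × ℝ} (hp : 0 ≤ p.1) :
    pastExtension u p = u p := by
  simp [pastExtension, max_eq_left hp]

theorem pastExtension_mk (u : ℝ × ℝ → ℝ) {t : ℝ} (ht : 0 ≤ t) (x : ℝ) :
    pastExtension u (t, x) = u (t, x) :=
  pastExtension_of_nonneg u (p := (t, x)) ht

theorem measurableSet_openHalfPlane (a : ℝ) : MeasurableSet (openHalfPlane a) :=
  measurableSet_lt measurable_const measurable_fst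

theorem fderiv_comp_const_sub {ρ : ℝ × ℝ → ℝ} (hρ : Differentiable ℝ ρ) (p q v : ℝ × ℝ) :
    fderiv ℝ (fun y => ρ (p - y)) q v = - fderiv ℝ ρ (p - q) v := by
  have h := (hρ (p - q)).hasFDerivAt.comp q ((hasFDerivAt_id q).const_sub p)
  have h' : fderiv ℝ (fun y => ρ (p - y)) q = _ := h.fderiv
  rw [h']
  simp

theorem fderiv_convolution_apply {ρ w : ℝ × ℝ → ℝ} (hc : HasCompactSupport ρ)
    (hρ : ContDiff ℝ 1 ρ) (hw : Continuous w) (p v : ℝ × ℝ) :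
    fderiv ℝ (convolution ρ w (ContinuousLinearMap.lsmul ℝ ℝ) volume) p v =
      ∫ q, fderiv ℝ ρ (p - q) v * w q := by
  rw [(hc.hasFDerivAt_convolution_left (ContinuousLinearMap.lsmul ℝ ℝ) hρ
    hw.locallyIntegrable p).fderiv, convolution_eq_swap]
  have hi : Integrable (fun q => (ContinuousLinearMap.precompL (ℝ × ℝ)
      (ContinuousLinearMap.lsmul ℝ ℝ : ℝ →L[ℝ] ℝ →L[ℝ] ℝ)) (fderiv ℝ ρ (p - q)) (w q)) := by
    have := (hc.fderiv ℝ).convolutionExists_left (ContinuousLinearMap.precompL (ℝ × ℝ)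
      (ContinuousLinearMap.lsmul ℝ ℝ : ℝ →L[ℝ] ℝ →L[ℝ] ℝ)) (μ := volume)
      (hρ.continuous_fderiv one_ne_zero) hw.locallyIntegrable p
    exact this.integrable_swap
  rw [ContinuousLinearMap.integral_apply hi]
  simp [ContinuousLinearMap.precompL_apply]

theorem nonneg_of_ae_bound {g : ℝ × ℝ → ℝ} {G : ℝ}
    (hgG : ∀ᵐ p ∂(volume.restrict (openHalfPlane 0)), |g p| ≤ G) : 0 ≤ G := by
  by_contra hneg
  push Not at hneg
  have hbad : ∀ᵐ q ∂(volume.restrict (openHalfPlane 0)), False := by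
    filter_upwards [hgG] with q hq
    linarith [abs_nonneg (g q)]
  have hz : volume.restrict (openHalfPlane 0) = 0 :=
    ae_eq_bot.1 (eventually_false_iff_eq_bot.1 hbad)
  rw [Measure.restrict_eq_zero] at hz
  have ho : IsOpen (openHalfPlane 0) := isOpen_lt continuous_const continuous_fst
  exact (ho.measure_pos volume ⟨(1, 0), by simp [openHalfPlane]⟩).ne' hz

/-- A continuous solution of `∂ₜ u + ∂ₓ w = g` with `|g| ≤ G` can be approximated locally uniformly
by continuously differentiable solutions of such equations. -/
theorem exists_smooth_approximation {u w g : ℝ × ℝ → ℝ} (hu : Continuous u) (hw : Continuous w)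
    {G : ℝ} (hgG : ∀ᵐ p ∂(volume.restrict (openHalfPlane 0)), |g p| ≤ G)
    (hsol : ∀ φ : ℝ × ℝ → ℝ, ContDiff ℝ ∞ φ → HasCompactSupport φ → tsupport φ ⊆ openHalfPlane 0 →
      ∫ p in openHalfPlane 0, (fderiv ℝ φ p (1, 0) * u p + fderiv ℝ φ p (0, 1) * w p) =
        - ∫ p in openHalfPlane 0, φ p * g p)
    {r : ℝ} (hr : 0 < r) {K : Set (ℝ × ℝ)} (hK : IsCompact K) (hKr : ∀ p ∈ K, r ≤ p.1)
    {η : ℝ} (hη : 0 < η) :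
    ∃ U W : ℝ × ℝ → ℝ, ContDiff ℝ 1 U ∧ ContDiff ℝ 1 W ∧ ∀ p ∈ K, |U p - u p| ≤ η ∧
      |W p - w p| ≤ η ∧ |fderiv ℝ U p (1, 0) + fderiv ℝ W p (0, 1)| ≤ G := by
  have unif : ∀ {v : ℝ × ℝ → ℝ}, Continuous v → ∃ d > 0, ∀ p ∈ K, ∀ q, dist p q < d →
      dist (v q) (v p) ≤ η := by
    intro v hv
    have := hK.uniformContinuousAt_of_continuousAt v (fun a _ => hv.continuousAt)
      (Metric.dist_mem_uniformity hη)
    obtain ⟨d, hd, h⟩ := Metric.mem_uniformity_dist.1 this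
    exact ⟨d, hd, fun p hp q hq => by rw [dist_comm]; exact (h hq hp).le⟩
  obtain ⟨d₁, hd₁, h₁⟩ := unif hu
  obtain ⟨d₂, hd₂, h₂⟩ := unif hw
  -- `d₁` and `d₂` make the mollification `η`-close on `K`; `r / 2` keeps the kernel centred at a
  -- point of `K` inside `t > 0`, where the equation may be tested.
  set R := min (min d₁ d₂) (r / 2) with hR
  have hRpos : 0 < R := by positivity
  let b : ContDiffBump (0 : ℝ × ℝ) := ⟨R / 2, R, by positivity, by linarith⟩
  set ρ := b.normed volume with hρdef
  have hρc : HasCompactSupport ρ := b.hasCompactSupport_normed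
  have hρs : ContDiff ℝ ∞ ρ := b.contDiff_normed
  have hρ1 : ContDiff ℝ 1 ρ := hρs.of_le (by exact_mod_cast le_top)
  have hρd : Differentiable ℝ ρ := hρ1.differentiable one_ne_zero
  refine ⟨convolution ρ u (ContinuousLinearMap.lsmul ℝ ℝ) volume,
    convolution ρ w (ContinuousLinearMap.lsmul ℝ ℝ) volume,
    hρc.contDiff_convolution_left _ hρ1 hu.locallyIntegrable,
    hρc.contDiff_convolution_left _ hρ1 hw.locallyIntegrable, fun p hp => ⟨?_, ?_, ?_⟩⟩
  · refine b.dist_normed_convolution_le hu.aestronglyMeasurable fun q hq => h₁ p hp q ?_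
    rw [dist_comm]
    exact (Metric.mem_ball.1 hq).trans_le ((min_le_left _ _).trans (min_le_left _ _))
  · refine b.dist_normed_convolution_le hw.aestronglyMeasurable fun q hq => h₂ p hp q ?_
    rw [dist_comm]
    exact (Metric.mem_ball.1 hq).trans_le ((min_le_left _ _).trans (min_le_right _ _))
  rw [fderiv_convolution_apply hρc hρ1 hu, fderiv_convolution_apply hρc hρ1 hw]
  -- With the reflected kernel as test function, the weak equation becomes a formula for `∂ₜ U + ∂ₓ
  -- W` at `p`: the mean of `g` against a probability density.
  set φ : ℝ × ℝ → ℝ := fun q => ρ (p - q) with hφ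
  have hφs : ContDiff ℝ ∞ φ := hρs.comp (contDiff_const.sub contDiff_id)
  have hzero : ∀ q, R < dist p q → ρ (p - q) = 0 := by
    intro q hq
    by_contra h
    have : p - q ∈ Function.support ρ := h
    rw [b.support_normed_eq] at this
    have h2 : dist p q < R := by simpa [dist_eq_norm] using this
    linarith
  have hts : tsupport φ ⊆ Metric.closedBall p R := by
    refine closure_minimal (fun q hq => ?_) Metric.isClosed_closedBall
    by_contra h
    exact hq (hzero q (by simpa [dist_comm] using h))
  have hsub : tsupport φ ⊆ openHalfPlane 0 := by
    intro q hq
    have h := hts hq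
    have h1 : dist q.1 p.1 ≤ R := (le_max_left _ _).trans (Metric.mem_closedBall.1 h)
    have h2 : R ≤ r / 2 := min_le_right _ _
    have h3 := hKr p hp
    rw [Real.dist_eq, abs_le] at h1
    show 0 < q.1
    linarith [h1.1]
  have hφc : HasCompactSupport φ := (isCompact_closedBall p R).of_isClosed_subset
    (isClosed_tsupport φ) hts
  have hφ1 : ContDiff ℝ 1 φ := hφs.of_le (by exact_mod_cast le_top)
  have key := hsol φ hφs hφc hsub
  have int_mul : ∀ {v : ℝ × ℝ → ℝ} (e : ℝ × ℝ), Continuous v →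
      Integrable (fun q => fderiv ℝ φ q e * v q) := by
    intro v e hv
    refine Continuous.integrable_of_hasCompactSupport ?_ ?_
    · exact ((hφ1.continuous_fderiv one_ne_zero).clm_apply continuous_const).mul hv
    · exact (hφc.fderiv_apply ℝ e).mul_right
  have hset : ∫ q in openHalfPlane 0, (fderiv ℝ φ q (1, 0) * u q + fderiv ℝ φ q (0, 1) * w q) =
      ∫ q, (fderiv ℝ φ q (1, 0) * u q + fderiv ℝ φ q (0, 1) * w q) := by
    refine setIntegral_eq_integral_of_forall_compl_eq_zero fun q hq => ?_
    have : fderiv ℝ φ q = 0 := by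
      by_contra h
      exact hq (hsub (support_fderiv_subset (f := φ) ℝ (Function.mem_support.2 h)))
    simp [this]
  rw [hset, integral_add (int_mul _ hu) (int_mul _ hw)] at key
  simp only [hφ, fderiv_comp_const_sub hρd, neg_mul, integral_neg] at key
  have key' : (∫ q, fderiv ℝ ρ (p - q) (1, 0) * u q) + ∫ q, fderiv ℝ ρ (p - q) (0, 1) * w q =
      ∫ q in openHalfPlane 0, ρ (p - q) * g q := by linarith
  rw [key']
  have hρi : Integrable (fun q => ρ (p - q)) :=
    (hφ1.continuous).integrable_of_hasCompactSupport hφc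
  have hG0 : 0 ≤ G := nonneg_of_ae_bound hgG
  rw [← Real.norm_eq_abs]
  calc ‖∫ q in openHalfPlane 0, ρ (p - q) * g q‖
      ≤ ∫ q in openHalfPlane 0, ρ (p - q) * G := by
        refine norm_integral_le_of_norm_le (hρi.integrableOn.mul_const G) ?_
        filter_upwards [hgG] with q hq
        rw [norm_mul, Real.norm_of_nonneg (b.nonneg_normed _)]
        exact mul_le_mul_of_nonneg_left hq (b.nonneg_normed _)
    _ ≤ ∫ q, ρ (p - q) * G := by
        refine setIntegral_le_integral (hρi.mul_const G) (Eventually.of_forall fun q => ?_)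
        exact mul_nonneg (b.nonneg_normed _) hG0
    _ = G := by
        rw [integral_mul_const, integral_sub_left_eq_self (fun q => ρ q) volume p,
          b.integral_normed, one_mul]

/-- `u` and `w` are locally uniform limits of `C¹` functions `U` and `W` with
`|∂ₜ U + ∂ₓ W| ≤ G`. -/
def HasSmoothApproximations (u w : ℝ × ℝ → ℝ) (G : ℝ) : Prop :=
  ∀ r > 0, ∀ K : Set (ℝ × ℝ), IsCompact K → (∀ p ∈ K, r ≤ p.1) → ∀ η > 0,
    ∃ U W : ℝ × ℝ → ℝ, ContDiff ℝ 1 U ∧ ContDiff ℝ 1 W ∧ ∀ p ∈ K, |U p - u p| ≤ η ∧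
      |W p - w p| ≤ η ∧ |fderiv ℝ U p (1, 0) + fderiv ℝ W p (0, 1)| ≤ G

/-! ### Balance over the strip between two parallel curves -/

/-- The increment of the amount of `u` between the curves `γ` and `γ + ε`, corrected by the
flux through these curves. -/
def stripBalance (u w : ℝ × ℝ → ℝ) (γ β : ℝ → ℝ) (r s ε : ℝ) : ℝ :=
  (∫ y in (0 : ℝ)..ε, (u (s, γ s + y) - u (r, γ r + y))) +
    ∫ t in r..s, (w (t, γ t + ε) - w (t, γ t) - β t * (u (t, γ t + ε) - u (t, γ t)))

/-- Green's formula in the coordinates `(t, y)` with `x = γ t + y`. The time derivative at fixed `y`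
contains the extra term `β ∂ₓ U`, whose integral over `y` is cancelled by the last term of the flux.
-/
theorem stripBalance_of_contDiff {U W : ℝ × ℝ → ℝ} (hU : ContDiff ℝ 1 U) (hW : ContDiff ℝ 1 W)
    {γ β : ℝ → ℝ} (hγ : ∀ t, HasDerivAt γ (β t) t) (hβ : Continuous β) (r s ε : ℝ) :
    stripBalance U W γ β r s ε = ∫ t in r..s, ∫ y in (0 : ℝ)..ε,
      (fderiv ℝ U (t, γ t + y) (1, 0) + fderiv ℝ W (t, γ t + y) (0, 1)) := by
  have hγc : Continuous γ := continuous_iff_continuousAt.2 fun t => (hγ t).continuousAt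
  have cU := hU.continuous_fderiv one_ne_zero
  have cW := hW.continuous_fderiv one_ne_zero
  have dU : ∀ p, HasFDerivAt U (fderiv ℝ U p) p := fun p =>
    (hU.differentiable one_ne_zero p).hasFDerivAt
  have dW : ∀ p, HasFDerivAt W (fderiv ℝ W p) p := fun p =>
    (hW.differentiable one_ne_zero p).hasFDerivAt
  have split : ∀ (L : ℝ × ℝ →L[ℝ] ℝ) (b : ℝ), L (1, b) = L (1, 0) + b * L (0, 1) := by
    intro L b
    have : ((1, b) : ℝ × ℝ) = (1, 0) + b • (0, 1) := by simp
    rw [this, map_add, map_smul, smul_eq_mul]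
  have along : ∀ y t, HasDerivAt (fun t => U (t, γ t + y))
      (fderiv ℝ U (t, γ t + y) (1, 0) + β t * fderiv ℝ U (t, γ t + y) (0, 1)) t := by
    intro y t
    rw [← split]
    exact (dU (t, γ t + y)).comp_hasDerivAt t ((hasDerivAt_id t).prodMk ((hγ t).add_const y))
  have across : ∀ {V : ℝ × ℝ → ℝ}, (∀ p, HasFDerivAt V (fderiv ℝ V p) p) → ∀ t y,
      HasDerivAt (fun y => V (t, γ t + y)) (fderiv ℝ V (t, γ t + y) (0, 1)) y := by
    intro V dV t y
    exact (dV (t, γ t + y)).comp_hasDerivAt y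
      ((hasDerivAt_const y t).prodMk ((hasDerivAt_id y).const_add (γ t)))
  have e1 : ∀ y, U (s, γ s + y) - U (r, γ r + y) = ∫ t in r..s,
      (fderiv ℝ U (t, γ t + y) (1, 0) + β t * fderiv ℝ U (t, γ t + y) (0, 1)) := by
    intro y
    rw [intervalIntegral.integral_eq_sub_of_hasDerivAt (fun t _ => along y t)]
    exact Continuous.intervalIntegrable (by fun_prop) _ _
  have e2 : ∀ {V : ℝ × ℝ → ℝ}, (∀ p, HasFDerivAt V (fderiv ℝ V p) p) → Continuous (fderiv ℝ V) →
      ∀ t, V (t, γ t + ε) - V (t, γ t) = ∫ y in (0 : ℝ)..ε, fderiv ℝ V (t, γ t + y) (0, 1) := by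
    intro V dV cV t
    rw [intervalIntegral.integral_eq_sub_of_hasDerivAt (fun y _ => across dV t y), add_zero]
    exact Continuous.intervalIntegrable (by fun_prop) _ _
  have swap : (∫ y in (0 : ℝ)..ε, (U (s, γ s + y) - U (r, γ r + y))) =
      ∫ t in r..s, ∫ y in (0 : ℝ)..ε,
        (fderiv ℝ U (t, γ t + y) (1, 0) + β t * fderiv ℝ U (t, γ t + y) (0, 1)) := by
    simp only [e1]
    refine intervalIntegral_intervalIntegral_swap ?_
    refine IntegrableOn.mono_set ?_ (prod_mono uIoc_subset_uIcc uIoc_subset_uIcc)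
    refine ContinuousOn.integrableOn_compact (isCompact_uIcc.prod isCompact_uIcc) ?_
    refine Continuous.continuousOn ?_
    unfold Function.uncurry
    fun_prop
  unfold stripBalance
  rw [swap, ← intervalIntegral.integral_add]
  · refine intervalIntegral.integral_congr fun t _ => ?_
    rw [e2 dW cW, e2 dU cU, ← intervalIntegral.integral_const_mul,
      ← intervalIntegral.integral_sub, ← intervalIntegral.integral_add]
    · refine intervalIntegral.integral_congr fun y _ => ?_
      ring
    all_goals exact Continuous.intervalIntegrable (by fun_prop) _ _
  · refine Continuous.intervalIntegrable ?_ _ _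
    refine intervalIntegral.continuous_parametric_intervalIntegral_of_continuous' ?_ _ _
    unfold Function.uncurry
    fun_prop
  · have := hU.continuous
    have := hW.continuous
    exact Continuous.intervalIntegrable (by fun_prop) _ _

/-- No derivatives of `u` and `w` enter `stripBalance`, so it is stable under uniform convergence on
the strip; this carries the classical bound over to continuous solutions. -/
theorem abs_stripBalance_sub_le {u w U W : ℝ × ℝ → ℝ} (hu : Continuous u) (hw : Continuous w)
    (hU : Continuous U) (hW : Continuous W) {γ β : ℝ → ℝ} (hγ : Continuous γ) (hβ : Continuous β)
    {r s ε η M : ℝ} (hrs : r ≤ s) (hM : ∀ t ∈ Icc r s, |β t| ≤ M)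
    (hUu : ∀ t ∈ Icc r s, ∀ y ∈ uIcc 0 ε, |U (t, γ t + y) - u (t, γ t + y)| ≤ η)
    (hWw : ∀ t ∈ Icc r s, ∀ y ∈ uIcc 0 ε, |W (t, γ t + y) - w (t, γ t + y)| ≤ η) :
    |stripBalance U W γ β r s ε - stripBalance u w γ β r s ε| ≤
      η * (2 * |ε| + (2 + 2 * M) * (s - r)) := by
  have h0 : (0 : ℝ) ∈ uIcc 0 ε := left_mem_uIcc
  have hε : ε ∈ uIcc 0 ε := right_mem_uIcc
  have e : stripBalance U W γ β r s ε - stripBalance u w γ β r s ε =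
      (∫ y in (0 : ℝ)..ε, ((U (s, γ s + y) - u (s, γ s + y)) - (U (r, γ r + y) - u (r, γ r + y)))) +
      ∫ t in r..s, ((W (t, γ t + ε) - w (t, γ t + ε)) - (W (t, γ t) - w (t, γ t)) -
        β t * ((U (t, γ t + ε) - u (t, γ t + ε)) - (U (t, γ t) - u (t, γ t)))) := by
    unfold stripBalance
    rw [add_sub_add_comm, ← intervalIntegral.integral_sub, ← intervalIntegral.integral_sub]
    · congr 1 <;> refine intervalIntegral.integral_congr fun t _ => ?_ <;> ring
    all_goals exact Continuous.intervalIntegrable (by fun_prop) _ _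
  have b1 : ‖∫ y in (0 : ℝ)..ε,
      ((U (s, γ s + y) - u (s, γ s + y)) - (U (r, γ r + y) - u (r, γ r + y)))‖ ≤
      2 * η * |ε - 0| := by
    refine intervalIntegral.norm_integral_le_of_norm_le_const fun y hy => ?_
    have hy' := uIoc_subset_uIcc hy
    have h1 := hUu s (right_mem_Icc.2 hrs) y hy'
    have h2 := hUu r (left_mem_Icc.2 hrs) y hy'
    rw [Real.norm_eq_abs]
    exact (abs_sub _ _).trans (by linarith)
  have b2 : ‖∫ t in r..s, ((W (t, γ t + ε) - w (t, γ t + ε)) - (W (t, γ t) - w (t, γ t)) -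
        β t * ((U (t, γ t + ε) - u (t, γ t + ε)) - (U (t, γ t) - u (t, γ t))))‖ ≤
      (η + η + M * (η + η)) * |s - r| := by
    refine intervalIntegral.norm_integral_le_of_norm_le_const fun t ht => ?_
    have ht' : t ∈ Icc r s := by rw [← uIcc_of_le hrs]; exact uIoc_subset_uIcc ht
    have h1 := hUu t ht' ε hε
    have h2 := hUu t ht' 0 h0
    have h3 := hWw t ht' ε hε
    have h4 := hWw t ht' 0 h0
    simp only [add_zero] at h2 h4
    rw [Real.norm_eq_abs]
    refine (abs_sub _ _).trans (add_le_add ((abs_sub _ _).trans (add_le_add h3 h4)) ?_)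
    rw [abs_mul]
    exact mul_le_mul (hM t ht') ((abs_sub _ _).trans (add_le_add h1 h2)) (abs_nonneg _)
      ((abs_nonneg _).trans (hM t ht'))
  rw [e]
  rw [sub_zero, Real.norm_eq_abs] at b1
  rw [Real.norm_eq_abs, abs_of_nonneg (sub_nonneg.2 hrs)] at b2
  refine (abs_add_le _ _).trans ((add_le_add b1 b2).trans (le_of_eq ?_))
  ring

/-- The balance of a continuous solution over the strip between `γ` and `γ + ε`. -/
theorem HasSmoothApproximations.abs_stripBalance_le {u w : ℝ × ℝ → ℝ} {G : ℝ}
    (happ : HasSmoothApproximations u w G) (hu : Continuous u) (hw : Continuous w)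
    {γ β : ℝ → ℝ} (hγ : ∀ t, HasDerivAt γ (β t) t) (hβ : Continuous β)
    {r s : ℝ} (hr : 0 < r) (hrs : r ≤ s) (ε : ℝ) :
    |stripBalance u w γ β r s ε| ≤ G * |ε| * (s - r) := by
  have hγc : Continuous γ := continuous_iff_continuousAt.2 fun t => (hγ t).continuousAt
  obtain ⟨M, hM⟩ := isCompact_Icc.exists_bound_of_continuousOn (s := Icc r s) hβ.continuousOn
  have hM0 : 0 ≤ M := (norm_nonneg _).trans (hM r (left_mem_Icc.2 hrs))
  set K : Set (ℝ × ℝ) := (fun q : ℝ × ℝ => (q.1, γ q.1 + q.2)) '' (Icc r s ×ˢ uIcc 0 ε) with hK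
  have hKc : IsCompact K := (isCompact_Icc.prod isCompact_uIcc).image (by fun_prop)
  have hKr : ∀ p ∈ K, r ≤ p.1 := by
    rintro _ ⟨q, hq, rfl⟩
    exact hq.1.1
  have hKm : ∀ t ∈ Icc r s, ∀ y ∈ uIcc 0 ε, (t, γ t + y) ∈ K := fun t ht y hy =>
    ⟨(t, y), ⟨ht, hy⟩, rfl⟩
  -- An `η`-approximation changes the balance by at most `η * (D - 1)`; the added one keeps the
  -- divisor in `η = e / D` positive.
  set D := 2 * |ε| + (2 + 2 * M) * (s - r) + 1 with hD
  have hDpos : 0 < D := by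
    have := abs_nonneg ε
    have := mul_nonneg (by linarith : 0 ≤ 2 + 2 * M) (sub_nonneg.2 hrs)
    linarith
  refine le_of_forall_pos_le_add fun e he => ?_
  obtain ⟨U, W, hU, hW, h⟩ := happ r hr K hKc hKr (e / D) (by positivity)
  have h1 := abs_stripBalance_sub_le hu hw hU.continuous hW.continuous hγc hβ (ε := ε) hrs hM
    (fun t ht y hy => (h _ (hKm t ht y hy)).1) (fun t ht y hy => (h _ (hKm t ht y hy)).2.1)
  have h2 : |stripBalance U W γ β r s ε| ≤ G * |ε| * (s - r) := by
    rw [stripBalance_of_contDiff hU hW hγ hβ]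
    have := intervalIntegral.norm_integral_le_of_norm_le_const (a := r) (b := s) (C := G * |ε|)
      (f := fun t => ∫ y in (0 : ℝ)..ε,
        (fderiv ℝ U (t, γ t + y) (1, 0) + fderiv ℝ W (t, γ t + y) (0, 1))) (fun t ht => ?_)
    · rwa [abs_of_nonneg (sub_nonneg.2 hrs)] at this
    · have ht' : t ∈ Icc r s := by rw [← uIcc_of_le hrs]; exact uIoc_subset_uIcc ht
      have := intervalIntegral.norm_integral_le_of_norm_le_const (a := 0) (b := ε) (C := G)
        (f := fun y => fderiv ℝ U (t, γ t + y) (1, 0) + fderiv ℝ W (t, γ t + y) (0, 1))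
        (fun y hy => (h _ (hKm t ht' y (uIoc_subset_uIcc hy))).2.2)
      rwa [sub_zero] at this
  have h3 : e / D * (2 * |ε| + (2 + 2 * M) * (s - r)) ≤ e := by
    have : e / D * (2 * |ε| + (2 + 2 * M) * (s - r)) = e - e / D := by
      have hD' : 2 * |ε| + (2 + 2 * M) * (s - r) = D - 1 := by rw [hD]; ring
      rw [hD']
      field_simp
    rw [this]
    linarith [div_pos he hDpos]
  have h4 := abs_sub_abs_le_abs_sub (stripBalance u w γ β r s ε) (stripBalance U W γ β r s ε)
  rw [abs_sub_comm] at h4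
  linarith

/-- An upper bound on `Q` alone controls the derivative on both sides: it bounds the slopes from
above for `ε > 0` and from below for `ε < 0`. This is why one sign of the flux excess suffices for a
two-sided estimate. -/
theorem abs_deriv_le_of_le_mul_abs {Q : ℝ → ℝ} {d C : ℝ} (hQ : HasDerivAt Q d 0) (h0 : Q 0 = 0)
    (h : ∀ᶠ ε in 𝓝 (0 : ℝ), Q ε ≤ C * |ε|) : |d| ≤ C := by
  have hs := hasDerivAt_iff_tendsto_slope.1 hQ
  rw [abs_le]
  constructor
  · have hl : Tendsto (slope Q 0) (𝓝[<] 0) (𝓝 d) :=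
      hs.mono_left (nhdsWithin_mono _ fun x hx => ne_of_lt hx)
    refine ge_of_tendsto hl ?_
    filter_upwards [self_mem_nhdsWithin, nhdsWithin_le_nhds h] with ε hε hb
    have hε' : ε < 0 := hε
    rw [slope_def_field, h0, sub_zero, sub_zero, le_div_iff_of_neg hε']
    rw [abs_of_neg hε'] at hb
    linarith
  · have hl : Tendsto (slope Q 0) (𝓝[>] 0) (𝓝 d) :=
      hs.mono_left (nhdsWithin_mono _ fun x hx => ne_of_gt hx)
    refine le_of_tendsto hl ?_
    filter_upwards [self_mem_nhdsWithin, nhdsWithin_le_nhds h] with ε hε hb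
    have hε' : 0 < ε := hε
    rw [slope_def_field, h0, sub_zero, sub_zero, div_le_iff₀ hε']
    rwa [abs_of_pos hε'] at hb

/-- If the flux excess through the curves parallel to `γ` has a sign, then `u` is `G`-Lipschitz
along `γ`. -/
theorem HasSmoothApproximations.abs_sub_le_of_sign {u w : ℝ × ℝ → ℝ} {G : ℝ}
    (happ : HasSmoothApproximations u w G) (hu : Continuous u) (hw : Continuous w)
    {γ β : ℝ → ℝ} (hγ : ∀ t, HasDerivAt γ (β t) t) (hβ : Continuous β)
    {r s : ℝ} (hr : 0 < r) (hrs : r ≤ s)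
    (hsign : (∀ᶠ ε in 𝓝 (0 : ℝ), ∀ t ∈ Icc r s,
        0 ≤ w (t, γ t + ε) - w (t, γ t) - β t * (u (t, γ t + ε) - u (t, γ t))) ∨
      (∀ᶠ ε in 𝓝 (0 : ℝ), ∀ t ∈ Icc r s,
        w (t, γ t + ε) - w (t, γ t) - β t * (u (t, γ t + ε) - u (t, γ t)) ≤ 0)) :
    |u (s, γ s) - u (r, γ r)| ≤ G * (s - r) := by
  set Q : ℝ → ℝ := fun ε => ∫ y in (0 : ℝ)..ε, (u (s, γ s + y) - u (r, γ r + y)) with hQ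
  have hQd : HasDerivAt Q (u (s, γ s) - u (r, γ r)) 0 := by
    have hc : Continuous fun y => u (s, γ s + y) - u (r, γ r + y) := by fun_prop
    simpa using! intervalIntegral.integral_hasDerivAt_right (hc.intervalIntegrable 0 0)
      (hc.stronglyMeasurableAtFilter _ _) hc.continuousAt
  have hQ0 : Q 0 = 0 := by simp [hQ]
  have hstrip := happ.abs_stripBalance_le hu hw hγ hβ hr hrs
  rcases hsign with hsign | hsign
  -- `Q ε` plus a nonnegative integral is at most `G * |ε| * (s - r)`, so the integral can be
  -- dropped; with the opposite sign the same is done for `-Q`.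
  · refine abs_deriv_le_of_le_mul_abs hQd hQ0 ?_
    filter_upwards [hsign] with ε hε
    have h1 : 0 ≤ ∫ t in r..s,
        (w (t, γ t + ε) - w (t, γ t) - β t * (u (t, γ t + ε) - u (t, γ t))) :=
      intervalIntegral.integral_nonneg hrs hε
    have h2 := (abs_le.1 (hstrip ε)).2
    unfold stripBalance at h2
    simp only [hQ]
    linarith
  · rw [← abs_neg]
    refine abs_deriv_le_of_le_mul_abs hQd.neg (by simp [hQ0]) ?_
    filter_upwards [hsign] with ε hε
    have h1 : 0 ≤ ∫ t in r..s,
        -(w (t, γ t + ε) - w (t, γ t) - β t * (u (t, γ t + ε) - u (t, γ t))) :=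
      intervalIntegral.integral_nonneg hrs fun t ht => neg_nonneg.2 (hε t ht)
    rw [intervalIntegral.integral_neg] at h1
    have h2 := (abs_le.1 (hstrip ε)).1
    unfold stripBalance at h2
    simp only [Pi.neg_apply, hQ]
    linarith

/-! ### Sign of the flux excess at non-inflection values -/

/-- If `f''(z) < 0`, then `f' < f'(z)` just to the right of `z`, and by the mean value theorem the
graph falls strictly below the tangent there. -/
theorem deriv_deriv_nonneg_of_local_support {f : ℝ → ℝ} (hf : ContDiff ℝ 2 f) {z : ℝ}
    (hz : ∃ h₀ > 0, ∀ h ∈ Icc (-h₀) h₀, deriv f z * h ≤ f (z + h) - f z) :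
    0 ≤ deriv (deriv f) z := by
  by_contra hneg
  push Not at hneg
  obtain ⟨h₀, hh₀, hsup⟩ := hz
  have hf1 : Differentiable ℝ f := hf.differentiable two_ne_zero
  have hf2 : ContDiff ℝ 1 (deriv f) := ((contDiff_succ_iff_deriv (n := 1)).1 hf).2.2
  have hd : HasDerivAt (deriv f) (deriv (deriv f) z) z :=
    (hf2.differentiable one_ne_zero z).hasDerivAt
  have hs := (hasDerivAt_iff_tendsto_slope.1 hd).mono_left
    (nhdsWithin_mono z (fun x (hx : z < x) => ne_of_gt hx))
  have hev : ∀ᶠ x in 𝓝[>] z, deriv f x < deriv f z := by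
    filter_upwards [hs.eventually (eventually_lt_nhds hneg), self_mem_nhdsWithin] with x hx hzx
    have hzx' : 0 < x - z := sub_pos.2 hzx
    rw [slope_def_field, div_lt_iff₀ hzx'] at hx
    linarith
  obtain ⟨c, hc, hcs⟩ := (mem_nhdsGT_iff_exists_Ioo_subset).1 hev
  have hc' : z < c := hc
  set h := min (c - z) h₀ / 2 with hh
  have hmin : 0 < min (c - z) h₀ := lt_min (sub_pos.2 hc') hh₀
  have hpos : 0 < h := by positivity
  have hlt1 : h < c - z := by
    have := min_le_left (c - z) h₀
    linarith
  have hlt2 : h < h₀ := by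
    have := min_le_right (c - z) h₀
    linarith
  obtain ⟨ξ, hξ, hξe⟩ := exists_deriv_eq_slope f (lt_add_of_pos_right z hpos)
    hf1.continuous.continuousOn hf1.differentiableOn
  have h1 : deriv f ξ < deriv f z := hcs ⟨hξ.1, by linarith [hξ.2]⟩
  have h2 := hsup h ⟨by linarith, hlt2.le⟩
  rw [add_sub_cancel_left, eq_div_iff hpos.ne'] at hξe
  have := mul_lt_mul_of_pos_right h1 hpos
  linarith

theorem monotoneOn_deriv_of_subset_convexRegion {f : ℝ → ℝ} (hf : ContDiff ℝ 2 f) {S : Set ℝ}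
    (hS : Convex ℝ S) (hsub : S ⊆ convexRegion f) : MonotoneOn (deriv f) S := by
  have hf2 : ContDiff ℝ 1 (deriv f) := ((contDiff_succ_iff_deriv (n := 1)).1 hf).2.2
  refine monotoneOn_of_deriv_nonneg hS hf2.continuous.continuousOn
    (hf2.differentiable one_ne_zero).differentiableOn fun x hx => ?_
  have hx' : x ∈ convexRegion f := hsub (interior_subset hx)
  have hx'' : x ∈ {z | ∃ h₀ > 0, ∀ h ∈ Icc (-h₀) h₀, deriv f z * h ≤ f (z + h) - f z} :=
    interior_subset hx'
  exact deriv_deriv_nonneg_of_local_support hf hx''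

theorem concaveRegion_eq (f : ℝ → ℝ) : concaveRegion f = convexRegion (-f) := by
  unfold concaveRegion convexRegion
  congr 1
  ext z
  simp only [mem_ofPred_eq, deriv.neg, Pi.neg_apply]
  refine exists_congr fun h₀ => and_congr_right fun _ => forall₂_congr fun h _ => ?_
  constructor <;> intro H <;> linarith

/-- Near a value which is not an inflection value, the derivative of the flux is monotone or
antitone. -/
theorem exists_ball_monotoneOn_or_antitoneOn_deriv {f : ℝ → ℝ} (hf : ContDiff ℝ 2 f) {z : ℝ}
    (hz : z ∉ inflectionSet f) :
    ∃ ρ > 0, MonotoneOn (deriv f) (Metric.ball z ρ) ∨ AntitoneOn (deriv f) (Metric.ball z ρ) := by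
  have hz' : z ∈ convexRegion f ∪ concaveRegion f := not_not.1 hz
  rcases hz' with h | h
  · obtain ⟨ρ, hρ, hsub⟩ := Metric.isOpen_iff.1 isOpen_interior z h
    exact ⟨ρ, hρ, Or.inl (monotoneOn_deriv_of_subset_convexRegion hf (convex_ball z ρ) hsub)⟩
  · rw [concaveRegion_eq] at h
    obtain ⟨ρ, hρ, hsub⟩ := Metric.isOpen_iff.1 isOpen_interior z h
    refine ⟨ρ, hρ, Or.inr ?_⟩
    have := (monotoneOn_deriv_of_subset_convexRegion hf.neg (convex_ball z ρ) hsub).neg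
    intro x hx y hy hxy
    simpa using! this hx hy hxy

theorem tangent_le_of_monotoneOn_deriv {f : ℝ → ℝ} (hf : Differentiable ℝ f) {S : Set ℝ}
    (hS : S.OrdConnected) (hmono : MonotoneOn (deriv f) S) {x y : ℝ} (hx : x ∈ S) (hy : y ∈ S) :
    0 ≤ f y - f x - deriv f x * (y - x) := by
  rcases lt_trichotomy x y with h | rfl | h
  · obtain ⟨ξ, hξ, hξe⟩ := exists_deriv_eq_slope f h hf.continuous.continuousOn
      hf.differentiableOn
    have h1 := hmono hx (hS.out hx hy (Ioo_subset_Icc_self hξ)) hξ.1.le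
    rw [eq_div_iff (sub_pos.2 h).ne'] at hξe
    have := mul_le_mul_of_nonneg_right h1 (sub_pos.2 h).le
    linarith
  · simp
  · obtain ⟨ξ, hξ, hξe⟩ := exists_deriv_eq_slope f h hf.continuous.continuousOn
      hf.differentiableOn
    have h1 := hmono (hS.out hy hx (Ioo_subset_Icc_self hξ)) hx hξ.2.le
    rw [eq_div_iff (sub_pos.2 h).ne'] at hξe
    have := mul_le_mul_of_nonneg_right h1 (sub_pos.2 h).le
    linarith

/-- A solution of `γ' = V(t, γ)` with continuous `V` near a compact interval agrees on this interval
with a globally continuously differentiable function. -/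
theorem exists_global_extension {V : ℝ × ℝ → ℝ} (hV : Continuous V) {γ : ℝ → ℝ} {a b : ℝ}
    (hab : a ≤ b) (hγ : ∀ t ∈ Icc a b, HasDerivAt γ (V (t, γ t)) t) :
    ∃ α β : ℝ → ℝ, Continuous β ∧ (∀ t, HasDerivAt α (β t) t) ∧ (∀ t, β t ∈ range V) ∧
      ∀ t ∈ Icc a b, α t = γ t ∧ β t = V (t, γ t) := by
  have hc : ContinuousOn γ (Icc a b) := fun t ht => (hγ t ht).continuousAt.continuousWithinAt
  have hcV : ContinuousOn (fun t => V (t, γ t)) (Icc a b) :=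
    hV.comp_continuousOn (continuousOn_id.prodMk hc)
  -- Outside `[a, b]` the speed is frozen at its endpoint values, so it stays in the range of `V`
  -- and inherits every bound on `V`; the extended curve is its primitive.
  set β : ℝ → ℝ := IccExtend hab ((Icc a b).domRestrict fun t => V (t, γ t)) with hβ
  have hβc : Continuous β := (continuousOn_iff_continuous_domRestrict.1 hcV).Icc_extend'
  have hβe : ∀ t ∈ Icc a b, β t = V (t, γ t) := fun t ht => by
    rw [hβ, IccExtend_of_mem hab _ ht]; rfl
  refine ⟨fun t => γ a + ∫ τ in a..t, β τ, β, hβc, fun t => ?_,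
    fun t => ⟨_, rfl⟩, fun t ht => ⟨?_, hβe t ht⟩⟩
  · exact (hβc.integral_hasStrictDerivAt a t).hasDerivAt.const_add _
  · have hsub : uIcc a t ⊆ Icc a b := by
      rw [uIcc_of_le ht.1]
      exact Icc_subset_Icc_right ht.2
    have h1 : ∫ τ in a..t, β τ = γ t - γ a := by
      refine intervalIntegral.integral_eq_sub_of_hasDerivAt (fun τ hτ => ?_)
        (hβc.intervalIntegrable _ _)
      rw [hβe τ (hsub hτ)]
      exact hγ τ (hsub hτ)
    simp [h1]

/-- Near every point at which `u` has no inflection value, a continuous solution is `G`-Lipschitz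
along characteristics. -/
theorem locally_lipschitz_along {f : ℝ → ℝ} (hf : ContDiff ℝ 2 f) {u : ℝ × ℝ → ℝ}
    (hu : Continuous u) {G : ℝ} (happ : HasSmoothApproximations u (fun p => f (u p)) G)
    {γ : ℝ → ℝ} {t₀ : ℝ} (ht₀ : 0 < t₀)
    (hγ : ∀ᶠ t in 𝓝 t₀, HasDerivAt γ (deriv f (u (t, γ t))) t)
    (hz : u (t₀, γ t₀) ∉ inflectionSet f) :
    ∃ ρ > 0, ∀ r ∈ Metric.ball t₀ ρ, ∀ s ∈ Metric.ball t₀ ρ,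
      |u (s, γ s) - u (r, γ r)| ≤ G * |s - r| := by
  have hf1 : Differentiable ℝ f := hf.differentiable two_ne_zero
  have hfc : Continuous (deriv f) := hf.continuous_deriv one_le_two
  obtain ⟨ρ₁, hρ₁, h₁⟩ := Metric.eventually_nhds_iff_ball.1 hγ
  obtain ⟨ρ₂, hρ₂, hmono⟩ := exists_ball_monotoneOn_or_antitoneOn_deriv hf hz
  have hab : t₀ - ρ₁ / 2 ≤ t₀ + ρ₁ / 2 := by linarith
  obtain ⟨α, β, hβ, hα, -, hαγ⟩ := exists_global_extension (V := fun p => deriv f (u p))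
    (hfc.comp hu) (γ := γ) hab fun t ht => h₁ t (by
      rw [Metric.mem_ball, Real.dist_eq, abs_lt]
      constructor <;> linarith [ht.1, ht.2])
  have hαc : Continuous α := continuous_iff_continuousAt.2 fun t => (hα t).continuousAt
  have ht₀m : t₀ ∈ Icc (t₀ - ρ₁ / 2) (t₀ + ρ₁ / 2) := ⟨by linarith, by linarith⟩
  have hcont : Continuous fun q : ℝ × ℝ => u (q.1, α q.1 + q.2) := by fun_prop
  have hnear : ∀ᶠ q in 𝓝 (t₀, (0 : ℝ)), u (q.1, α q.1 + q.2) ∈ Metric.ball (u (t₀, γ t₀)) ρ₂ := by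
    refine hcont.continuousAt.eventually_mem ?_
    simp only [add_zero, (hαγ t₀ ht₀m).1]
    exact Metric.ball_mem_nhds _ hρ₂
  obtain ⟨ρ₃, hρ₃, h₃⟩ := Metric.eventually_nhds_iff_ball.1 hnear
  have h₃' : ∀ t ε, |t - t₀| < ρ₃ → |ε| < ρ₃ →
      u (t, α t + ε) ∈ Metric.ball (u (t₀, γ t₀)) ρ₂ := by
    intro t ε ht hε
    refine h₃ (t, ε) ?_
    rw [Metric.mem_ball, Prod.dist_eq, Real.dist_eq, Real.dist_eq, sub_zero]
    exact max_lt ht hε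
  -- `ρ₁ / 2` keeps the times where `α = γ`, `ρ₃` keeps `u` on `α` and on its small translates in
  -- the ball where `f'` is monotone, and `t₀` keeps the times positive.
  set ρ := min (min (ρ₁ / 2) ρ₃) t₀ with hρ
  have hρle1 : ρ ≤ ρ₁ / 2 := (min_le_left _ _).trans (min_le_left _ _)
  have hρle3 : ρ ≤ ρ₃ := (min_le_left _ _).trans (min_le_right _ _)
  have hρle0 : ρ ≤ t₀ := min_le_right _ _
  have main : ∀ r s, |r - t₀| < ρ → |s - t₀| < ρ → r ≤ s →
      |u (s, γ s) - u (r, γ r)| ≤ G * (s - r) := by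
    intro r s hr hs hrs
    rw [abs_lt] at hr hs
    have hI : ∀ t ∈ Icc r s, t ∈ Icc (t₀ - ρ₁ / 2) (t₀ + ρ₁ / 2) ∧ |t - t₀| < ρ₃ := by
      intro t ht
      refine ⟨⟨by linarith [ht.1], by linarith [ht.2]⟩, abs_lt.2 ⟨?_, ?_⟩⟩ <;>
        linarith [ht.1, ht.2]
    rw [← (hαγ s (hI s (right_mem_Icc.2 hrs)).1).1, ← (hαγ r (hI r (left_mem_Icc.2 hrs)).1).1]
    refine happ.abs_sub_le_of_sign hu (hf1.continuous.comp hu) hα hβ (by linarith) hrs ?_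
    have hsmall : ∀ᶠ ε in 𝓝 (0 : ℝ), |ε| < ρ₃ := by
      filter_upwards [Metric.ball_mem_nhds (0 : ℝ) hρ₃] with ε hε
      simpa using hε
    have hβt : ∀ t ∈ Icc r s, β t = deriv f (u (t, α t)) := fun t ht => by
      rw [(hαγ t (hI t ht).1).2, (hαγ t (hI t ht).1).1]
    have hin : ∀ ε, |ε| < ρ₃ → ∀ t ∈ Icc r s,
        u (t, α t) ∈ Metric.ball (u (t₀, γ t₀)) ρ₂ ∧
        u (t, α t + ε) ∈ Metric.ball (u (t₀, γ t₀)) ρ₂ := fun ε hε t ht =>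
      ⟨by simpa using h₃' t 0 (hI t ht).2 (by simpa using hρ₃), h₃' t ε (hI t ht).2 hε⟩
    -- Because `β = f'(u)` on the curve, the flux excess is the deviation of `f` from its tangent
    -- line between two values of this ball.
    rcases hmono with hmono | hmono
    · left
      filter_upwards [hsmall] with ε hε t ht
      rw [hβt t ht]
      exact tangent_le_of_monotoneOn_deriv hf1 (convex_ball _ _).ordConnected hmono
        (hin ε hε t ht).1 (hin ε hε t ht).2
    · right
      filter_upwards [hsmall] with ε hε t ht
      rw [hβt t ht]
      have hneg : MonotoneOn (deriv (-f)) (Metric.ball (u (t₀, γ t₀)) ρ₂) := by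
        intro x hx y hy hxy
        rw [deriv.neg, deriv.neg]
        exact neg_le_neg (hmono hx hy hxy)
      have := tangent_le_of_monotoneOn_deriv hf1.neg (convex_ball _ _).ordConnected hneg
        (hin ε hε t ht).1 (hin ε hε t ht).2
      rw [deriv.neg] at this
      simp only [Pi.neg_apply] at this
      linarith
  refine ⟨ρ, by positivity, fun r hr s hs => ?_⟩
  rw [Metric.mem_ball, Real.dist_eq] at hr hs
  rcases le_total r s with h | h
  · rw [abs_of_nonneg (sub_nonneg.2 h)]
    exact main r s hr hs h
  · rw [abs_sub_comm, abs_sub_comm s r, abs_of_nonneg (sub_nonneg.2 h)]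
    exact main s r hs hr h

/-! ### Lipschitz continuity along characteristics -/

/-- A continuous function which is locally `G`-Lipschitz off the preimage of a null set is
`G`-Lipschitz. -/
theorem abs_sub_le_of_locally_lipschitz_off_null {v : ℝ → ℝ} {a b G : ℝ} (hab : a ≤ b)
    (hv : ContinuousOn v (Icc a b)) {N : Set ℝ} (hN : volume N = 0) (hG : 0 ≤ G)
    (hloc : ∀ t ∈ Ioo a b, v t ∉ N →
      ∃ ρ > 0, ∀ r ∈ Metric.ball t ρ, ∀ s ∈ Metric.ball t ρ, |v s - v r| ≤ G * |s - r|) :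
    |v b - v a| ≤ G * (b - a) := by
  set O : Set ℝ := {t | t ∈ Ioo a b ∧ v t ∉ N} with hO
  have hlip : ∀ t : ℝ, ∃ ρ, 0 < ρ ∧ (t ∈ O → LipschitzOnWith G.toNNReal v (Metric.ball t ρ)) := by
    intro t
    by_cases ht : t ∈ O
    · obtain ⟨ρ, hρ, h⟩ := hloc t ht.1 ht.2
      refine ⟨ρ, hρ, fun _ => LipschitzOnWith.of_dist_le_mul fun x hx y hy => ?_⟩
      rw [Real.dist_eq, Real.dist_eq, Real.coe_toNNReal _ hG]
      exact h y hy x hx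
    · exact ⟨1, one_pos, fun h => absurd h ht⟩
  choose ρ hρ hlip using hlip
  obtain ⟨T, hTO, hTc, hTcov⟩ := TopologicalSpace.countable_cover_nhdsWithin (s := O)
    (f := fun t => Metric.ball t (ρ t)) (fun t _ => mem_nhdsWithin_of_mem_nhds
      (Metric.ball_mem_nhds t (hρ t)))
  -- The countable cover is made disjoint before the images are measured, so overlaps are not
  -- counted and the sharp constant `G` survives.
  have himage : volume (v '' O) ≤ ENNReal.ofReal G * volume (Ioo a b) := by
    rcases T.eq_empty_or_nonempty with rfl | hTne
    · have : O = ∅ := by simpa using hTcov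
      simp [this]
    obtain ⟨e, he⟩ := hTc.exists_eq_range hTne
    set B : ℕ → Set ℝ := fun n => Metric.ball (e n) (ρ (e n)) with hB
    have hBm : ∀ n, MeasurableSet (B n) := fun n => Metric.isOpen_ball.measurableSet
    have heO : ∀ n, e n ∈ O := fun n => hTO (he ▸ mem_range_self n)
    have hcov : O ⊆ ⋃ n, Ioo a b ∩ disjointed B n := by
      rw [← inter_iUnion, iUnion_disjointed]
      intro t ht
      refine ⟨ht.1, ?_⟩
      obtain ⟨x, hx, hxt⟩ := mem_iUnion₂.1 (hTcov ht)
      rw [he] at hx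
      obtain ⟨n, rfl⟩ := hx
      exact mem_iUnion.2 ⟨n, hxt⟩
    calc volume (v '' O) ≤ volume (v '' ⋃ n, Ioo a b ∩ disjointed B n) :=
          measure_mono (image_mono hcov)
      _ ≤ ∑' n, volume (v '' (Ioo a b ∩ disjointed B n)) := by
          rw [image_iUnion]
          exact measure_iUnion_le _
      _ ≤ ∑' n, ENNReal.ofReal G * volume (Ioo a b ∩ disjointed B n) := by
          refine ENNReal.tsum_le_tsum fun n => ?_
          have h1 : LipschitzOnWith G.toNNReal v (Ioo a b ∩ disjointed B n) :=
            (hlip (e n) (heO n)).mono (inter_subset_right.trans (disjointed_subset B n))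
          have h2 := h1.hausdorffMeasure_image_le (d := 1) zero_le_one
          rw [hausdorffMeasure_real] at h2
          simpa [ENNReal.ofReal] using h2
      _ = ENNReal.ofReal G * volume (⋃ n, Ioo a b ∩ disjointed B n) := by
          rw [ENNReal.tsum_mul_left, measure_iUnion]
          · exact fun i j hij => ((disjoint_disjointed B) hij).mono inter_subset_right
              inter_subset_right
          · exact fun n => measurableSet_Ioo.inter (MeasurableSet.disjointed hBm n)
      _ ≤ ENNReal.ofReal G * volume (Ioo a b) := by
          gcongr
          exact iUnion_subset fun n => inter_subset_left
  -- By the intermediate value theorem every value between `v a` and `v b` is attained: at an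
  -- endpoint, at a good time, or with value in `N`. Only the good times contribute to the measure
  -- of this interval.
  have hsub : uIcc (v a) (v b) ⊆ (N ∪ v '' O) ∪ {v a, v b} := by
    intro y hy
    obtain ⟨t, ht, rfl⟩ := intermediate_value_uIcc (by rwa [uIcc_of_le hab]) hy
    rw [uIcc_of_le hab] at ht
    by_cases hta : t = a
    · simp [hta]
    by_cases htb : t = b
    · simp [htb]
    left
    by_cases hN : v t ∈ N
    · exact Or.inl hN
    · exact Or.inr ⟨t, ⟨⟨lt_of_le_of_ne ht.1 (Ne.symm hta), lt_of_le_of_ne ht.2 htb⟩, hN⟩, rfl⟩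
  have hvol : ENNReal.ofReal |v b - v a| ≤ ENNReal.ofReal (G * (b - a)) := by
    calc ENNReal.ofReal |v b - v a| = volume (uIcc (v a) (v b)) := Real.volume_interval.symm
      _ ≤ volume ((N ∪ v '' O) ∪ {v a, v b}) := measure_mono hsub
      _ ≤ volume (N ∪ v '' O) + volume {v a, v b} := measure_union_le _ _
      _ ≤ (volume N + volume (v '' O)) + volume {v a, v b} := by
          gcongr
          exact measure_union_le _ _
      _ = volume (v '' O) := by
          rw [hN, (toFinite {v a, v b}).measure_zero, zero_add, add_zero]
      _ ≤ ENNReal.ofReal G * volume (Ioo a b) := himage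
      _ = ENNReal.ofReal (G * (b - a)) := by
          rw [Real.volume_Ioo, ENNReal.ofReal_mul hG]
  exact (ENNReal.ofReal_le_ofReal_iff (mul_nonneg hG (sub_nonneg.2 hab))).1 hvol

theorem IsCharacteristic.nonneg {f : ℝ → ℝ} {u : ℝ × ℝ → ℝ} {I : Set ℝ} {γ : ℝ → ℝ}
    (h : IsCharacteristic f u I γ) {t : ℝ} (ht : t ∈ I) : 0 ≤ t := by
  obtain ⟨O, _, rfl⟩ := h.relOpen
  exact ht.2

theorem IsCharacteristic.mem_nhds {f : ℝ → ℝ} {u : ℝ × ℝ → ℝ} {I : Set ℝ} {γ : ℝ → ℝ}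
    (h : IsCharacteristic f u I γ) {t : ℝ} (ht : t ∈ I) (h0 : 0 < t) : I ∈ 𝓝 t := by
  obtain ⟨O, hO, rfl⟩ := h.relOpen
  exact inter_mem (hO.mem_nhds ht.1) (Ici_mem_nhds h0)

theorem IsCharacteristic.continuousOn_Icc {f : ℝ → ℝ} {u : ℝ × ℝ → ℝ} {I : Set ℝ} {γ : ℝ → ℝ}
    (h : IsCharacteristic f u I γ) {a b : ℝ} (ha : a ∈ I) (hb : b ∈ I) (hab : a ≤ b) :
    ContinuousOn γ (Icc a b) := by
  have := (h.absCont a ha b hb hab).continuousOn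
  rwa [uIcc_of_le hab] at this

/-- Characteristics are continuously differentiable at positive times. -/
theorem IsCharacteristic.eventually_hasDerivAt {f : ℝ → ℝ} (hf : Continuous (deriv f))
    {u : ℝ × ℝ → ℝ} (hu : ContinuousOn u halfPlane) {I : Set ℝ} {γ : ℝ → ℝ}
    (h : IsCharacteristic f u I γ) {t : ℝ} (ht : t ∈ I) (h0 : 0 < t) :
    ∀ᶠ τ in 𝓝 t, HasDerivAt γ (deriv f (pastExtension u (τ, γ τ))) τ := by
  obtain ⟨a, b, htab, hn, hsub⟩ := exists_Icc_mem_subset_of_mem_nhds (h.mem_nhds ht h0)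
  have hab : a ≤ b := htab.1.trans htab.2
  have ha : a ∈ I := hsub (left_mem_Icc.2 hab)
  have hb : b ∈ I := hsub (right_mem_Icc.2 hab)
  have hc : ContinuousOn γ (Icc a b) := h.continuousOn_Icc ha hb hab
  have hcV : ContinuousOn (fun τ => deriv f (pastExtension u (τ, γ τ))) (Icc a b) :=
    (hf.comp (continuous_pastExtension hu)).comp_continuousOn (continuousOn_id.prodMk hc)
  set β : ℝ → ℝ :=
    IccExtend hab ((Icc a b).domRestrict fun τ => deriv f (pastExtension u (τ, γ τ))) with hβ
  have hβc : Continuous β := (continuousOn_iff_continuous_domRestrict.1 hcV).Icc_extend'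
  have hβe : ∀ τ ∈ Icc a b, β τ = deriv f (pastExtension u (τ, γ τ)) := fun τ hτ => by
    rw [hβ, IccExtend_of_mem hab _ hτ]; rfl
  -- An absolutely continuous curve is the primitive of its almost everywhere derivative, which here
  -- coincides with the continuous function `β`.
  have hint : ∀ τ ∈ Icc a b, γ τ = γ a + ∫ x in a..τ, β x := by
    intro τ hτ
    have hac : AbsolutelyContinuousOnInterval γ a τ := h.absCont a ha τ (hsub hτ) hτ.1
    have e : ∫ x in a..τ, deriv γ x = ∫ x in a..τ, β x := by
      refine intervalIntegral.integral_congr_ae ?_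
      filter_upwards [h.ode] with x hx hxm
      rw [uIoc_of_le hτ.1] at hxm
      have hxI : x ∈ Icc a b := ⟨hxm.1.le, hxm.2.trans hτ.2⟩
      rw [(hx (hsub hxI)).deriv, hβe x hxI, pastExtension_mk _ (h.nonneg (hsub hxI))]
    rw [← e, hac.integral_deriv_eq_sub]
    ring
  filter_upwards [eventually_mem_nhds_iff.2 hn] with τ hτ
  rw [← hβe τ (mem_of_mem_nhds hτ)]
  have hd : HasDerivAt (fun τ => γ a + ∫ x in a..τ, β x) (β τ) τ :=
    (hβc.integral_hasStrictDerivAt a τ).hasDerivAt.const_add _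
  refine hd.congr_of_eventuallyEq ?_
  filter_upwards [hτ] with x hx using hint x hx

theorem IsCharacteristic.continuousOn_along {f : ℝ → ℝ} {u : ℝ × ℝ → ℝ}
    (hu : ContinuousOn u halfPlane) {I : Set ℝ} {γ : ℝ → ℝ} (h : IsCharacteristic f u I γ)
    {a b : ℝ} (ha : a ∈ I) (hb : b ∈ I) (hab : a ≤ b) :
    ContinuousOn (fun t => u (t, γ t)) (Icc a b) :=
  hu.comp (continuousOn_id.prodMk (h.continuousOn_Icc ha hb hab))
    fun _ ht => (h.nonneg ha).trans ht.1

/-- Continuous solutions are `G`-Lipschitz along their characteristics if the inflection values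
of the flux are negligible. -/
theorem IsCharacteristic.abs_sub_le {f : ℝ → ℝ} (hf : ContDiff ℝ 2 f)
    (hN : volume (inflectionSet f) = 0) {u : ℝ × ℝ → ℝ} (hu : ContinuousOn u halfPlane) {G : ℝ}
    (hG : 0 ≤ G)
    (happ : HasSmoothApproximations (pastExtension u) (fun p => f (pastExtension u p)) G)
    {I : Set ℝ} {γ : ℝ → ℝ} (h : IsCharacteristic f u I γ) {r s : ℝ} (hr : r ∈ I) (hs : s ∈ I)
    (hrs : r ≤ s) : |u (s, γ s) - u (r, γ r)| ≤ G * (s - r) := by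
  refine abs_sub_le_of_locally_lipschitz_off_null (v := fun t => u (t, γ t)) hrs
    (h.continuousOn_along hu hr hs hrs) hN hG fun t ht htN => ?_
  have htI : t ∈ I := h.ordConnected.out hr hs (Ioo_subset_Icc_self ht)
  have ht0 : 0 < t := (h.nonneg hr).trans_lt ht.1
  obtain ⟨ρ, hρ, hlip⟩ := locally_lipschitz_along hf (continuous_pastExtension hu) happ ht0
    (h.eventually_hasDerivAt (hf.continuous_deriv one_le_two) hu htI ht0)
    (by rwa [pastExtension_mk _ ht0.le])
  -- Times within distance `t` of `t` are nonnegative, and there the extension is `u` itself.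
  refine ⟨min ρ t, lt_min hρ ht0, fun a ha b hb => ?_⟩
  have hpos : ∀ x ∈ Metric.ball t (min ρ t), 0 ≤ x := by
    intro x hx
    have := (Metric.mem_ball.1 hx).trans_le (min_le_right _ _)
    rw [Real.dist_eq, abs_lt] at this
    linarith
  have := hlip a (Metric.ball_subset_ball (min_le_left _ _) ha) b
    (Metric.ball_subset_ball (min_le_left _ _) hb)
  rwa [pastExtension_mk _ (hpos a ha), pastExtension_mk _ (hpos b hb)] at this

/-! ### Derivatives over a null set of values -/

/-- The derivative of a function vanishes almost everywhere on the preimage of a null set. -/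
theorem ae_eq_zero_of_hasDerivAt_of_mem_null (v : ℝ → ℝ) {N : Set ℝ} (hN : volume N = 0) :
    ∀ᵐ t : ℝ, v t ∈ N → ∀ d, HasDerivAt v d t → d = 0 := by
  -- `A n` collects the times with value in `N` around which `v` expands distances to the centre by
  -- at least the factor `1 / (n + 1)`. On a short piece of `A n` the function is injective with
  -- Lipschitz inverse, so the piece is a Lipschitz image of a subset of `N`, hence null. A nonzero
  -- derivative puts the time in some `A n`.
  set A : ℕ → Set ℝ := fun n => {t | v t ∈ N ∧ ∀ s, |s - t| < 1 / (n + 1 : ℝ) →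
    |s - t| ≤ (n + 1 : ℝ) * |v s - v t|} with hA
  have hnull : ∀ (n : ℕ) (q : ℚ),
      volume (A n ∩ Metric.ball (q : ℝ) (1 / (n + 1 : ℝ) / 2)) = 0 := by
    intro n q
    set B := A n ∩ Metric.ball (q : ℝ) (1 / (n + 1 : ℝ) / 2) with hB
    have hanti : ∀ x ∈ B, ∀ y ∈ B, |x - y| ≤ (n + 1 : ℝ) * |v x - v y| := by
      intro x hx y hy
      refine hy.1.2 x ?_
      have h1 := Metric.mem_ball.1 hx.2
      have h2 := Metric.mem_ball'.1 hy.2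
      rw [← Real.dist_eq]
      exact (dist_triangle x q y).trans_lt (by linarith)
    have hinj : InjOn v B := by
      intro x hx y hy hxy
      have := hanti x hx y hy
      rw [hxy, sub_self, abs_zero, mul_zero] at this
      exact sub_eq_zero.1 (abs_nonpos_iff.1 this)
    have hinv : LeftInvOn (Function.invFunOn v B) v B := hinj.leftInvOn_invFunOn
    have hlip : LipschitzOnWith (n + 1 : ℝ).toNNReal (Function.invFunOn v B) (v '' B) := by
      refine LipschitzOnWith.of_dist_le_mul ?_
      rintro _ ⟨x, hx, rfl⟩ _ ⟨y, hy, rfl⟩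
      rw [hinv hx, hinv hy, Real.coe_toNNReal _ (by positivity), Real.dist_eq, Real.dist_eq]
      exact hanti x hx y hy
    have h1 := hlip.hausdorffMeasure_image_le (d := 1) zero_le_one
    rw [hausdorffMeasure_real, hinv.image_image] at h1
    have h2 : volume (v '' B) = 0 := by
      refine measure_mono_null ?_ hN
      rintro _ ⟨x, hx, rfl⟩
      exact hx.1.1
    rw [h2, mul_zero] at h1
    exact le_antisymm h1 bot_le
  have hae : ∀ᵐ t : ℝ, ∀ (n : ℕ) (q : ℚ), t ∉ A n ∩ Metric.ball (q : ℝ) (1 / (n + 1 : ℝ) / 2) :=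
    ae_all_iff.2 fun n => ae_all_iff.2 fun q => measure_eq_zero_iff_ae_notMem.1 (hnull n q)
  filter_upwards [hae] with t ht htN d hd
  by_contra hd0
  have hdpos : 0 < |d| := abs_pos.2 hd0
  have hs := (hasDerivAt_iff_tendsto_slope.1 hd).abs
  have hev : ∀ᶠ s in 𝓝[≠] t, |d| / 2 < |slope v t s| := hs.eventually (lt_mem_nhds (by linarith))
  obtain ⟨ρ, hρ, hρs⟩ := Metric.mem_nhdsWithin_iff.1 hev
  obtain ⟨n, hn⟩ := exists_nat_gt (max (1 / ρ) (2 / |d|))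
  have hn1 : 1 / (n + 1 : ℝ) < ρ := by
    rw [div_lt_comm₀ (by positivity) hρ]
    linarith [le_max_left (1 / ρ) (2 / |d|)]
  have hn2 : 1 ≤ (n + 1 : ℝ) * (|d| / 2) := by
    have h := (le_max_right (1 / ρ) (2 / |d|)).trans hn.le
    rw [div_le_iff₀ hdpos] at h
    nlinarith
  have htA : t ∈ A n := by
    refine ⟨htN, fun s hs => ?_⟩
    by_cases hst : s = t
    · simp [hst]
    have h1 : |d| / 2 < |slope v t s| :=
      hρs ⟨by rw [Metric.mem_ball, Real.dist_eq]; exact hs.trans hn1, hst⟩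
    have hpos : 0 < |s - t| := abs_pos.2 (sub_ne_zero.2 hst)
    rw [slope_def_field, abs_div, lt_div_iff₀ hpos] at h1
    calc |s - t| = 1 * |s - t| := (one_mul _).symm
      _ ≤ (n + 1 : ℝ) * (|d| / 2) * |s - t| := by gcongr
      _ = (n + 1 : ℝ) * (|d| / 2 * |s - t|) := by ring
      _ ≤ (n + 1 : ℝ) * |v s - v t| := by gcongr
  obtain ⟨q, hq⟩ := Rat.denseRange_cast.exists_dist_lt t
    (by positivity : 0 < 1 / (n + 1 : ℝ) / 2)
  exact ht n q ⟨htA, hq⟩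

/-! ### Independence of the derivative of the chosen characteristic -/

/-- The times `t` at which the increments of `U` along `γ` and along a curve touching `γ` at time
`t` from one side are strictly separated by those of a function of slope `q`, on a time interval
of radius `ρ`. -/
def touchingTimes (U : ℝ × ℝ → ℝ) (γ : ℝ → ℝ) (c e q ρ : ℝ) : Set ℝ :=
  {t | (∀ s ∈ Ioo t (t + ρ), c * (U (s, γ s) - U (t, γ t) - q * (s - t)) ≤ 0) ∧
    ∃ Γ : ℝ → ℝ, ContinuousOn Γ (Ioo (t - ρ) (t + ρ)) ∧ Γ t = γ t ∧
      (∀ s ∈ Ioo (t - ρ) (t + ρ), 0 ≤ e * (Γ s - γ s)) ∧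
      (∀ s ∈ Ioo t (t + ρ), 0 < c * (U (s, Γ s) - U (t, γ t) - q * (s - t))) ∧
      (∀ s ∈ Ioo (t - ρ) t, c * (U (s, Γ s) - U (t, γ t) - q * (s - t)) < 0)}

/-- If `t₂ < t₁ + ρ`, both curves lie on the same side of `γ`, while `Γ₁` starts on `γ` at `t₁` and
`Γ₂` reaches it at `t₂`; so they meet at some `τ` in between. For the function `c * (U - q * time)`,
the value at the meeting point is strictly above that at `t₁` by `Γ₁`, strictly below that at `t₂`
by `Γ₂`, and the value at `t₂` does not exceed that at `t₁` by the condition on `γ`: a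
contradiction. -/
theorem touchingTimes_separated {U : ℝ × ℝ → ℝ} {γ : ℝ → ℝ} {c e q ρ : ℝ} (he : e ≠ 0)
    {t₁ t₂ : ℝ} (h₁ : t₁ ∈ touchingTimes U γ c e q ρ) (h₂ : t₂ ∈ touchingTimes U γ c e q ρ)
    (hlt : t₁ < t₂) : t₁ + ρ ≤ t₂ := by
  by_contra hcon
  push Not at hcon
  obtain ⟨hγ, Γ₁, hc₁, he₁, hs₁, hr₁, _⟩ := h₁
  obtain ⟨_, Γ₂, hc₂, he₂, hs₂, _, hl₂⟩ := h₂
  have hsub₁ : Icc t₁ t₂ ⊆ Ioo (t₁ - ρ) (t₁ + ρ) := fun x hx =>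
    ⟨by linarith [hx.1], by linarith [hx.2]⟩
  have hsub₂ : Icc t₁ t₂ ⊆ Ioo (t₂ - ρ) (t₂ + ρ) := fun x hx =>
    ⟨by linarith [hx.1], by linarith [hx.2]⟩
  have hcont : ContinuousOn (fun s => e * (Γ₁ s - Γ₂ s)) (Icc t₁ t₂) :=
    continuousOn_const.mul ((hc₁.mono hsub₁).sub (hc₂.mono hsub₂))
  have m₁ : t₁ ∈ Icc t₁ t₂ := left_mem_Icc.2 hlt.le
  have m₂ : t₂ ∈ Icc t₁ t₂ := right_mem_Icc.2 hlt.le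
  have hz : (0 : ℝ) ∈ Icc (e * (Γ₁ t₁ - Γ₂ t₁)) (e * (Γ₁ t₂ - Γ₂ t₂)) := by
    have a := hs₂ t₁ (hsub₂ m₁)
    have b := hs₁ t₂ (hsub₁ m₂)
    rw [he₁, he₂]
    constructor <;> linarith
  obtain ⟨τ, hτ, hτe⟩ := intermediate_value_Icc hlt.le hcont hz
  have heq : Γ₁ τ = Γ₂ τ := by
    rcases mul_eq_zero.1 hτe with h | h
    · exact absurd h he
    · exact sub_eq_zero.1 h
  have hg := hγ t₂ ⟨hlt, hcon⟩
  -- The strict inequalities hold on open intervals only; if the curves meet at an endpoint, one of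
  -- them already contradicts the condition on `γ`.
  rcases eq_or_lt_of_le hτ.1 with h | h
  · have := hl₂ τ ⟨(hsub₂ hτ).1, h ▸ hlt⟩
    rw [← heq, ← h, he₁] at this
    linarith
  · rcases eq_or_lt_of_le hτ.2 with h' | h'
    · have := hr₁ τ ⟨h, (hsub₁ hτ).2⟩
      rw [heq, h', he₂] at this
      linarith
    · have a := hl₂ τ ⟨(hsub₂ hτ).1, h'⟩
      have b := hr₁ τ ⟨h, (hsub₁ hτ).2⟩
      rw [heq] at b
      linarith

/-- No other touching time lies in `(t, t + ρ)`, and a set of reals whose points are all isolated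
from the right is countable. -/
theorem countable_touchingTimes (U : ℝ × ℝ → ℝ) (γ : ℝ → ℝ) (c q : ℝ) {e ρ : ℝ} (he : e ≠ 0)
    (hρ : 0 < ρ) : (touchingTimes U γ c e q ρ).Countable := by
  refine Set.Countable.mono (fun t ht => ?_) (countable_setOfPred_isolated_right_within
    (s := touchingTimes U γ c e q ρ))
  refine ⟨ht, empty_mem_iff_bot.1 (mem_nhdsWithin.2 ⟨Iio (t + ρ), isOpen_Iio, by simp [hρ], ?_⟩)⟩
  rintro s ⟨hs, hsm, hts⟩
  exact absurd (touchingTimes_separated he ht hsm hts) (not_le.2 hs)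

/-- At a non-inflection value, a characteristic `Γ` through a point of the characteristic `γ` whose
difference quotients are separated from the derivative along `γ` touches `γ` from one side. -/
theorem exists_mem_touchingTimes {F : ℝ → ℝ} {U : ℝ × ℝ → ℝ} (hU : Continuous U)
    {γ Γ : ℝ → ℝ} {t c e q d ρ₀ : ℝ} (hc : c = 1 ∨ c = -1) (hρ₀ : 0 < ρ₀)
    (hF : ∀ a ∈ Metric.ball (U (t, γ t)) ρ₀, ∀ b ∈ Metric.ball (U (t, γ t)) ρ₀, a ≤ b →
      0 ≤ e * (F b - F a))
    (hγ : ∀ᶠ s in 𝓝 t, HasDerivAt γ (F (U (s, γ s))) s) (hΓ0 : Γ t = γ t)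
    (hΓ : ∀ᶠ s in 𝓝 t, HasDerivAt Γ (F (U (s, Γ s))) s)
    (hd : HasDerivAt (fun s => U (s, γ s)) d t) (hdq : c * (d - q) < 0)
    (hq : ∀ᶠ s in 𝓝[≠] t, 0 < c * ((U (s, Γ s) - U (t, γ t)) / (s - t) - q)) :
    ∃ n : ℕ, t ∈ touchingTimes U γ c (e * c) q (1 / (n + 1)) := by
  have hqd : ∀ᶠ s in 𝓝[≠] t, c * (slope (fun s => U (s, γ s)) t s - q) < 0 := by
    have h := ((hasDerivAt_iff_tendsto_slope.1 hd).sub_const q).const_mul c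
    exact h.eventually (gt_mem_nhds hdq)
  have hγc : ContinuousAt γ t := hγ.self_of_nhds.continuousAt
  have hΓc : ContinuousAt Γ t := hΓ.self_of_nhds.continuousAt
  have hbγ : ∀ᶠ s in 𝓝 t, U (s, γ s) ∈ Metric.ball (U (t, γ t)) ρ₀ := by
    have : ContinuousAt (fun s => U (s, γ s)) t :=
      hU.continuousAt.comp (continuousAt_id.prodMk hγc)
    exact this.eventually_mem (Metric.ball_mem_nhds _ hρ₀)
  have hbΓ : ∀ᶠ s in 𝓝 t, U (s, Γ s) ∈ Metric.ball (U (t, γ t)) ρ₀ := by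
    have : ContinuousAt (fun s => U (s, Γ s)) t :=
      hU.continuousAt.comp (continuousAt_id.prodMk hΓc)
    refine this.eventually_mem ?_
    rw [hΓ0]
    exact Metric.ball_mem_nhds _ hρ₀
  have hall := (hγ.and hΓ).and ((hbγ.and hbΓ).and
    ((eventually_nhdsWithin_iff.1 hq).and (eventually_nhdsWithin_iff.1 hqd)))
  obtain ⟨ρ, hρ, hρs⟩ := Metric.eventually_nhds_iff_ball.1 hall
  obtain ⟨n, hn⟩ := exists_nat_one_div_lt hρ
  set r : ℝ := 1 / (n + 1) with hr
  have hr0 : 0 < r := by positivity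
  have hball : ∀ s ∈ Ioo (t - r) (t + r), s ∈ Metric.ball t ρ := fun s hs => by
    rw [Metric.mem_ball, Real.dist_eq, abs_lt]
    constructor <;> linarith [hs.1, hs.2]
  -- The order of `U` along `Γ` and along `γ` is reversed when `s` passes `t`. Since `e * F` is
  -- monotone near the common value, `e * c * (Γ - γ)` decreases before `t` and increases after it,
  -- so its value `0` at `t` is a minimum.
  have gder : ∀ s ∈ Ioo (t - r) (t + r), HasDerivAt (fun s => e * c * (Γ s - γ s))
      (e * c * (F (U (s, Γ s)) - F (U (s, γ s)))) s := fun s hs =>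
    ((hρs s (hball s hs)).1.2.sub (hρs s (hball s hs)).1.1).const_mul _
  have hright : ∀ s ∈ Ioo t (t + r), 0 < c * (U (s, Γ s) - U (t, γ t) - q * (s - t)) ∧
      c * (U (s, γ s) - U (t, γ t) - q * (s - t)) < 0 := by
    intro s hs
    have h := (hρs s (hball s ⟨by linarith [hs.1], hs.2⟩)).2.2
    have h1 := h.1 hs.1.ne'
    have h2 := h.2 hs.1.ne'
    have hp : 0 < s - t := sub_pos.2 hs.1
    rw [slope_def_field] at h2
    constructor
    · have := mul_pos h1 hp
      have e1 : c * ((U (s, Γ s) - U (t, γ t)) / (s - t) - q) * (s - t) =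
        c * (U (s, Γ s) - U (t, γ t) - q * (s - t)) := by field_simp
      rwa [e1] at this
    · have := mul_neg_of_neg_of_pos h2 hp
      have e1 : c * ((U (s, γ s) - U (t, γ t)) / (s - t) - q) * (s - t) =
        c * (U (s, γ s) - U (t, γ t) - q * (s - t)) := by field_simp
      rwa [e1] at this
  have hleft : ∀ s ∈ Ioo (t - r) t, c * (U (s, Γ s) - U (t, γ t) - q * (s - t)) < 0 ∧
      0 < c * (U (s, γ s) - U (t, γ t) - q * (s - t)) := by
    intro s hs
    have h := (hρs s (hball s ⟨hs.1, by linarith [hs.2]⟩)).2.2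
    have h1 := h.1 hs.2.ne
    have h2 := h.2 hs.2.ne
    have hp : s - t < 0 := sub_neg.2 hs.2
    have hp' : s - t ≠ 0 := hp.ne
    rw [slope_def_field] at h2
    constructor
    · have := mul_neg_of_pos_of_neg h1 hp
      have e1 : c * ((U (s, Γ s) - U (t, γ t)) / (s - t) - q) * (s - t) =
        c * (U (s, Γ s) - U (t, γ t) - q * (s - t)) := by field_simp
      rwa [e1] at this
    · have := mul_pos_of_neg_of_neg h2 hp
      have e1 : c * ((U (s, γ s) - U (t, γ t)) / (s - t) - q) * (s - t) =
        c * (U (s, γ s) - U (t, γ t) - q * (s - t)) := by field_simp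
      rwa [e1] at this
  have hsgn : ∀ a ∈ Metric.ball (U (t, γ t)) ρ₀, ∀ b ∈ Metric.ball (U (t, γ t)) ρ₀,
      0 ≤ c * (b - a) → 0 ≤ e * c * (F b - F a) := by
    intro a ha b hb hab
    rcases hc with rfl | rfl
    · have := hF a ha b hb (by linarith)
      linarith
    · have := hF b hb a ha (by linarith)
      linarith
  refine ⟨n, fun s hs => (hright s hs).2.le, Γ, fun s hs =>
    (hρs s (hball s hs)).1.2.continuousAt.continuousWithinAt, hΓ0, ?_,
    fun s hs => (hright s hs).1, fun s hs => (hleft s hs).1⟩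
  have hz : e * c * (Γ t - γ t) = 0 := by rw [hΓ0, sub_self, mul_zero]
  intro s hs
  rcases lt_trichotomy s t with hst | rfl | hst
  · have hanti : AntitoneOn (fun s => e * c * (Γ s - γ s)) (Icc s t) := by
      have hsub : ∀ x ∈ Icc s t, x ∈ Ioo (t - r) (t + r) := fun x hx =>
        ⟨by linarith [hx.1, hs.1], by linarith [hx.2]⟩
      refine antitoneOn_of_deriv_nonpos (convex_Icc _ _)
        (fun x hx => (gder x (hsub x hx)).continuousAt.continuousWithinAt)
        (fun x hx => (gder x (hsub x (interior_subset hx))).differentiableAt.differentiableWithinAt)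
        fun x hx => ?_
      have hxm := hsub x (interior_subset hx)
      rw [interior_Icc] at hx
      rw [(gder x hxm).deriv]
      have hb := (hρs x (hball x hxm)).2.1
      have h := hleft x ⟨hxm.1, hx.2⟩
      have := hsgn _ hb.2 _ hb.1 (by linarith [h.1, h.2])
      linarith
    have := hanti (left_mem_Icc.2 hst.le) (right_mem_Icc.2 hst.le) hst.le
    simp only [hz] at this
    exact this
  · rw [hz]
  · have hmono : MonotoneOn (fun s => e * c * (Γ s - γ s)) (Icc t s) := by
      have hsub : ∀ x ∈ Icc t s, x ∈ Ioo (t - r) (t + r) := fun x hx =>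
        ⟨by linarith [hx.1], by linarith [hx.2, hs.2]⟩
      refine monotoneOn_of_deriv_nonneg (convex_Icc _ _)
        (fun x hx => (gder x (hsub x hx)).continuousAt.continuousWithinAt)
        (fun x hx => (gder x (hsub x (interior_subset hx))).differentiableAt.differentiableWithinAt)
        fun x hx => ?_
      have hxm := hsub x (interior_subset hx)
      rw [interior_Icc] at hx
      rw [(gder x hxm).deriv]
      have hb := (hρs x (hball x hxm)).2.1
      have h := hright x ⟨hx.1, hxm.2⟩
      exact hsgn _ hb.1 _ hb.2 (by linarith [h.1, h.2])
    have := hmono (left_mem_Icc.2 hst.le) (right_mem_Icc.2 hst.le) hst.le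
    simp only [hz] at this
    exact this

/-- The times at which some characteristic through a point of `γ` has difference quotients of `U`
separated from the derivative of `U` along `γ`, at non-inflection values, are countable. -/
theorem countable_setOf_separated {f : ℝ → ℝ} (hf : ContDiff ℝ 2 f) {U : ℝ × ℝ → ℝ}
    (hU : Continuous U) (γ : ℝ → ℝ) :
    {t : ℝ | (∀ᶠ s in 𝓝 t, HasDerivAt γ (deriv f (U (s, γ s))) s) ∧
      U (t, γ t) ∉ inflectionSet f ∧ ∃ (d : ℝ) (Γ : ℝ → ℝ),
        HasDerivAt (fun s => U (s, γ s)) d t ∧ Γ t = γ t ∧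
        (∀ᶠ s in 𝓝 t, HasDerivAt Γ (deriv f (U (s, Γ s))) s) ∧ ∃ c q : ℝ, (c = 1 ∨ c = -1) ∧
        c * (d - q) < 0 ∧
        ∀ᶠ s in 𝓝[≠] t, 0 < c * ((U (s, Γ s) - U (t, γ t)) / (s - t) - q)}.Countable := by
  have hc : (⋃ (n : ℕ) (q : ℚ), ((touchingTimes U γ 1 1 q (1 / (n + 1)) ∪
      touchingTimes U γ 1 (-1) q (1 / (n + 1))) ∪ (touchingTimes U γ (-1) 1 q (1 / (n + 1)) ∪
      touchingTimes U γ (-1) (-1) q (1 / (n + 1))))).Countable := by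
    refine countable_iUnion fun n => countable_iUnion fun q => ?_
    have hn : (0 : ℝ) < 1 / (n + 1) := by positivity
    refine ((countable_touchingTimes U γ _ _ ?_ hn).union
      (countable_touchingTimes U γ _ _ ?_ hn)).union
      ((countable_touchingTimes U γ _ _ ?_ hn).union (countable_touchingTimes U γ _ _ ?_ hn)) <;>
      norm_num
  refine hc.mono ?_
  rintro t ⟨hγ, hz, d, Γ, hd, hΓ0, hΓ, c, q, hc1, hdq, hq⟩
  -- Moving the threshold to a rational between `d` and `q` keeps both separations and leaves
  -- countably many parameters.
  obtain ⟨q', hq'1, hq'2⟩ : ∃ q' : ℚ, c * (d - q') < 0 ∧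
      ∀ᶠ s in 𝓝[≠] t, 0 < c * ((U (s, Γ s) - U (t, γ t)) / (s - t) - q') := by
    rcases hc1 with rfl | rfl
    · obtain ⟨q', h1, h2⟩ := exists_rat_btwn (show d < q by linarith)
      refine ⟨q', by linarith, ?_⟩
      filter_upwards [hq] with s hs
      linarith
    · obtain ⟨q', h1, h2⟩ := exists_rat_btwn (show q < d by linarith)
      refine ⟨q', by linarith, ?_⟩
      filter_upwards [hq] with s hs
      linarith
  obtain ⟨ρ₀, hρ₀, hmono⟩ := exists_ball_monotoneOn_or_antitoneOn_deriv hf hz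
  have key : ∃ (e : ℝ) (n : ℕ), (e = 1 ∨ e = -1) ∧
      t ∈ touchingTimes U γ c (e * c) q' (1 / (n + 1)) := by
    rcases hmono with hm | hm
    · obtain ⟨n, hn⟩ := exists_mem_touchingTimes (e := 1) hU hc1 hρ₀
        (fun a ha b hb hab => by have := hm ha hb hab; linarith) hγ hΓ0 hΓ hd hq'1 hq'2
      exact ⟨1, n, Or.inl rfl, hn⟩
    · obtain ⟨n, hn⟩ := exists_mem_touchingTimes (e := -1) hU hc1 hρ₀
        (fun a ha b hb hab => by have := hm ha hb hab; linarith) hγ hΓ0 hΓ hd hq'1 hq'2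
      exact ⟨-1, n, Or.inr rfl, hn⟩
  obtain ⟨e, n, he, hmem⟩ := key
  refine mem_iUnion₂.2 ⟨n, q', ?_⟩
  rcases hc1 with rfl | rfl <;> rcases he with rfl | rfl <;> norm_num at hmem ⊢ <;> tauto

theorem curveVal_of_mem {δ : ℝ} (c : C(Icc (-δ) δ, ℝ)) {s : ℝ} (hs : s ∈ Icc (-δ) δ) :
    curveVal c s = c ⟨s, hs⟩ := dif_pos hs

theorem C1Curve.hasDerivWithinAt {δ : ℝ} (Γ : C1Curve δ) {s : ℝ} (hs : s ∈ Icc (-δ) δ) :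
    HasDerivWithinAt Γ.val (Γ.der s) (Icc (-δ) δ) s := by
  have := Γ.2 ⟨s, hs⟩
  rwa [C1Curve.der, curveVal_of_mem _ hs]

/-- A translated characteristic, translated back, solves the characteristic equation near its
central time. -/
theorem translatedChar.eventually_hasDerivAt {f : ℝ → ℝ} {u : ℝ × ℝ → ℝ} {δ : ℝ} (hδ : 0 < δ)
    {p : ℝ × ℝ} {Γ : C1Curve δ} (h : (p, Γ) ∈ translatedChar f u δ) :
    ∀ᶠ s in 𝓝 p.1, HasDerivAt (fun s => Γ.val (s - p.1))
      (deriv f (pastExtension u (s, Γ.val (s - p.1)))) s := by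
  have hn : Ioo (p.1 - δ) (p.1 + δ) ∈ 𝓝 p.1 := Ioo_mem_nhds (by linarith) (by linarith)
  filter_upwards [hn] with s hs
  have hm : s - p.1 ∈ Icc (-δ) δ := ⟨by linarith [hs.1], by linarith [hs.2]⟩
  have h1 : HasDerivAt Γ.val (Γ.der (s - p.1)) (s - p.1) :=
    (Γ.hasDerivWithinAt hm).hasDerivAt
      (Icc_mem_nhds (by linarith [hs.1]) (by linarith [hs.2]))
  have h2 := h.2.2 (s - p.1) hm
  have h3 : δ ≤ p.1 := h.1
  simp only [add_sub_cancel] at h2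
  rw [h2] at h1
  rw [pastExtension_mk _ (by linarith [hs.1])]
  exact h1.comp_sub_const s p.1

/-- For almost every time, the difference quotients of `u` along the translated characteristics
through a point of `γ` with non-inflection value are not separated from the derivative of `u`
along `γ`. -/
theorem IsCharacteristic.ae_abs_sub_le {f : ℝ → ℝ} (hf : ContDiff ℝ 2 f) {u : ℝ × ℝ → ℝ}
    (hu : ContinuousOn u halfPlane) {I : Set ℝ} {γ : ℝ → ℝ} (h : IsCharacteristic f u I γ)
    {δ : ℝ} (hδ : 0 < δ) :
    ∀ᵐ t : ℝ, t ∈ I → δ ≤ t → u (t, γ t) ∉ inflectionSet f →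
      ∀ d, HasDerivAt (fun s => u (s, γ s)) d t → ∀ (Γ : C1Curve δ),
        ((t, γ t), Γ) ∈ translatedChar f u δ → ∀ ζ ε : ℝ,
          (∀ᶠ h in 𝓝[≠] (0 : ℝ), |ζ - quotAlong u (t, γ t) Γ h| < ε) → |ζ - d| ≤ ε := by
  have hc := (countable_setOf_separated hf (continuous_pastExtension hu) γ).ae_notMem volume
  filter_upwards [hc] with t ht htI hδt hz d hd Γ hΓ ζ ε hq
  by_contra hcon
  push Not at hcon
  have ht0 : 0 < t := hδ.trans_le hδt
  refine ht ⟨h.eventually_hasDerivAt (hf.continuous_deriv one_le_two) hu htI ht0, ?_, d,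
    fun s => Γ.val (s - t), ?_, ?_, translatedChar.eventually_hasDerivAt hδ hΓ, ?_⟩
  · rwa [pastExtension_mk _ ht0.le]
  · refine hd.congr_of_eventuallyEq ?_
    filter_upwards [lt_mem_nhds ht0] with s hs
    rw [pastExtension_mk _ hs.le]
  · simpa using hΓ.2.1
  have hmap : Tendsto (fun s => s - t) (𝓝[≠] t) (𝓝[≠] 0) := by
    refine tendsto_nhdsWithin_iff.2 ⟨?_, ?_⟩
    · have : Tendsto (fun s => s - t) (𝓝 t) (𝓝 (t - t)) := (continuous_sub_right t).tendsto t
      rw [sub_self] at this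
      exact this.mono_left nhdsWithin_le_nhds
    · filter_upwards [self_mem_nhdsWithin] with s hs
      exact sub_ne_zero.2 hs
  have hq' : ∀ᶠ s in 𝓝[≠] t, |ζ - (pastExtension u (s, Γ.val (s - t)) -
      pastExtension u (t, γ t)) / (s - t)| < ε := by
    filter_upwards [hmap.eventually hq, nhdsWithin_le_nhds (lt_mem_nhds ht0)] with s hs hs0
    rw [pastExtension_mk _ hs0.le, pastExtension_mk _ ht0.le]
    simpa [quotAlong] using hs
  -- If `|ζ - d| > ε`, the end of `[ζ - ε, ζ + ε]` nearer to `d` separates `d` from all short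
  -- quotients along `Γ`. The quotients need not converge, so approximate selections are covered
  -- too.
  rcases lt_abs.1 hcon with hlt | hlt
  · refine ⟨1, ζ - ε, Or.inl rfl, by linarith, ?_⟩
    filter_upwards [hq'] with s hs
    linarith [(abs_lt.1 hs).2]
  · refine ⟨-1, ζ + ε, Or.inr rfl, by linarith, ?_⟩
    filter_upwards [hq'] with s hs
    linarith [(abs_lt.1 hs).1]

/-! ### Peano's theorem by Tonelli's scheme -/

/-- The `L`-Lipschitz functions on a compact space with values in `[-R, R]` at a point form a
compact set for uniform convergence. -/
theorem isCompact_setOf_lipschitzWith {X : Type*} [PseudoMetricSpace X] [CompactSpace X]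
    (L : NNReal) (x₀ : X) (R : ℝ) :
    IsCompact {c : C(X, ℝ) | LipschitzWith L c ∧ |c x₀| ≤ R} := by
  refine ArzelaAscoli.isCompact_of_equicontinuous _ ?_ ?_
  · have himg : ContinuousMap.toFun '' {c : C(X, ℝ) | LipschitzWith L c ∧ |c x₀| ≤ R} =
        {g : X → ℝ | (∀ x y, dist (g x) (g y) ≤ L * dist x y) ∧ |g x₀| ≤ R} := by
      ext g
      constructor
      · rintro ⟨c, hc, rfl⟩
        exact ⟨lipschitzWith_iff_dist_le_mul.1 hc.1, hc.2⟩
      · rintro ⟨hg, hR⟩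
        have hl : LipschitzWith L g := lipschitzWith_iff_dist_le_mul.2 hg
        exact ⟨⟨g, hl.continuous⟩, ⟨hl, hR⟩, rfl⟩
    rw [himg]
    refine (isCompact_univ_pi fun x : X =>
      isCompact_closedBall (0 : ℝ) (R + L * dist x x₀)).of_isClosed_subset ?_ ?_
    · have h1 : IsClosed {g : X → ℝ | |g x₀| ≤ R} :=
        isClosed_le (continuous_apply x₀).abs continuous_const
      have h2 : IsClosed {g : X → ℝ | ∀ x y, dist (g x) (g y) ≤ L * dist x y} := by
        simp only [ofPred_forall]
        exact isClosed_iInter fun x => isClosed_iInter fun y =>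
          isClosed_le ((continuous_apply x).dist (continuous_apply y)) continuous_const
      exact h2.inter h1
    · rintro g ⟨hg, hR⟩ x _
      rw [mem_closedBall_zero_iff, Real.norm_eq_abs]
      have := hg x x₀
      rw [Real.dist_eq] at this
      linarith [abs_sub_abs_le_abs_sub (g x) (g x₀)]
  · have : UniformEquicontinuous
        (fun c : {c : C(X, ℝ) | LipschitzWith L c ∧ |c x₀| ≤ R} => (c : X → ℝ)) :=
      LipschitzWith.uniformEquicontinuous _ L fun c => c.2.1
    exact this.equicontinuous

/-- The operator of Tonelli's scheme for `z' = W(t, z)`, `z(0) = 0`, with delay `h`. -/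
def delayedIntegral (W : ℝ × ℝ → ℝ) (h : ℝ) (z : ℝ → ℝ) (s : ℝ) : ℝ :=
  ∫ τ in (0 : ℝ)..s, W (τ, z (τ - max (-h) (min h τ)))

/-- Subtracting the clamp of `τ` to `[-h, h]` moves `τ` by `h` towards `0` and stops at `0`. One
formula thus delays both the forward and the backward equation: values on `|τ| ≤ (n + 1) * h` depend
only on those on `|τ| ≤ n * h`. -/
theorem abs_sub_clamp_le {h τ : ℝ} (hh : 0 ≤ h) : |τ - max (-h) (min h τ)| ≤ max (|τ| - h) 0 := by
  rcases le_total 0 τ with h0 | h0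
  · rw [max_eq_right (by rw [le_min_iff]; constructor <;> linarith), abs_of_nonneg h0]
    rcases le_total h τ with h1 | h1
    · rw [min_eq_left h1, abs_of_nonneg (by linarith)]
      exact le_max_left _ _
    · rw [min_eq_right h1]; simp
  · rw [min_eq_right (by linarith), abs_of_nonpos h0]
    rcases le_total (-h) τ with h1 | h1
    · rw [max_eq_right h1]; simp
    · rw [max_eq_left h1, abs_of_nonpos (by linarith)]
      exact le_max_of_le_left (by linarith)

theorem abs_clamp_le {h τ : ℝ} (hh : 0 ≤ h) : |max (-h) (min h τ)| ≤ h :=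
  abs_le.2 ⟨le_max_left _ _, max_le (by linarith) (min_le_left _ _)⟩

theorem abs_sub_clamp_le_abs {h τ : ℝ} (hh : 0 ≤ h) : |τ - max (-h) (min h τ)| ≤ |τ| :=
  (abs_sub_clamp_le hh).trans (max_le (by linarith) (abs_nonneg _))

theorem abs_le_of_mem_uIoc_zero {s τ : ℝ} (h : τ ∈ uIoc 0 s) : |τ| ≤ |s| := by
  have := abs_sub_left_of_mem_uIcc (uIoc_subset_uIcc h)
  simpa using this

theorem continuous_delayedIntegral {W : ℝ × ℝ → ℝ} (hW : Continuous W) (h : ℝ) {z : ℝ → ℝ}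
    (hz : Continuous z) : Continuous (delayedIntegral W h z) := by
  refine intervalIntegral.continuous_primitive (fun a b => Continuous.intervalIntegrable ?_ _ _) 0
  fun_prop

theorem abs_delayedIntegral_sub_le {W : ℝ × ℝ → ℝ} (hW : Continuous W) {M : ℝ}
    (hM : ∀ p, |W p| ≤ M) (h : ℝ) {z : ℝ → ℝ} (hz : Continuous z) (a b : ℝ) :
    |delayedIntegral W h z b - delayedIntegral W h z a| ≤ M * |b - a| := by
  have hi : ∀ x y : ℝ, IntervalIntegrable
      (fun τ => W (τ, z (τ - max (-h) (min h τ)))) volume x y := fun x y =>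
    Continuous.intervalIntegrable (by fun_prop) _ _
  unfold delayedIntegral
  rw [intervalIntegral.integral_interval_sub_left (hi _ _) (hi _ _)]
  rw [← Real.norm_eq_abs]
  refine intervalIntegral.norm_integral_le_of_norm_le_const fun τ _ => ?_
  exact hM _

/-- Tonelli's approximations: there are solutions of the equation with delay. -/
theorem exists_delayed_solution {W : ℝ × ℝ → ℝ} (hW : Continuous W) {M : ℝ}
    (hM : ∀ p, |W p| ≤ M) {r δ h : ℝ} (hh : 0 < h) (hr : ∀ τ, |τ| ≤ r → W (τ, 0) = 0) :
    ∃ z : ℝ → ℝ, Continuous z ∧ (∀ a b, |z b - z a| ≤ M * |b - a|) ∧ z 0 = 0 ∧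
      (∀ s, |s| ≤ r → z s = 0) ∧ ∀ s, |s| ≤ δ → z s = delayedIntegral W h z s := by
  set z : ℕ → ℝ → ℝ := fun n => (delayedIntegral W h)^[n] (fun _ => 0) with hz
  have hsucc : ∀ n, z (n + 1) = delayedIntegral W h (z n) := fun n =>
    Function.iterate_succ_apply' _ _ _
  have hcont : ∀ n, Continuous (z n) := by
    intro n
    induction n with
    | zero => exact continuous_const
    | succ n ih => rw [hsucc]; exact continuous_delayedIntegral hW h ih
  have hzero : ∀ n s, |s| ≤ r → z n s = 0 := by
    intro n
    induction n with
    | zero => intro s _; rfl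
    | succ n ih =>
      intro s hs
      rw [hsucc, delayedIntegral]
      refine (intervalIntegral.integral_congr_ae (Eventually.of_forall fun τ hτ => ?_)).trans
        intervalIntegral.integral_zero
      have h1 := (abs_le_of_mem_uIoc_zero hτ).trans hs
      rw [ih _ ((abs_sub_clamp_le_abs hh.le).trans h1), hr τ h1]
  -- Each iteration settles the solution on one more interval of length `h` on each side of `0`;
  -- hence `n ≥ δ / h` iterations reach `[-δ, δ]`.
  have hstab : ∀ (n : ℕ) s, |s| ≤ n * h → z (n + 1) s = z n s := by
    intro n
    induction n with
    | zero =>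
      intro s hs
      have : s = 0 := by simpa using hs
      rw [hsucc, this, delayedIntegral, intervalIntegral.integral_same]
      rfl
    | succ n ih =>
      intro s hs
      rw [hsucc (n + 1), hsucc n, delayedIntegral, delayedIntegral]
      refine intervalIntegral.integral_congr_ae (Eventually.of_forall fun τ hτ => ?_)
      have h1 := (abs_le_of_mem_uIoc_zero hτ).trans hs
      push_cast at h1
      rw [← hsucc n, ih]
      refine (abs_sub_clamp_le hh.le).trans (max_le (by linarith) (by positivity))
  obtain ⟨n, hn⟩ := exists_nat_ge (δ / h)
  rw [div_le_iff₀ hh] at hn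
  refine ⟨z (n + 1), hcont _, fun a b => ?_, ?_, hzero _, fun s hs => ?_⟩
  · rw [hsucc]
    exact abs_delayedIntegral_sub_le hW hM h (hcont n) a b
  · rw [hsucc, delayedIntegral, intervalIntegral.integral_same]
  · rw [hsucc, delayedIntegral, delayedIntegral, ← hsucc]
    refine intervalIntegral.integral_congr_ae (Eventually.of_forall fun τ hτ => ?_)
    have h1 := ((abs_sub_clamp_le_abs hh.le).trans (abs_le_of_mem_uIoc_zero hτ)).trans
      (hs.trans hn)
    rw [hstab n _ h1]

/-- **Peano's theorem** for a bounded continuous scalar field; the solution can be chosen to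
vanish as long as the zero function is a solution. -/
theorem exists_integral_solution {W : ℝ × ℝ → ℝ} (hW : Continuous W) {M : ℝ}
    (hM : ∀ p, |W p| ≤ M) {r δ : ℝ} (hδ : 0 < δ) (hr : ∀ τ, |τ| ≤ r → W (τ, 0) = 0) :
    ∃ z : ℝ → ℝ, Continuous z ∧ z 0 = 0 ∧ (∀ s, |s| ≤ δ → |s| ≤ r → z s = 0) ∧
      ∀ s, |s| ≤ δ → z s = ∫ τ in (0 : ℝ)..s, W (τ, z τ) := by
  have hM0 : 0 ≤ M := (abs_nonneg _).trans (hM 0)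
  have hle : -δ ≤ δ := by linarith
  have h0 : (0 : ℝ) ∈ Icc (-δ) δ := ⟨by linarith, hδ.le⟩
  set K : Set C(Icc (-δ) δ, ℝ) := {c | LipschitzWith M.toNNReal c ∧ |c ⟨0, h0⟩| ≤ 0} with hK
  have hKc : IsCompact K := isCompact_setOf_lipschitzWith _ _ _
  set ext : C(Icc (-δ) δ, ℝ) → ℝ → ℝ := fun c s => c (projIcc (-δ) δ hle s) with hext
  have hextc : Continuous fun q : C(Icc (-δ) δ, ℝ) × ℝ => ext q.1 q.2 := by
    have : Continuous (projIcc (-δ) δ hle) := continuous_projIcc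
    fun_prop
  -- The `1 / (n + 1)`-approximate solutions with the required vanishing form a decreasing sequence
  -- of nonempty compact sets; a common element is a solution.
  set Z : ℕ → Set C(Icc (-δ) δ, ℝ) := fun n => K ∩ {c | (∀ s : Icc (-δ) δ, |(s : ℝ)| ≤ r → c s = 0) ∧
    ∀ s : Icc (-δ) δ, |c s - ∫ τ in (0 : ℝ)..s, W (τ, ext c τ)| ≤ 1 / (n + 1 : ℝ)} with hZ
  have hZclosed : ∀ n, IsClosed (Z n) := by
    intro n
    refine hKc.isClosed.inter (IsClosed.inter ?_ ?_)
    · change IsClosed {c : C(Icc (-δ) δ, ℝ) | ∀ s : Icc (-δ) δ, |(s : ℝ)| ≤ r → c s = 0}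
      simp only [ofPred_forall]
      exact isClosed_iInter fun s => isClosed_iInter fun _ =>
        isClosed_eq (by fun_prop) continuous_const
    · change IsClosed {c : C(Icc (-δ) δ, ℝ) | ∀ s : Icc (-δ) δ,
          |c s - ∫ τ in (0 : ℝ)..s, W (τ, ext c τ)| ≤ 1 / (n + 1 : ℝ)}
      simp only [ofPred_forall]
      refine isClosed_iInter fun s => isClosed_le (Continuous.abs ?_) continuous_const
      refine Continuous.sub (by fun_prop) ?_
      refine intervalIntegral.continuous_parametric_intervalIntegral_of_continuous' ?_ _ _
      exact hW.comp (continuous_snd.prodMk hextc)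
  have hZne : ∀ n, (Z n).Nonempty := by
    intro n
    set B : Set (ℝ × ℝ) := Icc (-δ) δ ×ˢ Icc (-(M * δ)) (M * δ) with hB
    have hBc : IsCompact B := isCompact_Icc.prod isCompact_Icc
    have hη : 0 < 1 / (n + 1 : ℝ) / δ := by positivity
    obtain ⟨d, hd, hunif⟩ := Metric.mem_uniformity_dist.1
      (hBc.uniformContinuousAt_of_continuousAt W (fun a _ => hW.continuousAt)
        (Metric.dist_mem_uniformity hη))
    -- The delay moves `z` by at most `M * h < d`, the modulus of continuity of `W` for the error `1
    -- / (n + 1) / δ` per unit of time; `M + 1` avoids dividing by zero.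
    set h := d / (2 * (M + 1)) with hh
    have hh0 : 0 < h := by positivity
    have hMh : M * h < d := by
      have : (M + 1) * h = d / 2 := by rw [hh]; field_simp
      nlinarith
    obtain ⟨z, hzc, hzl, hz0, hzr, hze⟩ := exists_delayed_solution hW hM (δ := δ) hh0 hr
    set c : C(Icc (-δ) δ, ℝ) := ⟨fun s => z s, hzc.comp continuous_subtype_val⟩ with hc
    have hcext : ∀ τ, |τ| ≤ δ → ext c τ = z τ := by
      intro τ hτ
      simp only [hext, hc, projIcc_of_mem hle (abs_le.1 hτ)]
      rfl
    refine ⟨c, ⟨?_, ?_⟩, fun s hs => hzr s hs, fun s => ?_⟩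
    · refine LipschitzWith.of_dist_le_mul fun a b => ?_
      rw [Real.coe_toNNReal _ hM0, dist_comm, dist_comm a b]
      exact hzl a b
    · exact (abs_eq_zero.2 hz0).le
    · have hs : |(s : ℝ)| ≤ δ := abs_le.2 s.2
      have e1 : c s = ∫ τ in (0 : ℝ)..s, W (τ, z (τ - max (-h) (min h τ))) := hze s hs
      have e2 : ∫ τ in (0 : ℝ)..s, W (τ, ext c τ) = ∫ τ in (0 : ℝ)..s, W (τ, z τ) := by
        refine intervalIntegral.integral_congr_ae (Eventually.of_forall fun τ hτ => ?_)
        rw [hcext τ ((abs_le_of_mem_uIoc_zero hτ).trans hs)]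
      rw [e1, e2, ← intervalIntegral.integral_sub]
      rotate_left
      · exact Continuous.intervalIntegrable (by fun_prop) _ _
      · exact Continuous.intervalIntegrable (by fun_prop) _ _
      have hb := intervalIntegral.norm_integral_le_of_norm_le_const (a := 0) (b := (s : ℝ))
        (C := 1 / (n + 1 : ℝ) / δ)
        (f := fun τ => W (τ, z (τ - max (-h) (min h τ))) - W (τ, z τ)) (fun τ hτ => ?_)
      · rw [Real.norm_eq_abs, sub_zero] at hb
        refine hb.trans ?_
        calc 1 / (n + 1 : ℝ) / δ * |(s : ℝ)| ≤ 1 / (n + 1 : ℝ) / δ * δ := by gcongr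
          _ = 1 / (n + 1 : ℝ) := by field_simp
      · have hτδ := (abs_le_of_mem_uIoc_zero hτ).trans hs
        have hmem : (τ, z τ) ∈ B := by
          refine ⟨abs_le.1 hτδ, abs_le.1 ?_⟩
          have := hzl 0 τ
          rw [hz0, sub_zero, sub_zero] at this
          exact this.trans (by gcongr)
        have hdist : dist (τ, z τ) (τ, z (τ - max (-h) (min h τ))) < d := by
          rw [Prod.dist_eq, dist_self, max_eq_right dist_nonneg, Real.dist_eq]
          refine (hzl _ _).trans_lt ?_
          rw [sub_sub_cancel]
          exact (mul_le_mul_of_nonneg_left (abs_clamp_le hh0.le) hM0).trans_lt hMh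
        have := hunif hdist hmem
        rw [← dist_eq_norm, dist_comm]
        exact this.le
  obtain ⟨c, hc⟩ := IsCompact.nonempty_iInter_of_sequence_nonempty_isCompact_isClosed Z
    (fun n c hc => ⟨hc.1, hc.2.1, fun s => (hc.2.2 s).trans (by
      apply one_div_le_one_div_of_le <;> push_cast <;> first | positivity | linarith)⟩)
    hZne (hKc.of_isClosed_subset (hZclosed 0) inter_subset_left) hZclosed
  rw [mem_iInter] at hc
  have hval : ∀ s (hs : |s| ≤ δ), ext c s = c ⟨s, abs_le.1 hs⟩ := fun s hs => by
    simp only [hext, projIcc_of_mem hle (abs_le.1 hs)]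
  refine ⟨ext c, hextc.comp (continuous_const.prodMk continuous_id), ?_, fun s hs hsr => ?_,
    fun s hs => ?_⟩
  · rw [hval 0 (by simpa using hδ.le)]
    exact abs_nonpos_iff.1 (hc 0).1.2
  · rw [hval s hs]
    exact (hc 0).2.1 ⟨s, abs_le.1 hs⟩ hsr
  · rw [hval s hs, ← sub_eq_zero, ← abs_nonpos_iff]
    refine ge_of_tendsto' tendsto_one_div_add_atTop_nhds_zero_nat fun n => ?_
    exact (hc n).2.2 ⟨s, abs_le.1 hs⟩

/-! ### Compactness of the set of characteristics -/

theorem continuous_curveVal {δ : ℝ} (s : ℝ) :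
    Continuous fun c : C(Icc (-δ) δ, ℝ) => curveVal c s := by
  by_cases hs : s ∈ Icc (-δ) δ
  · simp only [curveVal_of_mem _ hs]
    fun_prop
  · have : ∀ c : C(Icc (-δ) δ, ℝ), curveVal c s = 0 := fun c => dif_neg hs
    simp only [this]
    exact continuous_const

theorem C1Curve.continuous_val {δ : ℝ} (s : ℝ) : Continuous fun Γ : C1Curve δ => Γ.val s :=
  (continuous_curveVal s).comp (continuous_fst.comp continuous_subtype_val)

theorem exists_C1Curve {δ : ℝ} {Γ D : ℝ → ℝ}
    (hΓ : ∀ s ∈ Icc (-δ) δ, HasDerivWithinAt Γ (D s) (Icc (-δ) δ) s) (hD : ContinuousOn D (Icc (-δ) δ)) :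
    ∃ c : C1Curve δ, (∀ s ∈ Icc (-δ) δ, c.val s = Γ s) ∧ ∀ s ∈ Icc (-δ) δ, c.der s = D s := by
  have hc : ContinuousOn Γ (Icc (-δ) δ) := fun s hs => (hΓ s hs).continuousWithinAt
  refine ⟨⟨(⟨_, hc.domRestrict⟩, ⟨_, hD.domRestrict⟩), fun s => ?_⟩, fun s hs => ?_, fun s hs => ?_⟩
  · refine (hΓ s s.2).congr (fun x hx => ?_) ?_
    · rw [curveVal_of_mem _ hx]; rfl
    · rw [curveVal_of_mem _ s.2]; rfl
  · rw [C1Curve.val, curveVal_of_mem _ hs]; rfl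
  · rw [C1Curve.der, curveVal_of_mem _ hs]; rfl

/-- The pairs of a point `(t, x)` and a curve on `[-δ, δ]` solving the time-translated integral
equation of the field `V` through this point. -/
def integralCurves (V : ℝ × ℝ → ℝ) {δ : ℝ} (hδ : -δ ≤ δ) : Set ((ℝ × ℝ) × C(Icc (-δ) δ, ℝ)) :=
  {q | ∀ s : Icc (-δ) δ,
    q.2 s = q.1.2 + ∫ τ in (0 : ℝ)..s, V (q.1.1 + τ, q.2 (projIcc (-δ) δ hδ τ))}

/-- The values of a field along a curve. -/
def fieldAlong {V : ℝ × ℝ → ℝ} (hV : Continuous V) {δ : ℝ} (q : (ℝ × ℝ) × C(Icc (-δ) δ, ℝ)) :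
    C(Icc (-δ) δ, ℝ) :=
  ⟨fun s => V (q.1.1 + s, q.2 s), by fun_prop⟩

theorem continuous_fieldAlong {V : ℝ × ℝ → ℝ} (hV : Continuous V) (δ : ℝ) :
    Continuous (fieldAlong hV (δ := δ)) := by
  refine ContinuousMap.continuous_of_continuous_uncurry _ ?_
  have : Continuous fun x : ((ℝ × ℝ) × C(Icc (-δ) δ, ℝ)) × Icc (-δ) δ =>
    V (x.1.1.1 + x.2, x.1.2 x.2) := by fun_prop
  exact this

theorem isClosed_integralCurves {V : ℝ × ℝ → ℝ} (hV : Continuous V) {δ : ℝ} (hδ : -δ ≤ δ) :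
    IsClosed (integralCurves V hδ) := by
  unfold integralCurves
  simp only [ofPred_forall]
  have hp : Continuous (projIcc (-δ) δ hδ) := continuous_projIcc
  refine isClosed_iInter fun s => isClosed_eq (by fun_prop) ?_
  refine Continuous.add (by fun_prop) ?_
  refine intervalIntegral.continuous_parametric_intervalIntegral_of_continuous' ?_ _ _
  have : Continuous fun x : ((ℝ × ℝ) × C(Icc (-δ) δ, ℝ)) × ℝ =>
    V (x.1.1.1 + x.2, x.1.2 (projIcc (-δ) δ hδ x.2)) := by fun_prop
  exact this

theorem hasDerivWithinAt_of_mem_integralCurves {V : ℝ × ℝ → ℝ} (hV : Continuous V) {δ : ℝ}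
    (hδ : -δ ≤ δ) {q : (ℝ × ℝ) × C(Icc (-δ) δ, ℝ)} (hq : q ∈ integralCurves V hδ)
    (s : Icc (-δ) δ) :
    HasDerivWithinAt (curveVal q.2) (fieldAlong hV q s) (Icc (-δ) δ) s := by
  have hp : Continuous (projIcc (-δ) δ hδ) := continuous_projIcc
  have hc : Continuous fun τ => V (q.1.1 + τ, q.2 (projIcc (-δ) δ hδ τ)) := by fun_prop
  have hd := ((hc.integral_hasStrictDerivAt 0 (s : ℝ)).hasDerivAt.const_add q.1.2).hasDerivWithinAt
    (s := Icc (-δ) δ)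
  have e : V (q.1.1 + s, q.2 (projIcc (-δ) δ hδ s)) = fieldAlong hV q s := by
    rw [projIcc_val]; rfl
  rw [e] at hd
  refine hd.congr (fun x hx => ?_) ?_
  · rw [curveVal_of_mem _ hx]; exact hq ⟨x, hx⟩
  · rw [curveVal_of_mem _ s.2]; exact hq s

theorem mem_integralCurves_of_hasDerivWithinAt {V : ℝ × ℝ → ℝ} (hV : Continuous V) {δ : ℝ}
    (hδ : 0 ≤ δ) (hδ' : -δ ≤ δ) {q : (ℝ × ℝ) × C(Icc (-δ) δ, ℝ)} (h0 : curveVal q.2 0 = q.1.2)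
    (hq : ∀ s : Icc (-δ) δ,
      HasDerivWithinAt (curveVal q.2) (fieldAlong hV q s) (Icc (-δ) δ) s) :
    q ∈ integralCurves V hδ' := by
  have hp : Continuous (projIcc (-δ) δ hδ') := continuous_projIcc
  have hc : Continuous fun τ => V (q.1.1 + τ, q.2 (projIcc (-δ) δ hδ' τ)) := by fun_prop
  have hcont : ContinuousOn (curveVal q.2) (Icc (-δ) δ) := fun s hs =>
    (hq ⟨s, hs⟩).continuousWithinAt
  have key : ∀ a b, -δ ≤ a → a ≤ b → b ≤ δ → ∫ τ in a..b,
      V (q.1.1 + τ, q.2 (projIcc (-δ) δ hδ' τ)) = curveVal q.2 b - curveVal q.2 a := by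
    intro a b ha hab hb
    refine intervalIntegral.integral_eq_sub_of_hasDerivAt_of_le hab
      (hcont.mono (Icc_subset_Icc ha hb)) (fun x hx => ?_) (hc.intervalIntegrable _ _)
    have hx' : x ∈ Icc (-δ) δ := ⟨ha.trans hx.1.le, hx.2.le.trans hb⟩
    have := (hq ⟨x, hx'⟩).hasDerivAt (Icc_mem_nhds (ha.trans_lt hx.1) (hx.2.trans_le hb))
    rw [projIcc_of_mem hδ' hx']
    exact this
  intro s
  have hs : q.2 s = curveVal q.2 s := by rw [curveVal_of_mem _ s.2]
  rw [hs, ← h0]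
  rcases le_total 0 (s : ℝ) with h | h
  · rw [key 0 s (by linarith) h s.2.2]; ring
  · rw [intervalIntegral.integral_symm, key s 0 s.2.1 h hδ]; ring

/-- The speed of the characteristics. -/
def charSpeed (f : ℝ → ℝ) (u : ℝ × ℝ → ℝ) (p : ℝ × ℝ) : ℝ := deriv f (pastExtension u p)

/-- For `δ ≤ p.1` only nonnegative times occur, so the continuous extension of the field may be
used. The integral equation is a closed condition for uniform convergence, unlike the differential
one, and the derivative component becomes a continuous function of the point and the curve. -/
theorem mem_translatedChar_iff {f : ℝ → ℝ} {u : ℝ × ℝ → ℝ} (hV : Continuous (charSpeed f u))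
    {δ : ℝ} (hδ : 0 ≤ δ) (hδ' : -δ ≤ δ) {p : ℝ × ℝ} {Γ : C1Curve δ} :
    (p, Γ) ∈ translatedChar f u δ ↔
      δ ≤ p.1 ∧ (p, Γ.1.1) ∈ integralCurves (charSpeed f u) hδ' ∧
        Γ.1.2 = fieldAlong hV (p, Γ.1.1) := by
  have h0 : (0 : ℝ) ∈ Icc (-δ) δ := ⟨by linarith, hδ⟩
  have hfield : ∀ (_ : δ ≤ p.1) (s : Icc (-δ) δ), fieldAlong hV (p, Γ.1.1) s =
      deriv f (u (p.1 + s, Γ.val s)) := by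
    intro hp s
    have e : Γ.val s = Γ.1.1 s := by rw [C1Curve.val, curveVal_of_mem _ s.2]
    rw [e, ← pastExtension_mk u (by linarith [s.2.1])]
    rfl
  constructor
  · rintro ⟨hp, hx, hd⟩
    have e : Γ.1.2 = fieldAlong hV (p, Γ.1.1) := by
      ext s
      rw [hfield hp s, ← hd s s.2, C1Curve.der, curveVal_of_mem _ s.2]
    refine ⟨hp, mem_integralCurves_of_hasDerivWithinAt hV hδ hδ' hx fun s => ?_, e⟩
    rw [← e]
    exact Γ.2 s
  · rintro ⟨hp, hi, e⟩
    refine ⟨hp, ?_, fun s hs => ?_⟩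
    · have := hi ⟨0, h0⟩
      rw [intervalIntegral.integral_same, add_zero] at this
      rw [C1Curve.val, curveVal_of_mem _ h0]
      exact this
    · have := hfield hp ⟨s, hs⟩
      rw [← this, ← e, C1Curve.der, curveVal_of_mem _ hs]

/-- The characteristics through the points of a compact set form a compact set of `C¹` curves. -/
theorem isCompact_translatedChar {f : ℝ → ℝ} {u : ℝ × ℝ → ℝ} (hV : Continuous (charSpeed f u))
    {M : ℝ} (hM : ∀ p, |charSpeed f u p| ≤ M) {δ : ℝ} (hδ : 0 ≤ δ) {P : Set (ℝ × ℝ)}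
    (hP : IsCompact P) : IsCompact {q | q ∈ translatedChar f u δ ∧ q.1 ∈ P} := by
  have hδ' : -δ ≤ δ := by linarith
  have h0 : (0 : ℝ) ∈ Icc (-δ) δ := ⟨by linarith, hδ⟩
  have hM0 : 0 ≤ M := (abs_nonneg _).trans (hM 0)
  obtain ⟨R, hR⟩ := hP.isBounded.exists_norm_le
  set Q : Set ((ℝ × ℝ) × C(Icc (-δ) δ, ℝ)) :=
    integralCurves (charSpeed f u) hδ' ∩ {q | δ ≤ q.1.1} ∩ {q | q.1 ∈ P} with hQ
  have hQc : IsCompact Q := by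
    refine (hP.prod (isCompact_setOf_lipschitzWith M.toNNReal (⟨0, h0⟩ : Icc (-δ) δ)
      R)).of_isClosed_subset ?_ ?_
    · exact ((isClosed_integralCurves hV hδ').inter
        (isClosed_le continuous_const (by fun_prop))).inter (hP.isClosed.preimage continuous_fst)
    · rintro ⟨p, c⟩ ⟨⟨hi, hp⟩, hpP⟩
      refine ⟨hpP, LipschitzWith.of_dist_le_mul fun a b => ?_, ?_⟩
      · have ha : c a = _ := hi a
        have hb : c b = _ := hi b
        have hp' : Continuous (projIcc (-δ) δ hδ') := continuous_projIcc
        have hii : ∀ x y : ℝ, IntervalIntegrable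
            (fun τ => charSpeed f u (p.1 + τ, c (projIcc (-δ) δ hδ' τ))) volume x y := fun x y =>
          Continuous.intervalIntegrable (by fun_prop) _ _
        rw [ha, hb, dist_add_left, dist_eq_norm,
          intervalIntegral.integral_interval_sub_left (hii _ _) (hii _ _),
          Real.coe_toNNReal _ hM0]
        exact intervalIntegral.norm_integral_le_of_norm_le_const fun τ _ => hM _
      · have : c ⟨0, h0⟩ = _ := hi ⟨0, h0⟩
        rw [intervalIntegral.integral_same, add_zero] at this
        rw [this]
        exact (norm_snd_le p).trans (hR p hpP)
  have : CompactSpace Q := isCompact_iff_compactSpace.1 hQc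
  -- Adjoining the derivative, given by the field along the curve, is continuous; this raises
  -- compactness in the uniform topology to compactness in `C¹`.
  let Φ : Q → (ℝ × ℝ) × C1Curve δ := fun q => (q.1.1, ⟨(q.1.2, fieldAlong hV q.1), fun s =>
    hasDerivWithinAt_of_mem_integralCurves hV hδ' q.2.1.1 s⟩)
  have hΦ : Continuous Φ := by
    refine Continuous.prodMk (by fun_prop) (Continuous.subtype_mk ?_ _)
    exact (continuous_snd.comp continuous_subtype_val).prodMk
      ((continuous_fieldAlong hV δ).comp continuous_subtype_val)
  have himg : {q | q ∈ translatedChar f u δ ∧ q.1 ∈ P} = range Φ := by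
    ext ⟨p, Γ⟩
    constructor
    · rintro ⟨h, hp⟩
      obtain ⟨h1, h2, h3⟩ := (mem_translatedChar_iff hV hδ hδ').1 h
      refine ⟨⟨(p, Γ.1.1), ⟨h2, h1⟩, hp⟩, ?_⟩
      refine Prod.ext rfl (Subtype.ext (Prod.ext rfl ?_))
      exact h3.symm
    · rintro ⟨q, hq⟩
      obtain ⟨rfl, rfl⟩ := Prod.ext_iff.1 hq
      exact ⟨(mem_translatedChar_iff hV hδ hδ').2 ⟨q.2.1.2, q.2.1.1, rfl⟩, q.2.2⟩
  rw [himg]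
  exact isCompact_range hΦ

/-! ### Descriptive complexity of the graph of derivatives -/

/-- The approximate derivative graphs: triples of a point of `P`, a characteristic through it and
a number `ζ` which is `η`-close to the difference quotients with increments up to `ρ`. -/
def approxGraph (f : ℝ → ℝ) (u : ℝ × ℝ → ℝ) (G δ : ℝ) (P : Set (ℝ × ℝ)) (η ρ : ℝ) :
    Set ((ℝ × ℝ) × C1Curve δ × ℝ) :=
  {q | ((q.1, q.2.1) ∈ translatedChar f u δ ∧ q.1 ∈ P) ∧ q.2.2 ∈ Icc (-G) G ∧
    ∀ h, h ≠ 0 → |h| ≤ ρ → |q.2.2 - quotAlong u q.1 q.2.1 h| ≤ η}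

/-- For each fixed increment the non-strict inequality is a closed condition. The restriction `ρ ≤
δ` keeps the increments in the domain of the curves and the times nonnegative. -/
theorem isCompact_approxGraph {f : ℝ → ℝ} (hf : Continuous (deriv f)) {u : ℝ × ℝ → ℝ}
    (hu : ContinuousOn u halfPlane) {M : ℝ} (hM : ∀ p, |charSpeed f u p| ≤ M) (G : ℝ) {δ : ℝ}
    (hδ : 0 ≤ δ) {P : Set (ℝ × ℝ)} (hP : IsCompact P) (η : ℝ) {ρ : ℝ} (hρ : ρ ≤ δ) :
    IsCompact (approxGraph f u G δ P η ρ) := by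
  have huc := continuous_pastExtension hu
  have hV : Continuous (charSpeed f u) := hf.comp huc
  have hc := ((isCompact_translatedChar hV hM hδ hP).prod (isCompact_Icc (a := -G) (b := G))).image
    (f := fun q : ((ℝ × ℝ) × C1Curve δ) × ℝ => (q.1.1, q.1.2, q.2)) (by fun_prop)
  set A := {q : (ℝ × ℝ) × C1Curve δ × ℝ | ∀ h, h ≠ 0 → |h| ≤ ρ →
    |q.2.2 - (pastExtension u (q.1.1 + h, q.2.1.val h) - pastExtension u q.1) / h| ≤ η} with hA
  have hAc : IsClosed A := by
    rw [hA]
    simp only [ofPred_forall]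
    refine isClosed_iInter fun h => isClosed_iInter fun _ => isClosed_iInter fun _ =>
      isClosed_le ?_ continuous_const
    have : Continuous fun q : (ℝ × ℝ) × C1Curve δ × ℝ => q.2.1.val h :=
      (C1Curve.continuous_val h).comp (continuous_fst.comp continuous_snd)
    fun_prop
  convert! hc.inter_right hAc using 1
  ext ⟨p, Γ, ζ⟩
  have hquot : (p, Γ) ∈ translatedChar f u δ → ∀ h, |h| ≤ ρ → quotAlong u p Γ h =
      (pastExtension u (p.1 + h, Γ.val h) - pastExtension u p) / h := by
    intro hp h hh
    have hp1 : δ ≤ p.1 := hp.1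
    have := (abs_le.1 (hh.trans hρ)).1
    rw [quotAlong, pastExtension_mk u (by linarith),
      pastExtension_of_nonneg u (hδ.trans hp1)]
  constructor
  · rintro ⟨h1, h2, h3⟩
    refine ⟨⟨((p, Γ), ζ), ⟨h1, h2⟩, rfl⟩, fun h hh0 hh => ?_⟩
    have := h3 h hh0 hh
    simp only at this
    rwa [hquot h1.1 h hh] at this
  · rintro ⟨⟨⟨⟨p', Γ'⟩, ζ'⟩, ⟨h1, h2⟩, he⟩, h3⟩
    obtain ⟨rfl, he⟩ := Prod.ext_iff.1 he
    obtain ⟨rfl, rfl⟩ := Prod.ext_iff.1 he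
    refine ⟨h1, h2, fun h hh0 hh => ?_⟩
    simp only
    rw [hquot h1.1 h hh]
    exact h3 h hh0 hh

theorem exists_mem_approxGraph {f : ℝ → ℝ} {u : ℝ × ℝ → ℝ} {G δ : ℝ} (hδ : 0 < δ)
    {q : (ℝ × ℝ) × C1Curve δ × ℝ} (hq : q ∈ derivGraph f u G δ) {η : ℝ} (hη : 0 < η) :
    ∃ m j : ℕ, q ∈ approxGraph f u G δ (Metric.closedBall 0 j) η (δ / (m + 1)) := by
  obtain ⟨h1, h2, h3⟩ := hq
  obtain ⟨j, hj⟩ := exists_nat_ge ‖q.1‖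
  have hev := h3.eventually (Metric.closedBall_mem_nhds q.2.2 hη)
  obtain ⟨r, hr, hrs⟩ := Metric.mem_nhdsWithin_iff.1 hev
  obtain ⟨m, hm⟩ := exists_nat_gt (δ / r)
  refine ⟨m, j, ⟨h1, by simpa using hj⟩, h2, fun h hh0 hh => ?_⟩
  have hlt : δ / (m + 1) < r := by
    rw [div_lt_comm₀ (by positivity) hr]
    linarith
  have : quotAlong u q.1 q.2.1 h ∈ Metric.closedBall q.2.2 η :=
    hrs ⟨by simpa using hh.trans_lt hlt, hh0⟩
  rwa [Metric.mem_closedBall', Real.dist_eq] at this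

/-- Countably many precisions, increment radii and balls describe the limit, so `derivGraph` is a
countable intersection of σ-compact sets. Projection does not commute with this intersection, hence
the distinction between Souslin and Borel selections. -/
theorem derivGraph_eq {f : ℝ → ℝ} {u : ℝ × ℝ → ℝ} {G δ : ℝ} (hδ : 0 < δ) :
    derivGraph f u G δ = ⋂ n : ℕ, ⋃ (m : ℕ) (j : ℕ),
      approxGraph f u G δ (Metric.closedBall 0 j) (1 / (n + 1)) (δ / (m + 1)) := by
  ext q
  simp only [mem_iInter, mem_iUnion]
  constructor
  · exact fun hq n => exists_mem_approxGraph hδ hq (by positivity)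
  · intro hq
    obtain ⟨m, j, h1, h2, h3⟩ := hq 0
    refine ⟨h1.1, h2, Metric.tendsto_nhds.2 fun e he => ?_⟩
    obtain ⟨n, hn⟩ := exists_nat_one_div_lt he
    obtain ⟨m, j, -, -, h3⟩ := hq n
    have hpos : 0 < δ / (m + 1) := by positivity
    filter_upwards [self_mem_nhdsWithin,
      nhdsWithin_le_nhds (Metric.closedBall_mem_nhds (0 : ℝ) hpos)] with h hh0 hh
    rw [dist_comm, Real.dist_eq]
    exact (h3 h hh0 (by simpa using hh)).trans_lt hn

theorem analyticSet_of_isCompact {X : Type*} [TopologicalSpace X]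
    [TopologicalSpace.MetrizableSpace X] {s : Set X} (hs : IsCompact s) : AnalyticSet s := by
  have : CompactSpace s := isCompact_iff_compactSpace.1 hs
  let := TopologicalSpace.metrizableSpaceMetric s
  rw [← Subtype.range_coe (s := s)]
  exact analyticSet_range_of_polishSpace continuous_subtype_val

theorem analyticSet_derivGraph {f : ℝ → ℝ} (hf : Continuous (deriv f)) {u : ℝ × ℝ → ℝ}
    (hu : ContinuousOn u halfPlane) {M : ℝ} (hM : ∀ p, |charSpeed f u p| ≤ M) (G : ℝ) {δ : ℝ}
    (hδ : 0 < δ) : AnalyticSet (derivGraph f u G δ) := by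
  rw [derivGraph_eq hδ]
  refine AnalyticSet.iInter fun n => AnalyticSet.iUnion fun m => AnalyticSet.iUnion fun j => ?_
  refine analyticSet_of_isCompact (isCompact_approxGraph hf hu hM G hδ.le
    (isCompact_closedBall _ _) _ ?_)
  exact div_le_self hδ.le (by linarith [(Nat.cast_nonneg m : (0 : ℝ) ≤ m)])

/-! ### Extension of characteristics to a fixed time interval -/

/-- A solution of `γ' = V(t, γ)` near a time `t` agrees near `t` with a solution on
`[t - δ, t + δ]`. -/
theorem exists_extension {V : ℝ × ℝ → ℝ} (hV : Continuous V) {M : ℝ} (hM : ∀ p, |V p| ≤ M)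
    {δ : ℝ} (hδ : 0 < δ) {γ : ℝ → ℝ} {t : ℝ} (hγ : ∀ᶠ s in 𝓝 t, HasDerivAt γ (V (s, γ s)) s) :
    ∃ Γ : ℝ → ℝ, Continuous Γ ∧ (∀ᶠ s in 𝓝 0, Γ s = γ (t + s)) ∧
      ∀ s ∈ Icc (-δ) δ, HasDerivWithinAt Γ (V (t + s, Γ s)) (Icc (-δ) δ) s := by
  obtain ⟨ρ, hρ, hρs⟩ := Metric.eventually_nhds_iff_ball.1 hγ
  set r := min (ρ / 2) δ with hr
  have hr0 : 0 < r := by positivity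
  have hrρ : r ≤ ρ / 2 := min_le_left _ _
  obtain ⟨α, β, hβ, hα, hβV, hαγ⟩ := exists_global_extension hV (γ := γ)
    (a := t - r) (b := t + r) (by linarith) fun s hs => hρs s (by
      rw [Metric.mem_ball, Real.dist_eq, abs_lt]
      constructor <;> linarith [hs.1, hs.2])
  have hαc : Continuous α := continuous_iff_continuousAt.2 fun t => (hα t).continuousAt
  have hmem : ∀ τ, |τ| ≤ r → t + τ ∈ Icc (t - r) (t + r) := fun τ hτ => by
    have := abs_le.1 hτ
    constructor <;> linarith
  -- The extension is sought as `α + z` with `z' = W(s, z)`. As long as `α` itself solves the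
  -- equation, `W` vanishes at `z = 0`, so `z` can be taken zero there and `γ` is not altered near
  -- `t`.
  set W : ℝ × ℝ → ℝ := fun p => V (t + p.1, α (t + p.1) + p.2) - β (t + p.1) with hW
  have hWc : Continuous W := by fun_prop
  have hWM : ∀ p, |W p| ≤ 2 * M := by
    intro p
    obtain ⟨q, hq⟩ := hβV (t + p.1)
    refine (abs_sub _ _).trans ?_
    rw [← hq]
    linarith [hM (t + p.1, α (t + p.1) + p.2), hM q]
  obtain ⟨z, hzc, hz0, hzr, hz⟩ := exists_integral_solution hWc hWM hδ (r := r) fun τ hτ => by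
    have := hαγ _ (hmem τ hτ)
    simp [hW, this.1, this.2]
  refine ⟨fun s => α (t + s) + z s, by fun_prop, ?_, fun s hs => ?_⟩
  · filter_upwards [Metric.closedBall_mem_nhds (0 : ℝ) hr0] with s hs
    have hs' : |s| ≤ r := by simpa using hs
    rw [hzr s (hs'.trans (min_le_right _ _)) hs', (hαγ _ (hmem s hs')).1, add_zero]
  · have hc : Continuous fun τ => W (τ, z τ) := by fun_prop
    have hzd : HasDerivWithinAt z (W (s, z s)) (Icc (-δ) δ) s :=
      (hc.integral_hasStrictDerivAt 0 s).hasDerivAt.hasDerivWithinAt.congr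
        (fun x hx => hz x (abs_le.2 hx)) (hz s (abs_le.2 hs))
    have hαd : HasDerivAt (fun s => α (t + s)) (β (t + s)) s := (hα (t + s)).comp_const_add t s
    convert! hαd.hasDerivWithinAt.add hzd using 1
    simp [hW]

/-- The points of a characteristic at which `u` is differentiable along it belong to `E`. -/
theorem IsCharacteristic.mem_derivSet {f : ℝ → ℝ} (hf : Continuous (deriv f)) {u : ℝ × ℝ → ℝ}
    (hu : ContinuousOn u halfPlane) {M : ℝ} (hM : ∀ p, |charSpeed f u p| ≤ M) {I : Set ℝ}
    {γ : ℝ → ℝ} (h : IsCharacteristic f u I γ) {G δ : ℝ} (hδ : 0 < δ) {t : ℝ} (ht : t ∈ I)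
    (hδt : δ ≤ t) {d : ℝ} (hd : HasDerivAt (fun s => u (s, γ s)) d t) (hdG : |d| ≤ G) :
    (t, γ t) ∈ derivSet f u G δ := by
  have hV : Continuous (charSpeed f u) := hf.comp (continuous_pastExtension hu)
  -- The interval of `γ` may be too short for `[t - δ, t + δ]`. A curve agreeing with `γ` near `t`
  -- serves as well, since the derivative of `u` along it at `t` is local.
  obtain ⟨Γ, hΓc, hΓγ, hΓ⟩ := exists_extension hV hM hδ
    (h.eventually_hasDerivAt hf hu ht (hδ.trans_le hδt))
  obtain ⟨c, hc1, hc2⟩ := exists_C1Curve hΓ (by fun_prop : Continuous _).continuousOn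
  have h0 : (0 : ℝ) ∈ Icc (-δ) δ := ⟨by linarith, hδ.le⟩
  refine ⟨((t, γ t), c, d), ⟨⟨hδt, ?_, fun s hs => ?_⟩, abs_le.1 hdG, ?_⟩, rfl⟩
  · simp only
    rw [hc1 0 h0, hΓγ.self_of_nhds, add_zero]
  · simp only
    rw [hc2 s hs, hc1 s hs, charSpeed, pastExtension_mk u (by linarith [hs.1])]
  · have h1 := hasDerivAt_iff_tendsto_slope_zero.1 hd
    refine h1.congr' ?_
    filter_upwards [nhdsWithin_le_nhds hΓγ,
      nhdsWithin_le_nhds (Icc_mem_nhds (by linarith : -δ < 0) hδ)] with s hs hsm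
    rw [quotAlong, hc1 s hsm, hs, smul_eq_mul, div_eq_inv_mul]

/-! ### Measurable selections by the lexicographically least branch -/

/-- The elements of `A` whose first `n` terms are those of the lexicographically least branch. -/
def branchSet (A : Set (ℕ → ℕ)) : ℕ → Set (ℕ → ℕ)
  | 0 => A
  | n + 1 => {z ∈ branchSet A n | z n = sInf ((fun z => z n) '' branchSet A n)}

/-- The lexicographically least branch of a set of sequences. -/
def leastBranch (A : Set (ℕ → ℕ)) (n : ℕ) : ℕ := sInf ((fun z => z n) '' branchSet A n)

theorem mem_branchSet {A : Set (ℕ → ℕ)} {n : ℕ} {z : ℕ → ℕ} :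
    z ∈ branchSet A n ↔ z ∈ A ∧ ∀ i < n, z i = leastBranch A i := by
  induction n with
  | zero => simp [branchSet]
  | succ n ih =>
    change z ∈ branchSet A n ∧ z n = leastBranch A n ↔ _
    rw [ih, Nat.forall_lt_succ_right, and_assoc]

theorem branchSet_nonempty {A : Set (ℕ → ℕ)} (hA : A.Nonempty) (n : ℕ) :
    (branchSet A n).Nonempty := by
  induction n with
  | zero => exact hA
  | succ n ih =>
    obtain ⟨z, hz, hzn⟩ := Nat.sInf_mem (ih.image fun z => z n)
    exact ⟨z, hz, hzn⟩

/-- Members of `branchSet A n` agree with the least branch in the first `n` places, so they converge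
to it; closedness of `A` concludes. -/
theorem leastBranch_mem {A : Set (ℕ → ℕ)} (hc : IsClosed A) (hA : A.Nonempty) :
    leastBranch A ∈ A := by
  choose z hz using branchSet_nonempty hA
  refine hc.mem_of_tendsto (b := atTop) (f := z) ?_
    (Eventually.of_forall fun n => (mem_branchSet.1 (hz n)).1)
  refine tendsto_pi_nhds.2 fun i => tendsto_const_nhds.congr' ?_
  filter_upwards [eventually_gt_atTop i] with n hn
  exact ((mem_branchSet.1 (hz n)).2 i hn).symm

/-- Each coordinate is determined by which finite prefixes occur in `A`. When `A` is a fibre of a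
map, these become membership conditions in images of cylinders, which is what makes the least branch
measurable. -/
theorem leastBranch_eq_iff {A : Set (ℕ → ℕ)} (hA : A.Nonempty) {n k : ℕ} :
    leastBranch A n = k ↔ (∃ z ∈ A, (∀ i < n, z i = leastBranch A i) ∧ z n = k) ∧
      ∀ j < k, ¬ ∃ z ∈ A, (∀ i < n, z i = leastBranch A i) ∧ z n = j := by
  have hmem : ∀ j, (∃ z ∈ A, (∀ i < n, z i = leastBranch A i) ∧ z n = j) ↔
      j ∈ (fun z => z n) '' branchSet A n := by
    intro j
    constructor
    · rintro ⟨z, hz, hzi, hzn⟩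
      exact ⟨z, mem_branchSet.2 ⟨hz, hzi⟩, hzn⟩
    · rintro ⟨z, hz, hzn⟩
      exact ⟨z, (mem_branchSet.1 hz).1, (mem_branchSet.1 hz).2, hzn⟩
  simp only [hmem]
  constructor
  · rintro rfl
    exact ⟨Nat.sInf_mem ((branchSet_nonempty hA n).image _), fun j hj => Nat.notMem_of_lt_sInf hj⟩
  · rintro ⟨h1, h2⟩
    refine le_antisymm (Nat.sInf_le h1) (not_lt.1 fun hlt => h2 _ hlt ?_)
    exact Nat.sInf_mem ((branchSet_nonempty hA n).image _)

/-- A continuous map on the Baire space has a section, with measurable coordinates for every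
`σ`-algebra which contains the images of the cylinders. -/
theorem exists_section {X : Type*} [TopologicalSpace X] [T1Space X] [MeasurableSpace X]
    {φ : (ℕ → ℕ) → X} (hφ : Continuous φ)
    (hcyl : ∀ (a : ℕ → ℕ) (n : ℕ), MeasurableSet (φ '' {z | ∀ i < n, z i = a i})) :
    ∃ s : X → ℕ → ℕ, (∀ x ∈ range φ, φ (s x) = x) ∧
      ∀ n k, MeasurableSet {x | x ∈ range φ ∧ s x n = k} := by
  set s : X → ℕ → ℕ := fun x => leastBranch (φ ⁻¹' {x}) with hs
  have hne : ∀ x ∈ range φ, (φ ⁻¹' {x}).Nonempty := fun x hx => hx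
  refine ⟨s, fun x hx => leastBranch_mem (isClosed_singleton.preimage hφ) (hne x hx), ?_⟩
  have hmeas : ∀ n (a : ℕ → ℕ), MeasurableSet {x | x ∈ range φ ∧ ∀ i < n, s x i = a i} := by
    intro n
    induction n with
    | zero =>
      intro a
      convert hcyl a 0 using 1
      ext x
      simp
    | succ n ih =>
      intro a
      -- The least branch of the fibre continues the prefix by `a n` exactly when some preimage does
      -- and none continues it by a smaller number.
      have e : {x | x ∈ range φ ∧ ∀ i < n + 1, s x i = a i} =
          {x | x ∈ range φ ∧ ∀ i < n, s x i = a i} ∩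
            (φ '' {z | ∀ i < n + 1, z i = Function.update a n (a n) i} \
              ⋃ j ∈ Iio (a n), φ '' {z | ∀ i < n + 1, z i = Function.update a n j i}) := by
        have himg : ∀ x j, (∀ i < n, s x i = a i) →
            ((∃ z ∈ φ ⁻¹' {x}, (∀ i < n, z i = s x i) ∧ z n = j) ↔
              x ∈ φ '' {z | ∀ i < n + 1, z i = Function.update a n j i}) := by
          intro x j ha
          refine exists_congr fun z => ?_
          simp only [mem_preimage, mem_singleton_iff, mem_ofPred_eq, Nat.forall_lt_succ_right,
            Function.update_self]
          rw [and_comm]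
          refine and_congr_left fun _ => and_congr_left fun _ => forall₂_congr fun i hi => ?_
          rw [Function.update_of_ne hi.ne, ha i hi]
        ext x
        simp only [mem_ofPred_eq, mem_inter_iff, Nat.forall_lt_succ_right, Set.mem_sdiff, mem_iUnion,
          mem_Iio, exists_prop, not_exists, not_and, ← and_assoc]
        rw [and_assoc (a := x ∈ range φ ∧ ∀ i < n, s x i = a i)]
        refine and_congr_right fun hx => ?_
        have := leastBranch_eq_iff (hne x hx.1) (n := n) (k := a n)
        change s x n = a n ↔ _
        refine this.trans (and_congr ((himg x _ hx.2).trans ?_) (forall₂_congr fun j _ =>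
          not_congr ((himg x j hx.2).trans ?_)))
        · simp only [mem_image, mem_ofPred_eq, Nat.forall_lt_succ_right]
        · simp only [mem_image, mem_ofPred_eq, Nat.forall_lt_succ_right]
      rw [e]
      refine (ih a).inter ((hcyl _ _).diff ?_)
      exact MeasurableSet.biUnion (to_countable _) fun j _ => hcyl _ _
  intro n k
  -- Fixing one coordinate amounts to a countable union over all prefixes of length `n`.
  have e : {x | x ∈ range φ ∧ s x n = k} = ⋃ l : Fin n → ℕ,
      {x | x ∈ range φ ∧ ∀ i < n + 1, s x i = if h : i < n then l ⟨i, h⟩ else k} := by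
    ext x
    simp only [mem_ofPred_eq, mem_iUnion, Nat.forall_lt_succ_right, lt_irrefl, dite_false]
    constructor
    · rintro ⟨hx, hk⟩
      exact ⟨fun i => s x i, hx, fun i hi => by simp [hi], hk⟩
    · rintro ⟨l, hx, -, hk⟩
      exact ⟨hx, hk⟩
  rw [e]
  exact MeasurableSet.iUnion fun l => hmeas _ _

theorem measurable_restrict_section {X : Type*} [MeasurableSpace X] {D : Set X} {s : X → ℕ → ℕ}
    (hs : ∀ n k, MeasurableSet {x | x ∈ D ∧ s x n = k}) : Measurable fun x : D => s x := by
  refine measurable_pi_iff.2 fun n => measurable_to_countable' fun k => ?_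
  refine ⟨_, hs n k, ?_⟩
  ext x
  simp

/-- **Jankov–von Neumann**: an analytic subset of a product has a selection over its projection
which is measurable for the `σ`-algebra generated by the analytic sets. -/
theorem exists_selection_of_analyticSet {X Y : Type*} [TopologicalSpace X] [T1Space X]
    [TopologicalSpace Y] {A : Set (X × Y)} (hA : AnalyticSet A) :
    ∃ σ : (Prod.fst '' A : Set X) → Y,
      @Measurable _ _ ((MeasurableSpace.generateFrom {s : Set X | AnalyticSet s}).comap Subtype.val)
        (borel Y) σ ∧ ∀ x : (Prod.fst '' A : Set X), ((x : X), σ x) ∈ A := by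
  rw [AnalyticSet] at hA
  rcases hA with rfl | ⟨φ, hφ, rfl⟩
  · refine ⟨fun x => absurd x.2 (by simp), ?_, fun x => absurd x.2 (by simp)⟩
    have : IsEmpty (Prod.fst '' (∅ : Set (X × Y)) : Set X) := by simp
    intro t _
    rw [Subsingleton.elim (_ ⁻¹' t) ∅]
    exact @MeasurableSet.empty _ (_)
  · let : MeasurableSpace X := MeasurableSpace.generateFrom {s : Set X | AnalyticSet s}
    have hψ : Continuous (Prod.fst ∘ φ) := continuous_fst.comp hφ
    obtain ⟨s, hs, hsm⟩ := exists_section hψ fun a n => by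
      refine MeasurableSpace.measurableSet_generateFrom ?_
      have hcl : IsClosed {z : ℕ → ℕ | ∀ i < n, z i = a i} := by
        simp only [ofPred_forall]
        exact isClosed_iInter fun i => isClosed_iInter fun _ =>
          isClosed_eq (continuous_apply i) continuous_const
      exact hcl.analyticSet.image_of_continuous hψ
    have hr : (Prod.fst '' range φ : Set X) = range (Prod.fst ∘ φ) := (range_comp _ _).symm
    rw [hr]
    let : MeasurableSpace Y := borel Y
    have : BorelSpace Y := ⟨rfl⟩
    refine ⟨fun x => (φ (s x)).2, ?_, fun x => ?_⟩
    · exact (continuous_snd.comp hφ).measurable.comp (measurable_restrict_section hsm)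
    · have h := hs x x.2
      exact ⟨s x, Prod.ext h rfl⟩

/-- A compact subset of a product has a Borel selection over its projection. -/
theorem exists_measurable_selection_of_isCompact {X Y : Type*} [TopologicalSpace X] [T2Space X]
    [MeasurableSpace X] [BorelSpace X] [TopologicalSpace Y] [Nonempty Y] [MeasurableSpace Y]
    [BorelSpace Y] [TopologicalSpace.MetrizableSpace (X × Y)] {A : Set (X × Y)}
    (hA : IsCompact A) :
    ∃ σ : X → Y, Measurable σ ∧ ∀ x ∈ Prod.fst '' A, (x, σ x) ∈ A := by
  classical
  obtain ⟨y₀⟩ := ‹Nonempty Y›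
  rcases A.eq_empty_or_nonempty with rfl | hne
  · exact ⟨fun _ => y₀, measurable_const, by simp⟩
  have : CompactSpace A := isCompact_iff_compactSpace.1 hA
  have : Nonempty A := hne.to_subtype
  let := TopologicalSpace.metrizableSpaceMetric A
  obtain ⟨g, hg, hgs⟩ := exists_nat_bool_continuous_surjective_of_compact A
  -- A compact metrizable set is a continuous image of the Cantor space. Folding the Baire space
  -- onto it by `b` makes `exists_section` applicable, while the images of cylinders, being images
  -- of Cantor cylinders, are compact and hence Borel.
  set b : ℕ → Bool := fun n => decide (n = 0) with hb
  have hbc : Continuous fun z : ℕ → ℕ => fun n => b (z n) :=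
    continuous_pi fun n => (continuous_of_discreteTopology (f := b)).comp (continuous_apply n)
  have hbs : ∀ c, ∃ n, b n = c := fun c => by
    cases c
    · exact ⟨1, rfl⟩
    · exact ⟨0, rfl⟩
  choose b' hb' using hbs
  set φ : (ℕ → ℕ) → X × Y := fun z => (g fun n => b (z n)) with hφ
  have hφc : Continuous φ := continuous_subtype_val.comp (hg.comp hbc)
  have hrange : range φ = A := by
    ext p
    constructor
    · rintro ⟨z, rfl⟩
      exact (g _).2
    · intro hp
      obtain ⟨y, hy⟩ := hgs ⟨p, hp⟩
      exact ⟨fun n => b' (y n), by simp [hφ, hb', hy]⟩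
  obtain ⟨s, hs, hsm⟩ := exists_section (continuous_fst.comp hφc) fun a n => by
    have e : (Prod.fst ∘ φ) '' {z | ∀ i < n, z i = a i} =
        (fun y => (g y : X × Y).1) '' {y : ℕ → Bool | ∀ i < n, y i = b (a i)} := by
      ext x
      constructor
      · rintro ⟨z, hz, rfl⟩
        exact ⟨fun n => b (z n), fun i hi => by simp only [hz i hi], rfl⟩
      · rintro ⟨y, hy, rfl⟩
        refine ⟨fun i => if i < n then a i else b' (y i), fun i hi => by simp [hi], ?_⟩
        simp only [Function.comp, hφ]
        congr 3
        ext1 i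
        split_ifs with hi
        · exact (hy i hi).symm
        · exact hb' _
    rw [e]
    have hcl : IsClosed {y : ℕ → Bool | ∀ i < n, y i = b (a i)} := by
      simp only [ofPred_forall]
      exact isClosed_iInter fun i => isClosed_iInter fun _ =>
        isClosed_eq (continuous_apply i) continuous_const
    exact (hcl.isCompact.image (continuous_fst.comp
      (continuous_subtype_val.comp hg))).isClosed.measurableSet
  have hD : MeasurableSet (range (Prod.fst ∘ φ)) := by
    rw [range_comp, hrange]
    exact (hA.image continuous_fst).isClosed.measurableSet
  refine ⟨fun x => if h : x ∈ range (Prod.fst ∘ φ) then (φ (s (⟨x, h⟩ : range (Prod.fst ∘ φ)))).2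
    else y₀, ?_, fun x hx => ?_⟩
  · exact Measurable.dite ((continuous_snd.comp hφc).measurable.comp
      (measurable_restrict_section hsm)) measurable_const hD
  · rw [← hrange, ← range_comp] at hx
    simp only [dif_pos hx]
    rw [← hrange]
    exact ⟨s x, Prod.ext (hs x hx) rfl⟩

/-! ### Existence of Souslin and Borel selections -/

theorem exists_isSouslinSelection {f : ℝ → ℝ} (hf : Continuous (deriv f)) {u : ℝ × ℝ → ℝ}
    (hu : ContinuousOn u halfPlane) {M : ℝ} (hM : ∀ p, |charSpeed f u p| ≤ M) (G : ℝ) {δ : ℝ}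
    (hδ : 0 < δ) : ∃ σ, IsSouslinSelection f u G δ σ := by
  obtain ⟨σ, h1, h2⟩ := exists_selection_of_analyticSet (analyticSet_derivGraph hf hu hM G hδ)
  exact ⟨σ, h1, h2⟩

theorem nonempty_C1Curve (δ : ℝ) : Nonempty (C1Curve δ) :=
  ⟨(exists_C1Curve (Γ := fun _ => 0) (D := fun _ => 0)
    (fun s _ => hasDerivWithinAt_const s _ 0) continuousOn_const).choose⟩

/-- Borel selections over the projection of a countable union of compact sets. -/
theorem exists_measurable_selection_of_iUnion {X Y : Type*} [TopologicalSpace X] [T2Space X]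
    [MeasurableSpace X] [BorelSpace X] [TopologicalSpace Y] [Nonempty Y] [MeasurableSpace Y]
    [BorelSpace Y] [TopologicalSpace.MetrizableSpace (X × Y)] {A : ℕ → Set (X × Y)}
    (hA : ∀ n, IsCompact (A n)) :
    MeasurableSet (Prod.fst '' ⋃ n, A n) ∧ ∃ σ : (Prod.fst '' ⋃ n, A n : Set X) → Y,
      Measurable σ ∧ ∀ x : (Prod.fst '' ⋃ n, A n : Set X), ((x : X), σ x) ∈ ⋃ n, A n := by
  classical
  have hm : ∀ n, MeasurableSet (Prod.fst '' A n) := fun n =>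
    ((hA n).image continuous_fst).isClosed.measurableSet
  rw [image_iUnion]
  refine ⟨MeasurableSet.iUnion hm, ?_⟩
  choose σ hσ hσA using fun n => exists_measurable_selection_of_isCompact (hA n)
  have hex : ∀ x : (⋃ n, Prod.fst '' A n : Set X), ∃ n, (x : X) ∈ Prod.fst '' A n := fun x =>
    mem_iUnion.1 x.2
  refine ⟨fun x => σ (Nat.find (hex x)) x, ?_, fun x => ?_⟩
  · exact Measurable.find (f := fun n (x : (⋃ n, Prod.fst '' A n : Set X)) => σ n x)
      (p := fun n (x : (⋃ n, Prod.fst '' A n : Set X)) => (x : X) ∈ Prod.fst '' A n)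
      (fun n => (hσ n).comp measurable_subtype_coe) (fun n => measurable_subtype_coe (hm n)) hex
  · exact mem_iUnion.2 ⟨_, hσA _ _ (Nat.find_spec (hex x))⟩

theorem exists_isBorelSelection {f : ℝ → ℝ} (hf : Continuous (deriv f)) {u : ℝ × ℝ → ℝ}
    (hu : ContinuousOn u halfPlane) {M : ℝ} (hM : ∀ p, |charSpeed f u p| ≤ M) (G : ℝ) {δ : ℝ}
    (hδ : 0 < δ) {ε : ℕ → ℝ} (hε : ∀ k, 0 < ε k) : ∃ S σ, IsBorelSelection f u G δ ε S σ := by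
  let : MeasurableSpace (C1Curve δ × ℝ) := borel _
  have : BorelSpace (C1Curve δ × ℝ) := ⟨rfl⟩
  have := nonempty_C1Curve δ
  -- The index `n` codes the pair of increment radius and ball; the precision `ε k / 2` leaves room
  -- for the strict inequality required.
  set A : ℕ → ℕ → Set ((ℝ × ℝ) × C1Curve δ × ℝ) := fun k n =>
    approxGraph f u G δ (Metric.closedBall 0 n.unpair.2) (ε k / 2) (δ / (n.unpair.1 + 1)) with hA
  have hAc : ∀ k n, IsCompact (A k n) := fun k n =>
    isCompact_approxGraph hf hu hM G hδ.le (isCompact_closedBall _ _) _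
      (div_le_self hδ.le (by linarith [(Nat.cast_nonneg n.unpair.1 : (0 : ℝ) ≤ n.unpair.1)]))
  choose hm σ hσ hσA using fun k => exists_measurable_selection_of_iUnion (hAc k)
  -- Each projection is σ-compact, so `S` is Borel. It contains `E` but may be larger, because the
  -- approximating curve may change with `k`.
  set S : Set (ℝ × ℝ) := ⋂ k, Prod.fst '' ⋃ n, A k n with hS
  have hSk : ∀ k, S ⊆ Prod.fst '' ⋃ n, A k n := fun k => iInter_subset _ k
  have hmem : ∀ k (p : S), ((p : ℝ × ℝ), σ k ⟨p, hSk k p.2⟩) ∈ ⋃ n, A k n := fun k p =>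
    hσA k ⟨p, hSk k p.2⟩
  refine ⟨S, fun k p => σ k ⟨p, hSk k p.2⟩, MeasurableSet.iInter hm, ?_, fun k => ?_,
    fun k p => ?_, fun k p => ?_, fun k p => ?_⟩
  · rintro _ ⟨q, hq, rfl⟩
    refine mem_iInter.2 fun k => ⟨q, mem_iUnion.2 ?_, rfl⟩
    obtain ⟨m, j, h⟩ := exists_mem_approxGraph hδ hq (half_pos (hε k))
    refine ⟨Nat.pair m j, ?_⟩
    simp only [hA, Nat.unpair_pair]
    exact h
  · exact (hσ k).comp (measurable_subtype_coe.subtype_mk)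
  · obtain ⟨n, hn⟩ := mem_iUnion.1 (hmem k p)
    exact hn.1.1
  · obtain ⟨n, hn⟩ := mem_iUnion.1 (hmem k p)
    have := hε k
    constructor <;> linarith [hn.2.1.1, hn.2.1.2]
  · obtain ⟨n, hn⟩ := mem_iUnion.1 (hmem k p)
    have hpos : 0 < δ / (n.unpair.1 + 1 : ℝ) := by positivity
    filter_upwards [self_mem_nhdsWithin,
      nhdsWithin_le_nhds (Metric.closedBall_mem_nhds (0 : ℝ) hpos)] with h hh0 hh
    exact (hn.2.2 h hh0 (by simpa using hh)).trans_lt (half_lt_self (hε k))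

/-! ### From pointwise derivatives to the source -/

/-- `u` is `G`-Lipschitz along every characteristic. -/
def LipschitzAlongCharacteristics (f : ℝ → ℝ) (u : ℝ × ℝ → ℝ) (G : ℝ) : Prop :=
  ∀ (I : Set ℝ) (γ : ℝ → ℝ), IsCharacteristic f u I γ → ∀ r ∈ I, ∀ s ∈ I, r ≤ s →
    |u (s, γ s) - u (r, γ r)| ≤ G * (s - r)

/-- `g` is almost everywhere, from time `a` on, the derivative of `u` along every
characteristic. -/
def IsDerivAlongCharacteristics (f : ℝ → ℝ) (u g : ℝ × ℝ → ℝ) (a : ℝ) : Prop :=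
  ∀ (I : Set ℝ) (γ : ℝ → ℝ), IsCharacteristic f u I γ →
    ∀ᵐ t : ℝ, t ∈ I → a ≤ t → HasDerivAt (fun s => u (s, γ s)) (g (t, γ t)) t

section Lipschitz

variable {f : ℝ → ℝ} {u g : ℝ × ℝ → ℝ} {G : ℝ}

theorem LipschitzAlongCharacteristics.lipschitzOnWith (h : LipschitzAlongCharacteristics f u G)
    (hG : 0 ≤ G) {I : Set ℝ} {γ : ℝ → ℝ} (hγ : IsCharacteristic f u I γ) :
    LipschitzOnWith G.toNNReal (fun s => u (s, γ s)) I := by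
  refine LipschitzOnWith.of_dist_le_mul fun x hx y hy => ?_
  rw [Real.dist_eq, Real.dist_eq, Real.coe_toNNReal _ hG]
  rcases le_total x y with hxy | hxy
  · rw [abs_sub_comm, abs_sub_comm x y, abs_of_nonneg (sub_nonneg.2 hxy)]
    exact h I γ hγ x hx y hy hxy
  · rw [abs_of_nonneg (sub_nonneg.2 hxy)]
    exact h I γ hγ y hy x hx hxy

theorem LipschitzAlongCharacteristics.ae_exists_hasDerivAt
    (h : LipschitzAlongCharacteristics f u G) (hG : 0 ≤ G) {I : Set ℝ} {γ : ℝ → ℝ}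
    (hγ : IsCharacteristic f u I γ) :
    ∀ᵐ t : ℝ, t ∈ I → 0 < t → ∃ d, HasDerivAt (fun s => u (s, γ s)) d t ∧ |d| ≤ G := by
  have hl := h.lipschitzOnWith hG hγ
  filter_upwards [hl.ae_differentiableWithinAt_of_mem (μ := volume)] with t ht htI ht0
  have hn := hγ.mem_nhds htI ht0
  refine ⟨_, ((ht htI).differentiableAt hn).hasDerivAt, ?_⟩
  have := norm_deriv_le_of_lipschitzOn hn hl
  rwa [Real.coe_toNNReal _ hG] at this

theorem LipschitzAlongCharacteristics.absolutelyContinuous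
    (h : LipschitzAlongCharacteristics f u G) (hG : 0 ≤ G) {I : Set ℝ} {γ : ℝ → ℝ}
    (hγ : IsCharacteristic f u I γ) {r s : ℝ} (hr : r ∈ I) (hs : s ∈ I) :
    AbsolutelyContinuousOnInterval (fun s => u (s, γ s)) r s :=
  ((h.lipschitzOnWith hG hγ).mono
    (hγ.ordConnected.uIcc_subset hr hs)).absolutelyContinuousOnInterval

theorem IsDerivAlongCharacteristics.ae_deriv_eq {a : ℝ} (hg : IsDerivAlongCharacteristics f u g a)
    {I : Set ℝ} {γ : ℝ → ℝ} (hγ : IsCharacteristic f u I γ) {r s : ℝ} (hr : r ∈ I) (hs : s ∈ I)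
    (ha : a ≤ r) (hrs : r ≤ s) :
    ∀ᵐ t : ℝ, t ∈ uIoc r s → deriv (fun s => u (s, γ s)) t = g (t, γ t) := by
  filter_upwards [hg I γ hγ] with t ht htm
  rw [uIoc_of_le hrs] at htm
  exact (ht (hγ.ordConnected.out hr hs (Ioc_subset_Icc_self htm)) (ha.trans htm.1.le)).deriv

theorem IsDerivAlongCharacteristics.integrates {a : ℝ} (hg : IsDerivAlongCharacteristics f u g a)
    (h : LipschitzAlongCharacteristics f u G) (hG : 0 ≤ G) :
    IntegratesAlongCharacteristics f u g a := by
  intro I γ hγ r hr s hs ha hrs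
  have hac := h.absolutelyContinuous hG hγ hr hs
  have hae := hg.ae_deriv_eq hγ hr hs ha hrs
  constructor
  · exact hac.intervalIntegrable_deriv.congr_ae
      ((ae_restrict_iff' measurableSet_uIoc).2 hae)
  · rw [← hac.integral_deriv_eq_sub]
    exact intervalIntegral.integral_congr_ae hae

theorem IsDerivAlongCharacteristics.solves {a : ℝ} (hg : IsDerivAlongCharacteristics f u g a)
    (h : LipschitzAlongCharacteristics f u G) (hG : 0 ≤ G) (ha : 0 ≤ a) :
    SolvesAlongCharacteristics f u g (openHalfPlane a) := by
  intro I γ hγ φ hφ hφc hsub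
  rcases (tsupport φ).eq_empty_or_nonempty with he | hne
  · have : φ = 0 := tsupport_eq_empty_iff.1 he
    simp [this]
  have hφc' : IsCompact (tsupport φ) := hφc
  obtain ⟨m, hm⟩ := hφc'.exists_isLeast hne
  obtain ⟨M, hM⟩ := hφc'.exists_isGreatest hne
  have hmI := hsub hm.1
  have hMI := hsub hM.1
  have hma : a < m := hmI.2
  have hMa : a < M := hMI.2
  obtain ⟨r, hr, hrm, hra⟩ : ∃ r ∈ I, r < m ∧ a ≤ r := by
    obtain ⟨r, h1, h2, h3⟩ := Filter.nonempty_of_mem (f := 𝓝[<] m)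
      (inter_mem (nhdsWithin_le_nhds (hγ.mem_nhds hmI.1 (ha.trans_lt hma)))
        (inter_mem self_mem_nhdsWithin (nhdsWithin_le_nhds (Ioi_mem_nhds hma))))
    exact ⟨r, h1, h2, le_of_lt h3⟩
  obtain ⟨s, hs, hsM⟩ : ∃ s ∈ I, M < s := by
    obtain ⟨s, h1, h2⟩ := Filter.nonempty_of_mem (f := 𝓝[>] M)
      (inter_mem (nhdsWithin_le_nhds (hγ.mem_nhds hMI.1 (ha.trans_lt hMa))) self_mem_nhdsWithin)
    exact ⟨s, h1, h2⟩
  have hrs : r ≤ s := (hrm.le.trans (hm.2 hM.1)).trans hsM.le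
  have hK : tsupport φ ⊆ Ioc r s := fun t ht =>
    ⟨hrm.trans_le (hm.2 ht), (hM.2 ht).trans hsM.le⟩
  have hφr : φ r = 0 := image_eq_zero_of_notMem_tsupport fun h => not_lt.2 (hm.2 h) hrm
  have hφs : φ s = 0 := image_eq_zero_of_notMem_tsupport fun h => not_lt.2 (hM.2 h) hsM
  have hφac : AbsolutelyContinuousOnInterval φ r s :=
    (hφ.of_le (by exact_mod_cast le_top)).contDiffOn.absolutelyContinuousOnInterval
  -- Integration by parts for absolutely continuous functions; the endpoints lie outside the support
  -- of `φ`, so the boundary terms vanish.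
  have key := hφac.integral_mul_deriv_eq_deriv_mul (h.absolutelyContinuous hG hγ hr hs)
  rw [hφr, hφs, zero_mul, zero_mul, sub_zero, zero_sub] at key
  have e1 : ∫ t, deriv φ t * u (t, γ t) = ∫ t in r..s, deriv φ t * u (t, γ t) := by
    refine (intervalIntegral.integral_eq_integral_of_support_subset ?_).symm
    exact (Function.support_mul_subset_left _ _).trans ((support_deriv_subset).trans hK)
  have e2 : ∫ t, φ t * g (t, γ t) = ∫ t in r..s, φ t * g (t, γ t) := by
    refine (intervalIntegral.integral_eq_integral_of_support_subset ?_).symm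
    exact (Function.support_mul_subset_left _ _).trans ((subset_tsupport φ).trans hK)
  have e3 : ∫ t in r..s, φ t * g (t, γ t) =
      ∫ t in r..s, φ t * deriv (fun s => u (s, γ s)) t := by
    refine intervalIntegral.integral_congr_ae ?_
    filter_upwards [hg.ae_deriv_eq hγ hr hs hra hrs] with t ht htm
    rw [ht htm]
  rw [e1, e2, e3, key, neg_neg]

/-- A function which vanishes before time `δ` and at the inflection values, and is the derivative
along characteristics elsewhere, is a universal source. -/
theorem isUniversalSource_of_ae_eq (hf : ContDiff ℝ 2 f) (hN : volume (inflectionSet f) = 0)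
    (hu : ContinuousOn u halfPlane) {M : ℝ} (hM : ∀ p, |charSpeed f u p| ≤ M)
    (h : LipschitzAlongCharacteristics f u G) (hG : 0 ≤ G) {δ : ℝ} (hδ : 0 < δ)
    (hbd : ∀ p, |g p| ≤ G) (hearly : ∀ p : ℝ × ℝ, p.1 < δ → g p = 0)
    (hinf : ∀ p, u p ∈ inflectionSet f → g p = 0)
    (hval : ∀ (I : Set ℝ) (γ : ℝ → ℝ), IsCharacteristic f u I γ →
      ∀ᵐ t : ℝ, t ∈ I → δ ≤ t → u (t, γ t) ∉ inflectionSet f →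
        (t, γ t) ∈ derivSet f u G δ → ∀ d, HasDerivAt (fun s => u (s, γ s)) d t →
          g (t, γ t) = d) :
    IsUniversalSource f u G δ g ∧ IsDerivAlongCharacteristics f u g δ := by
  have hf' := hf.continuous_deriv one_le_two
  have hder : IsDerivAlongCharacteristics f u g δ := by
    intro I γ hγ
    filter_upwards [h.ae_exists_hasDerivAt hG hγ, hval I γ hγ,
      ae_eq_zero_of_hasDerivAt_of_mem_null (fun s => u (s, γ s)) hN] with t h1 h2 h3 htI hδt
    obtain ⟨d, hd, hdG⟩ := h1 htI (hδ.trans_le hδt)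
    -- Over `N` the derivative is almost everywhere zero, as is `g`; elsewhere the selected value is
    -- the derivative.
    have : g (t, γ t) = d := by
      by_cases hz : u (t, γ t) ∈ inflectionSet f
      · rw [h3 hz d hd, hinf _ hz]
      · exact h2 htI hδt hz (hγ.mem_derivSet hf' hu hM hδ htI hδt hd hdG) d hd
    rwa [this]
  -- Before time `δ` both `g` and the derivative of the vanishing `u` are zero; the times `0` and
  -- `δ` need separate care only at `0`, a null set.
  have hzero : (∀ p : ℝ × ℝ, 0 ≤ p.1 → p.1 ≤ δ → u p = 0) →
      IsDerivAlongCharacteristics f u g 0 := by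
    intro hz I γ hγ
    filter_upwards [hder I γ hγ, measure_eq_zero_iff_ae_notMem.1
      (Real.volume_singleton (a := 0))] with t h1 h2 htI ht0
    have ht0' : 0 < t := lt_of_le_of_ne ht0 (Ne.symm h2)
    rcases lt_or_ge t δ with hlt | hle
    · rw [hearly _ hlt]
      refine (hasDerivAt_const t (0 : ℝ)).congr_of_eventuallyEq ?_
      filter_upwards [Ioo_mem_nhds ht0' hlt] with s hs using hz _ hs.1.le hs.2.le
    · exact h1 htI hle
  refine ⟨⟨hbd, ?_, hder.integrates h hG, hder.solves h hG hδ.le,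
    fun hz => (hzero hz).integrates h hG, fun hz => (hzero hz).solves h hG le_rfl⟩, hder⟩
  intro I γ hγ
  filter_upwards [h.ae_exists_hasDerivAt hG hγ, hval I γ hγ, hγ.ae_abs_sub_le hf hu hδ]
    with t h1 h2 h3 htI hδt
  obtain ⟨d, hd, hdG⟩ := h1 htI (hδ.trans_le hδt)
  have hE := hγ.mem_derivSet hf' hu hM hδ htI hδt hd hdG
  refine ⟨hE, fun hz Γ ζ hΓ => ?_⟩
  rw [h2 htI hδt hz hE d hd, ← sub_eq_zero, ← abs_nonpos_iff]
  refine le_of_forall_pos_le_add fun e he => ?_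
  rw [zero_add]
  refine h3 htI hδt hz d hd Γ hΓ.1 ζ e ?_
  filter_upwards [hΓ.2.2.eventually (Metric.ball_mem_nhds ζ he)] with x hx
  rwa [← Real.dist_eq, dist_comm]

theorem le_time_of_mem_derivSet {δ : ℝ} {p : ℝ × ℝ} (hp : p ∈ derivSet f u G δ) : δ ≤ p.1 := by
  obtain ⟨q, hq, rfl⟩ := hp
  exact hq.1.1

theorem isUniversalSource_selectedSource (hf : ContDiff ℝ 2 f)
    (hN : volume (inflectionSet f) = 0) (hu : ContinuousOn u halfPlane) {M : ℝ}
    (hM : ∀ p, |charSpeed f u p| ≤ M) (h : LipschitzAlongCharacteristics f u G) (hG : 0 ≤ G)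
    {δ : ℝ} (hδ : 0 < δ) {σ : derivSet f u G δ → C1Curve δ × ℝ}
    (hσ : IsSouslinSelection f u G δ σ) : IsUniversalSource f u G δ (selectedSource f u σ) := by
  refine (isUniversalSource_of_ae_eq hf hN hu hM h hG hδ (fun p => ?_) (fun p hp => ?_)
    (fun p hp => ?_) fun I γ hγ => ?_).1
  · unfold selectedSource
    split_ifs with hp
    · exact abs_le.2 (hσ.mem ⟨p, hp.1⟩).2.1
    · simpa using hG
  · exact dif_neg fun hE => absurd (le_time_of_mem_derivSet hE.1) (not_le.2 hp)
  · exact dif_neg fun hE => hE.2 hp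
  · filter_upwards [hγ.ae_abs_sub_le hf hu hδ] with t h3 htI hδt hz hE d hd
    have e : selectedSource f u σ (t, γ t) = (σ ⟨(t, γ t), hE⟩).2 := dif_pos ⟨hE, hz⟩
    have hm := hσ.mem ⟨(t, γ t), hE⟩
    rw [e, ← sub_eq_zero, ← abs_nonpos_iff]
    refine le_of_forall_pos_le_add fun ε hε => ?_
    rw [zero_add]
    refine h3 htI hδt hz d hd _ hm.1 _ ε ?_
    filter_upwards [hm.2.2.eventually (Metric.ball_mem_nhds _ hε)] with x hx
    rwa [← Real.dist_eq, dist_comm]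

theorem abs_liminf_le {ζ ε : ℕ → ℝ} (hε : Tendsto ε atTop (𝓝 0))
    (hζ : ∀ k, ζ k ∈ Icc (-G - ε k) (G + ε k)) : |liminf ζ atTop| ≤ G := by
  obtain ⟨B, hB⟩ := hε.bddAbove_range
  have hB' : ∀ k, ε k ≤ B := fun k => hB (mem_range_self k)
  have hbelow : IsBoundedUnder (· ≥ ·) atTop ζ :=
    isBoundedUnder_of ⟨-G - B, fun k => by linarith [(hζ k).1, hB' k]⟩
  have habove : IsBoundedUnder (· ≤ ·) atTop ζ :=
    isBoundedUnder_of ⟨G + B, fun k => by linarith [(hζ k).2, hB' k]⟩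
  rw [abs_le]
  constructor
  · refine le_of_forall_pos_le_add fun e he => ?_
    rw [← sub_le_iff_le_add]
    refine le_liminf_of_le habove.isCoboundedUnder_ge ?_
    filter_upwards [hε.eventually (gt_mem_nhds he)] with k hk
    linarith [(hζ k).1]
  · refine liminf_le_of_le hbelow fun b hb => ?_
    refine le_of_tendsto_of_tendsto (f := fun _ : ℕ => b) (g := fun k => G + ε k) (b := atTop)
      tendsto_const_nhds ?_ ?_
    · simpa using hε.const_add G
    · filter_upwards [hb] with k hk using hk.trans (hζ k).2

theorem isUniversalSource_limitSource (hf : ContDiff ℝ 2 f)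
    (hN : volume (inflectionSet f) = 0) (hu : ContinuousOn u halfPlane) {M : ℝ}
    (hM : ∀ p, |charSpeed f u p| ≤ M) (h : LipschitzAlongCharacteristics f u G) (hG : 0 ≤ G)
    {δ : ℝ} (hδ : 0 < δ) {ε : ℕ → ℝ} (hε : Tendsto ε atTop (𝓝 0)) {S : Set (ℝ × ℝ)}
    {σ : ℕ → S → C1Curve δ × ℝ} (hσ : IsBorelSelection f u G δ ε S σ) :
    IsUniversalSource f u G δ (limitSource f u σ) ∧
      IsDerivAlongCharacteristics f u (limitSource f u σ) δ := by
  refine isUniversalSource_of_ae_eq hf hN hu hM h hG hδ (fun p => ?_) (fun p hp => ?_)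
    (fun p hp => ?_) fun I γ hγ => ?_
  · unfold limitSource
    split_ifs with hp
    · exact abs_liminf_le hε fun k => hσ.bound k ⟨p, hp.1⟩
    · simpa using hG
  · exact dif_neg fun hE => absurd (hσ.mem 0 ⟨p, hE.1⟩).1 (not_le.2 hp)
  · exact dif_neg fun hE => hE.2 hp
  · filter_upwards [hγ.ae_abs_sub_le hf hu hδ] with t h3 htI hδt hz hE d hd
    have hS := hσ.subset hE
    have e : limitSource f u σ (t, γ t) = liminf (fun k => (σ k ⟨(t, γ t), hS⟩).2) atTop :=
      dif_pos ⟨hS, hz⟩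
    rw [e]
    -- The selected characteristics depend on `k`, yet all selected numbers are within `ε k` of the
    -- same derivative along `γ`, so the lower limit is a limit.
    refine Tendsto.liminf_eq ?_
    rw [tendsto_iff_dist_tendsto_zero]
    refine squeeze_zero (fun _ => dist_nonneg) (fun k => ?_) hε
    rw [Real.dist_eq]
    exact h3 htI hδt hz d hd _ (hσ.mem k ⟨(t, γ t), hS⟩) _ _ (hσ.approx k ⟨(t, γ t), hS⟩)

end Lipschitz

/-! ### Measurability of the sources and gluing in time -/

theorem isClosed_inflectionSet (f : ℝ → ℝ) : IsClosed (inflectionSet f) :=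
  (isOpen_interior.union isOpen_interior).isClosed_compl

/-- The points of a set contained in the half plane at which `u` has no inflection value. -/
theorem measurableSet_inter_notMem_inflectionSet (f : ℝ → ℝ) {u : ℝ × ℝ → ℝ}
    (hu : ContinuousOn u halfPlane) {m : MeasurableSpace (ℝ × ℝ)}
    (hm : borel (ℝ × ℝ) ≤ m) {S : Set (ℝ × ℝ)} (hS : MeasurableSet[m] S)
    (hsub : ∀ p ∈ S, 0 ≤ p.1) : MeasurableSet[m] {p | p ∈ S ∧ u p ∉ inflectionSet f} := by
  have e : {p | p ∈ S ∧ u p ∉ inflectionSet f} =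
      S ∩ {p | pastExtension u p ∉ inflectionSet f} := by
    ext p
    refine and_congr_right fun hp => ?_
    rw [mem_ofPred_eq, pastExtension_of_nonneg u (hsub p hp)]
  rw [e]
  refine MeasurableSet.inter hS (hm _ ?_)
  refine MeasurableSpace.measurableSet_generateFrom ?_
  exact (isClosed_inflectionSet f).isOpen_compl.preimage (continuous_pastExtension hu)

theorem borel_le_souslinSpace : borel (ℝ × ℝ) ≤ souslinSpace := by
  intro s hs
  have hs' : MeasurableSet s := by rwa [BorelSpace.measurable_eq (α := ℝ × ℝ)]
  exact MeasurableSpace.measurableSet_generateFrom hs'.analyticSet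

theorem measurable_dite_zero {X : Type*} {m : MeasurableSpace X} {S : Set X} {P : X → Prop}
    {dec : ∀ p, Decidable (P p)} (hPS : ∀ p, P p → p ∈ S) (hP : MeasurableSet {p | P p}) {g : S → ℝ}
    (hg : Measurable g) : Measurable fun p => if h : P p then g ⟨p, hPS p h⟩ else 0 :=
  Measurable.dite (s := {p | P p}) (f := fun p : {p | P p} => g ⟨p, hPS p p.2⟩)
    (hg.comp measurable_subtype_coe.subtype_mk) measurable_const hP

theorem measurable_snd_borel (X : Type*) [TopologicalSpace X] :
    Measurable[borel (X × ℝ)] (Prod.snd : X × ℝ → ℝ) := by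
  let : MeasurableSpace (X × ℝ) := borel _
  have : BorelSpace (X × ℝ) := ⟨rfl⟩
  exact continuous_snd.measurable

theorem measurable_selectedSource {f : ℝ → ℝ} (hf : Continuous (deriv f)) {u : ℝ × ℝ → ℝ}
    (hu : ContinuousOn u halfPlane) {M : ℝ} (hM : ∀ p, |charSpeed f u p| ≤ M) {G δ : ℝ}
    (hδ : 0 < δ) {σ : derivSet f u G δ → C1Curve δ × ℝ} (hσ : IsSouslinSelection f u G δ σ) :
    @Measurable _ _ souslinSpace _ (selectedSource f u σ) := by
  have hE : MeasurableSet[souslinSpace] (derivSet f u G δ) :=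
    MeasurableSpace.measurableSet_generateFrom
      ((analyticSet_derivGraph hf hu hM G hδ).image_of_continuous continuous_fst)
  have hT := measurableSet_inter_notMem_inflectionSet f hu borel_le_souslinSpace hE
    fun p hp => hδ.le.trans (le_time_of_mem_derivSet hp)
  exact @measurable_dite_zero _ souslinSpace _
    (fun p => p ∈ derivSet f u G δ ∧ u p ∉ inflectionSet f) _ (fun p hp => hp.1) hT (fun p => (σ p).2)
    ((measurable_snd_borel _).comp hσ.measurable)

theorem measurable_limitSource {f : ℝ → ℝ} {u : ℝ × ℝ → ℝ} (hu : ContinuousOn u halfPlane)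
    {G δ : ℝ} (hδ : 0 < δ) {ε : ℕ → ℝ} {S : Set (ℝ × ℝ)} {σ : ℕ → S → C1Curve δ × ℝ}
    (hσ : IsBorelSelection f u G δ ε S σ) : Measurable (limitSource f u σ) := by
  have hT := measurableSet_inter_notMem_inflectionSet f hu
    (BorelSpace.measurable_eq (α := ℝ × ℝ)).ge hσ.measurableSet
    fun p hp => hδ.le.trans (hσ.mem 0 ⟨p, hp⟩).1
  refine measurable_dite_zero (P := fun p => p ∈ S ∧ u p ∉ inflectionSet f) (fun p hp => hp.1) hT
    (g := fun p => liminf (fun k => (σ k p).2) atTop) ?_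
  exact Measurable.liminf fun k => (measurable_snd_borel _).comp (hσ.measurable k)

/-- A countable family of Borel derivatives along characteristics, the `n`-th one being valid from
time `1 / (n + 1)` on, can be glued. -/
theorem exists_isDerivAlongCharacteristics_zero {f : ℝ → ℝ} {u : ℝ × ℝ → ℝ} {G : ℝ}
    {g : ℕ → ℝ × ℝ → ℝ} (hgm : ∀ n, Measurable (g n)) (hgG : ∀ n p, |g n p| ≤ G)
    (hg : ∀ n : ℕ, IsDerivAlongCharacteristics f u (g n) (1 / (n + 1))) :
    ∃ g₀ : ℝ × ℝ → ℝ, Measurable g₀ ∧ (∀ p, |g₀ p| ≤ G) ∧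
      IsDerivAlongCharacteristics f u g₀ 0 := by
  -- With `n = ⌊1 / t⌋₊` one has `1 / (n + 1) ≤ t`, so the `n`-th source is valid at time `t > 0`.
  -- At times `t ≤ 0` the index is `0`, which is harmless.
  refine ⟨fun p => g ⌊1 / p.1⌋₊ p, ?_, fun p => hgG _ p, fun I γ hγ => ?_⟩
  · have h1 : Measurable fun q : ℕ × ℝ × ℝ => g q.1 q.2 := measurable_from_prod_countable_right hgm
    have h2 : Measurable fun p : ℝ × ℝ => (⌊1 / p.1⌋₊, p) :=
      (Nat.measurable_floor.comp (measurable_fst.const_div 1)).prodMk measurable_id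
    exact h1.comp h2
  · filter_upwards [ae_all_iff.2 fun n => hg n I γ hγ, measure_eq_zero_iff_ae_notMem.1
      (Real.volume_singleton (a := 0))] with t h1 h2 htI ht0
    have ht0' : 0 < t := lt_of_le_of_ne ht0 (Ne.symm h2)
    refine h1 ⌊1 / t⌋₊ htI ?_
    rw [div_le_comm₀ (by positivity) ht0']
    exact (Nat.lt_floor_add_one _).le

/-- The extension to negative times need not have compact support, but it takes no new values: the
speed is controlled on `K` and equals `f'(0)` where `u` vanishes. This bound makes solutions global
and their families equicontinuous. -/
theorem exists_bound_charSpeed {f : ℝ → ℝ} (hf : Continuous (deriv f)) {u : ℝ × ℝ → ℝ}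
    (hu : ContinuousOn u halfPlane)
    (hsupp : ∃ K : Set (ℝ × ℝ), IsCompact K ∧ ∀ p ∈ halfPlane, p ∉ K → u p = 0) :
    ∃ M, ∀ p, |charSpeed f u p| ≤ M := by
  obtain ⟨K, hK, h0⟩ := hsupp
  have hc : Continuous (charSpeed f u) := hf.comp (continuous_pastExtension hu)
  obtain ⟨M, hM⟩ := hK.exists_bound_of_continuousOn hc.continuousOn
  refine ⟨max M |deriv f 0|, fun p => ?_⟩
  have hp : (max p.1 0, p.2) ∈ halfPlane := le_max_right p.1 0
  by_cases hpK : (max p.1 0, p.2) ∈ K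
  · refine le_max_of_le_left ?_
    have := hM _ hpK
    rwa [charSpeed, pastExtension_of_nonneg u hp] at this
  · refine le_max_of_le_right (le_of_eq ?_)
    rw [charSpeed, pastExtension, h0 _ hp hpK]

theorem hasSmoothApproximations {f : ℝ → ℝ} (hf : Continuous f) {u gE : ℝ × ℝ → ℝ}
    (hu : ContinuousOn u halfPlane) {G : ℝ}
    (hgG : ∀ᵐ p ∂(volume.restrict (openHalfPlane 0)), |gE p| ≤ G)
    (hsol : IsDistributionalSolution f u gE (openHalfPlane 0)) :
    HasSmoothApproximations (pastExtension u) (fun p => f (pastExtension u p)) G := by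
  have huc := continuous_pastExtension hu
  intro r hr K hK hKr η hη
  refine exists_smooth_approximation huc (hf.comp huc) hgG (fun φ h1 h2 h3 => ?_) hr hK hKr hη
  rw [← hsol φ h1 h2 h3]
  refine setIntegral_congr_fun (measurableSet_openHalfPlane 0) fun p hp => ?_
  have hp' : 0 < p.1 := hp
  simp only [Function.comp, pastExtension_of_nonneg u hp'.le]

end BalanceLaw

end

theorem theoremT
    (f : ℝ → ℝ) (hf : ContDiff ℝ 2 f)
    (hN : volume (BalanceLaw.inflectionSet f) = 0)
    (u : ℝ × ℝ → ℝ) (hu : ContinuousOn u BalanceLaw.halfPlane)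
    (husupp : ∃ K : Set (ℝ × ℝ), IsCompact K ∧ ∀ p ∈ BalanceLaw.halfPlane, p ∉ K → u p = 0)
    (G : ℝ) (gE : ℝ × ℝ → ℝ)
    (hgm : AEStronglyMeasurable gE (volume.restrict (BalanceLaw.openHalfPlane 0)))
    (hgG : ∀ᵐ p ∂(volume.restrict (BalanceLaw.openHalfPlane 0)), |gE p| ≤ G)
    (hsol : BalanceLaw.IsDistributionalSolution f u gE (BalanceLaw.openHalfPlane 0)) :
    -- for every `δ > 0`: Souslin selections exist, and each of them gives a universal source
    (∀ δ : ℝ, 0 < δ →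
      (∃ σ, BalanceLaw.IsSouslinSelection f u G δ σ) ∧
      (∀ σ, BalanceLaw.IsSouslinSelection f u G δ σ →
        @Measurable _ _ BalanceLaw.souslinSpace _ (BalanceLaw.selectedSource f u σ) ∧
        BalanceLaw.IsUniversalSource f u G δ (BalanceLaw.selectedSource f u σ))) ∧
    -- the same for Borel selections of approximate derivatives
    (∀ δ : ℝ, 0 < δ → ∀ ε : ℕ → ℝ, (∀ k, 0 < ε k) → Tendsto ε atTop (𝓝 0) →
      (∃ S σ, BalanceLaw.IsBorelSelection f u G δ ε S σ) ∧
      (∀ S σ, BalanceLaw.IsBorelSelection f u G δ ε S σ →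
        Measurable (BalanceLaw.limitSource f u σ) ∧
        BalanceLaw.IsUniversalSource f u G δ (BalanceLaw.limitSource f u σ) ∧
        BalanceLaw.IsBroadSolution f u (BalanceLaw.limitSource f u σ)
          (BalanceLaw.openHalfPlane δ))) ∧
    -- hence `u` is a broad solution on the whole open half plane
    (∃ g : ℝ × ℝ → ℝ, (∀ p, |g p| ≤ G) ∧
      BalanceLaw.IntegratesAlongCharacteristics f u g 0 ∧
      BalanceLaw.IsBroadSolution f u g (BalanceLaw.openHalfPlane 0)) := by
  have hf' : Continuous (deriv f) := hf.continuous_deriv one_le_two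
  have hG : 0 ≤ G := BalanceLaw.nonneg_of_ae_bound hgG
  obtain ⟨M, hM⟩ := BalanceLaw.exists_bound_charSpeed hf' hu husupp
  have happ := BalanceLaw.hasSmoothApproximations hf.continuous hu hgG hsol
  have hlip : BalanceLaw.LipschitzAlongCharacteristics f u G := fun I γ hγ r hr s hs hrs =>
    hγ.abs_sub_le hf hN hu hG happ hr hs hrs
  have hcont : ∀ a, 0 ≤ a → ContinuousOn u (BalanceLaw.openHalfPlane a) := fun a ha =>
    hu.mono fun p (hp : a < p.1) => ha.trans hp.le
  refine ⟨fun δ hδ => ⟨BalanceLaw.exists_isSouslinSelection hf' hu hM G hδ, fun σ hσ =>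
    ⟨BalanceLaw.measurable_selectedSource hf' hu hM hδ hσ,
      BalanceLaw.isUniversalSource_selectedSource hf hN hu hM hlip hG hδ hσ⟩⟩,
    fun δ hδ ε hε hε0 => ⟨BalanceLaw.exists_isBorelSelection hf' hu hM G hδ hε, fun S σ hσ => ?_⟩,
    ?_⟩
  · have hm := BalanceLaw.measurable_limitSource hu hδ hσ
    have huniv := (BalanceLaw.isUniversalSource_limitSource hf hN hu hM hlip hG hδ hε0 hσ).1
    exact ⟨hm, huniv, hcont δ hδ.le, hm, ⟨G, fun p _ => huniv.bounded p⟩, huniv.solves⟩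
  -- The Borel sources for `δ = 1 / (n + 1)` are glued into one that is valid at all positive times.
  · have hδ : ∀ n : ℕ, (0 : ℝ) < 1 / (n + 1) := fun n => Nat.one_div_pos_of_nat
    choose S σ hσ using fun n =>
      BalanceLaw.exists_isBorelSelection hf' hu hM G (hδ n) (ε := fun k : ℕ => 1 / (k + 1 : ℝ))
        fun k => Nat.one_div_pos_of_nat
    have hsrc := fun n => BalanceLaw.isUniversalSource_limitSource hf hN hu hM hlip hG (hδ n)
      tendsto_one_div_add_atTop_nhds_zero_nat (hσ n)
    obtain ⟨g, hgm, hgG, hg⟩ := BalanceLaw.exists_isDerivAlongCharacteristics_zero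
      (fun n => BalanceLaw.measurable_limitSource hu (hδ n) (hσ n))
      (fun n => (hsrc n).1.bounded) fun n => (hsrc n).2
    exact ⟨g, hgG, hg.integrates hlip hG, hcont 0 le_rfl, hgm, ⟨G, fun p _ => hgG p⟩,
      hg.solves hlip hG le_rfl⟩
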